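/- \textbf{Theorem (Conservation of the stochastic symplectic form).} Let $Q$ be a finite-dimensional smooth Hausdorff, second countable manifold (without boundary), $a<b$, $(\Omega,\mathcal F,P)$ a probability space with a filtration $(\mathcal F_t)$, and $W_1,\dots,W_m$ independent Wiener processes on $[a,b]$ with respect to $(\mathcal F_t)$. Let $L:TQ\to\mathbb R$ and $\gamma_1,\dots,\gamma_m:Q\to\mathbb R$ be of class $C^2$. Assume that $v$ can be eliminated through the Legendre transform: for every $(q,p)\in T^*Q$ the equation $p=\frac{\partial L}{\partial v}(q,v)$ has exactly one solution $v\in T_qQ$, and $(q,v)\in TQ$ is a $C^1$ function of $(q,p)$. Let $F_t:T^*Q\to T^*Q$, $t\in[a,b]$, be the stochastic flow of the stochastic Hamilton--Pontryagin equations $$dq=v\,dt,\qquad dp=\frac{\partial L}{\partial q}\,dt+\sum_{i=1}^m\frac{\partial\gamma_i}{\partial q}\circ dW_i,\qquad p=\frac{\partial L}{\partial v}$$ (the second equation in local coordinates, $\circ$ the Stratonovich integral): almost surely $F_a=\mathrm{id}$ and $(t,z)\mapsto F_t(z)$ is continuous on $[a,b]\times T^*Q$, and for every $z\in T^*Q$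 the process $F_t(z)$ is the $(q,p)$-part of a continuous adapted solution $(q,v,p)$ in $TQ\oplus T^*Q$ of these equations on $[a,b]$. Let $\kappa=-\mathbf d\Theta$ be the canonical symplectic form of $T^*Q$, where $\Theta_{(q,p)}(w)=\langle p,T\pi(w)\rangle$ and $\pi:T^*Q\to Q$ is the projection. Call $(F_t)$ of class $C^1$ (for a given sample point) if every $F_t$, $t\in[a,b]$, is $C^1$ and $(t,u)\mapsto TF_t(u)$ is continuous on $[a,b]\times T(T^*Q)$. Then: 1. for almost every sample point the following holds: if $(F_t)$ is of class $C^1$, then $F_t^*\kappa=\kappa$ for all $t\in[a,b]$; 2. if moreover $\gamma_1,\dots,\gamma_m$ are of class $C^3$, then almost surely $(F_t)$ is of class $C^1$ and $F_t^*\kappa=\kappa$ for all $t\in[a,b]$. -/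

import Mathlib

open Set Filter Topology MeasureTheory ProbabilityTheory Bundle
open scoped Manifold ContDiff

noncomputable section

namespace StochasticHP

/-! ### The bundles `T*Q` and `TQ ⊕ T*Q`, and the Legendre transform -/

section Bundles

variable (E : Type*) [NormedAddCommGroup E] [NormedSpace ℝ E]
  (Q : Type*) [TopologicalSpace Q] [ChartedSpace E Q] [IsManifold 𝓘(ℝ, E) ∞ Q]

/-- The cotangent bundle `T*Q` of a manifold `Q` modelled on `E`; its elements are pairs
`⟨q, p⟩` with `p : T_q Q →L[ℝ] ℝ`. Topology and smooth structure are those of Mathlib's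
hom-bundle. -/
abbrev Cotangent : Type _ :=
  TotalSpace (E →L[ℝ] ℝ)
    (fun q : Q => TangentSpace 𝓘(ℝ, E) q →L[ℝ] Bundle.Trivial Q ℝ q)

/-- The model with corners of the manifold `T*Q`. -/
abbrev cotangentModel : ModelWithCorners ℝ (E × (E →L[ℝ] ℝ)) (ModelProd E (E →L[ℝ] ℝ)) :=
  𝓘(ℝ, E).prod 𝓘(ℝ, E →L[ℝ] ℝ)

/-- The Pontryagin bundle `TQ ⊕ T*Q`; its elements are `⟨q, (v, p)⟩`. -/
abbrev Pontryagin : Type _ :=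
  TotalSpace (E × (E →L[ℝ] ℝ))
    ((fun q : Q => TangentSpace 𝓘(ℝ, E) q) ×ᵇ
      (fun q : Q => TangentSpace 𝓘(ℝ, E) q →L[ℝ] Bundle.Trivial Q ℝ q))

variable {E Q}

/-- The projection `(q, v, p) ↦ (q, p)` from `TQ ⊕ T*Q` to `T*Q`. -/
def Pontryagin.toCotangent (c : Pontryagin E Q) : Cotangent E Q := ⟨c.proj, c.2.2⟩

/-- The fibre derivative `∂L/∂v (q, v) ∈ T*_q Q` of a Lagrangian `L : TQ → ℝ`. -/
def fiberDeriv (L : TangentBundle 𝓘(ℝ, E) Q → ℝ) (q : Q) (v : TangentSpace 𝓘(ℝ, E) q) :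
    TangentSpace 𝓘(ℝ, E) q →L[ℝ] ℝ :=
  fderiv ℝ (fun w : TangentSpace 𝓘(ℝ, E) q => L ⟨q, w⟩) v

/-- The Legendre transform `TQ → T*Q`, `(q, v) ↦ (q, ∂L/∂v (q, v))`. -/
def legendre (L : TangentBundle 𝓘(ℝ, E) Q → ℝ) (x : TangentBundle 𝓘(ℝ, E) Q) :
    Cotangent E Q :=
  ⟨x.proj, fiberDeriv L x.proj x.2⟩

/-- The velocity `v` can be eliminated through the Legendre transform: the equation
`p = ∂L/∂v (q, v)` has, for every `(q, p)`, a unique solution `v`, and `(q, v)` is a `C¹`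
function of `(q, p)`. -/
def CanEliminateVelocity (L : TangentBundle 𝓘(ℝ, E) Q → ℝ) : Prop :=
  ∃ V : Cotangent E Q → TangentBundle 𝓘(ℝ, E) Q,
    ContMDiff (cotangentModel E) 𝓘(ℝ, E).tangent 1 V ∧
    Function.LeftInverse V (legendre L) ∧ Function.RightInverse V (legendre L)

end Bundles

/-! ### The canonical symplectic form of `T*Q` -/

section Symplectic

variable {E : Type*} [NormedAddCommGroup E] [NormedSpace ℝ E]
  {Q : Type*} [TopologicalSpace Q] [ChartedSpace E Q] [IsManifold 𝓘(ℝ, E) ∞ Q]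

/-- The canonical one-form `Θ` on `T*Q`: `Θ_(q,p)(w) = ⟨p, dπ(w)⟩`, `π : T*Q → Q`. In bundle
coordinates it is `p dq`. -/
def canonicalOneForm (z : Cotangent E Q) : TangentSpace (cotangentModel E) z →L[ℝ] ℝ :=
  ContinuousLinearMap.comp (z.2 : TangentSpace 𝓘(ℝ, E) z.proj →L[ℝ] ℝ)
    (mfderiv (cotangentModel E) 𝓘(ℝ, E) (fun y : Cotangent E Q => y.proj) z)

/-- The canonical one-form read in the preferred chart of `T*Q` at `z`, as a differential
one-form on the model space `E × E*` (its pullback by the inverse of the chart). -/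
def canonicalOneFormInChart (z : Cotangent E Q) (x : E × (E →L[ℝ] ℝ)) :
    (E × (E →L[ℝ] ℝ)) [⋀^Fin 1]→L[ℝ] ℝ :=
  ContinuousAlternatingMap.ofSubsingleton ℝ (E × (E →L[ℝ] ℝ)) ℝ (0 : Fin 1)
    (ContinuousLinearMap.comp (canonicalOneForm ((extChartAt (cotangentModel E) z).symm x))
      (mfderiv 𝓘(ℝ, E × (E →L[ℝ] ℝ)) (cotangentModel E)
        (extChartAt (cotangentModel E) z).symm x))

/-- The canonical symplectic form `κ = -dΘ` on `T*Q`; in bundle coordinates `κ = dq ∧ dp`. -/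
def canonicalSymplecticForm (z : Cotangent E Q) (u w : TangentSpace (cotangentModel E) z) : ℝ :=
  - extDeriv (canonicalOneFormInChart z) (extChartAt (cotangentModel E) z z)
      ![mfderiv (cotangentModel E) 𝓘(ℝ, E × (E →L[ℝ] ℝ)) (extChartAt (cotangentModel E) z) z u,
        mfderiv (cotangentModel E) 𝓘(ℝ, E × (E →L[ℝ] ℝ)) (extChartAt (cotangentModel E) z) z w]

/-- `φ* κ = κ` for a map `φ : T*Q → T*Q`. -/
def PreservesSymplecticForm (φ : Cotangent E Q → Cotangent E Q) : Prop :=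
  ∀ (z : Cotangent E Q) (u w : TangentSpace (cotangentModel E) z),
    canonicalSymplecticForm (φ z)
        (mfderiv (cotangentModel E) (cotangentModel E) φ z u)
        (mfderiv (cotangentModel E) (cotangentModel E) φ z w)
      = canonicalSymplecticForm z u w

/-- The family `φ t`, `t ∈ [a, b]`, of maps of `T*Q` is of class `C¹` in the point and `C⁰` in
time: every `φ t` is `C¹` and the tangent maps `T(φ t)` depend continuously on time and point. -/
def IsC1Family (a b : ℝ) (φ : ℝ → Cotangent E Q → Cotangent E Q) : Prop :=
  (∀ t ∈ Icc a b, ContMDiff (cotangentModel E) (cotangentModel E) 1 (φ t)) ∧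
  ContinuousOn
    (fun x : ℝ × TangentBundle (cotangentModel E) (Cotangent E Q) =>
      tangentMap (cotangentModel E) (cotangentModel E) (φ x.1) x.2)
    (Icc a b ×ˢ univ)

end Symplectic

/-! ### Wiener processes and the Stratonovich integral -/

section Stochastic

variable {Ω : Type*} {mΩ : MeasurableSpace Ω}

/-- `W₁, …, W_m` are independent Wiener processes on `[a, b]` with respect to the filtration
`𝓕`: adapted, started from `0` at time `a`, with almost surely continuous paths, and with
increments over `[s, t]` that are independent of `𝓕 s` and have the law `N(0, (t - s) Id)`. -/
structure IsWienerFamily (P : Measure Ω) (𝓕 : Filtration ℝ mΩ) (a b : ℝ) {m : ℕ}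
    (W : Fin m → ℝ → Ω → ℝ) : Prop where
  adapted : ∀ i, ∀ t ∈ Icc a b, Measurable[𝓕 t] (W i t)
  start : ∀ i, ∀ᵐ η ∂P, W i a η = 0
  continuous : ∀ i, ∀ᵐ η ∂P, ContinuousOn (fun t => W i t η) (Icc a b)
  law : ∀ s ∈ Icc a b, ∀ t ∈ Icc a b, s ≤ t →
    HasLaw (fun η (i : Fin m) => W i t η - W i s η)
      (Measure.pi fun _ : Fin m => gaussianReal 0 (Real.toNNReal (t - s))) P
  indep : ∀ s ∈ Icc a b, ∀ t ∈ Icc a b, s ≤ t →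
    Indep (𝓕 s)
      (MeasurableSpace.comap (fun η (i : Fin m) => W i t η - W i s η) inferInstance) P

/-- `τ 0 = s ≤ τ 1 ≤ … ≤ τ N = t` is a partition of `[s, t]`. -/
def IsPartition (s t : ℝ) (N : ℕ) (τ : ℕ → ℝ) : Prop :=
  τ 0 = s ∧ τ N = t ∧ ∀ k < N, τ k ≤ τ (k + 1)

/-- The Stratonovich sum `∑ ½ (f(τ_{k+1}) + f(τ_k)) (B(τ_{k+1}) - B(τ_k))`. -/
def stratonovichSum {V : Type*} [NormedAddCommGroup V] [NormedSpace ℝ V]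
    (f : ℝ → Ω → V) (B : ℝ → Ω → ℝ) (N : ℕ) (τ : ℕ → ℝ) (η : Ω) : V :=
  ∑ k ∈ Finset.range N,
    (B (τ (k + 1)) η - B (τ k) η) • ((1 / 2 : ℝ) • (f (τ (k + 1)) η + f (τ k) η))

/-- `J = ∫_s^t f ∘ dB` on the event `A` (Stratonovich integral): on `A`, the Stratonovich sums
converge to `J` in probability along all sequences of partitions of `[s, t]` whose mesh tends
to `0`. -/
def HasStratonovichIntegralOn {V : Type*} [NormedAddCommGroup V] [NormedSpace ℝ V]
    (P : Measure Ω) (A : Set Ω) (f : ℝ → Ω → V) (B : ℝ → Ω → ℝ) (s t : ℝ) (J : Ω → V) : Prop :=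
  ∀ (N : ℕ → ℕ) (τ : ℕ → ℕ → ℝ), (∀ n, IsPartition s t (N n) (τ n)) →
    (∀ δ > 0, ∀ᶠ n in atTop, ∀ k < N n, τ n (k + 1) - τ n k < δ) →
    TendstoInMeasure (P.restrict A) (fun n => stratonovichSum f B (N n) (τ n)) atTop J

end Stochastic

/-! ### The stochastic Hamilton–Pontryagin equations -/

section Equations

variable {E : Type*} [NormedAddCommGroup E] [NormedSpace ℝ E]
  {Q : Type*} [TopologicalSpace Q] [ChartedSpace E Q] [IsManifold 𝓘(ℝ, E) ∞ Q]

/-- `∂L/∂q` at `(q, v)` in the coordinates of the chart `e` of `Q` (and the induced coordinates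
on `TQ`): the partial derivative of `(x, u) ↦ L (e⁻¹ x, D(e⁻¹)(x) u)` with respect to `x`. -/
def baseDerivInChart (L : TangentBundle 𝓘(ℝ, E) Q → ℝ) (e : OpenPartialHomeomorph Q E)
    (q : Q) (v : TangentSpace 𝓘(ℝ, E) q) : E →L[ℝ] ℝ :=
  fderiv ℝ
    (fun x : E => L ⟨e.symm x,
      mfderiv 𝓘(ℝ, E) 𝓘(ℝ, E) e.symm x (mfderiv 𝓘(ℝ, E) 𝓘(ℝ, E) e q v)⟩)
    (e q)

/-- `∂γ/∂q` at `q` in the coordinates of the chart `e`. -/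
def potentialDerivInChart (γ : Q → ℝ) (e : OpenPartialHomeomorph Q E) (q : Q) : E →L[ℝ] ℝ :=
  fderiv ℝ (fun x : E => γ (e.symm x)) (e q)

/-- The components of a covector `p ∈ T*_q Q` in the coordinates of the chart `e`. -/
def momentumInChart (e : OpenPartialHomeomorph Q E) (q : Q)
    (p : TangentSpace 𝓘(ℝ, E) q →L[ℝ] ℝ) : E →L[ℝ] ℝ :=
  ContinuousLinearMap.comp p (ContinuousLinearMap.inverse (mfderiv 𝓘(ℝ, E) 𝓘(ℝ, E) e q))

variable {Ω : Type*} {mΩ : MeasurableSpace Ω}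

/-- The process `c = (q, v, p)` in `TQ ⊕ T*Q` solves on `[a, b]` the stochastic
Hamilton–Pontryagin equations
`dq = v dt`, `dp = ∂L/∂q dt + ∑ᵢ ∂γᵢ/∂q ∘ dWᵢ`, `p = ∂L/∂v`.
The second equation is an equation in local coordinates: it is required in every smooth chart `e`
of `Q`, over every time interval `[s, t]`, on the event that `q` stays in the domain of `e` during
`[s, t]`. -/
structure IsSolution (L : TangentBundle 𝓘(ℝ, E) Q → ℝ) {m : ℕ} (γ : Fin m → Q → ℝ)
    (P : Measure Ω) (𝓕 : Filtration ℝ mΩ) (W : Fin m → ℝ → Ω → ℝ) (a b : ℝ)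
    (c : ℝ → Ω → Pontryagin E Q) : Prop where
  adapted : ∀ t ∈ Icc a b, Measurable[𝓕 t, borel (Pontryagin E Q)] (c t)
  continuous : ∀ᵐ η ∂P, ContinuousOn (fun t => c t η) (Icc a b)
  kinematic : ∀ᵐ η ∂P, ∀ t ∈ Icc a b,
    HasMFDerivWithinAt 𝓘(ℝ, ℝ) 𝓘(ℝ, E) (fun r => (c r η).proj) (Icc a b) t
      ((1 : ℝ →L[ℝ] ℝ).smulRight (c t η).2.1)
  momentum : ∀ e ∈ IsManifold.maximalAtlas 𝓘(ℝ, E) ∞ Q,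
    ∀ s ∈ Icc a b, ∀ t ∈ Icc a b, s ≤ t → ∃ J : Fin m → Ω → (E →L[ℝ] ℝ),
      (∀ i, HasStratonovichIntegralOn P {η | ∀ r ∈ Icc s t, (c r η).proj ∈ e.source}
        (fun r η => potentialDerivInChart (γ i) e (c r η).proj) (W i) s t (J i)) ∧
      ∀ᵐ η ∂P, (∀ r ∈ Icc s t, (c r η).proj ∈ e.source) →
        momentumInChart e (c t η).proj (c t η).2.2 - momentumInChart e (c s η).proj (c s η).2.2
          = (∫ r in s..t, baseDerivInChart L e (c r η).proj (c r η).2.1) + ∑ i, J i η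
  legendre : ∀ᵐ η ∂P, ∀ t ∈ Icc a b, (c t η).2.2 = fiberDeriv L (c t η).proj (c t η).2.1

/-- `F` is the stochastic flow on `T*Q` of the stochastic Hamilton–Pontryagin equations on
`[a, b]`: almost surely `F_a` is the identity and `F_t(z)` is continuous in `(t, z)`, and, for
every initial condition `z = (q, p)`, the process `F_t(z)` is the `(q, p)`-part of a solution
`(q, v, p)` of the equations. -/
structure IsStochasticFlow (L : TangentBundle 𝓘(ℝ, E) Q → ℝ) {m : ℕ} (γ : Fin m → Q → ℝ)
    (P : Measure Ω) (𝓕 : Filtration ℝ mΩ) (W : Fin m → ℝ → Ω → ℝ) (a b : ℝ)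
    (F : ℝ → Ω → Cotangent E Q → Cotangent E Q) : Prop where
  start : ∀ᵐ η ∂P, ∀ z, F a η z = z
  continuous : ∀ᵐ η ∂P,
    ContinuousOn (fun x : ℝ × Cotangent E Q => F x.1 η x.2) (Icc a b ×ˢ univ)
  solves : ∀ z, ∃ c : ℝ → Ω → Pontryagin E Q, IsSolution L γ P 𝓕 W a b c ∧
    ∀ᵐ η ∂P, ∀ t ∈ Icc a b, (c t η).toCotangent = F t η z

end Equations

end StochasticHP

end

/-! The theorem is proved path by path. Along a solution, `q` is `C¹` in time with velocity `v =
V(q, p)`, so the Stratonovich integrand `dγᵢ(q)` is `C¹` in time. Integration by parts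
(`HasStratonovichIntegralOn.ae_eq`) then turns `∫ dγᵢ(q) ∘ dWᵢ` into `[Wᵢ dγᵢ(q)] - ∫ Wᵢ D(dγᵢ)(q) v
dt`, an expression that makes sense for each continuous noise path. Hence the shifted momentum `p̃ =
p - ∑ Wᵢ dγᵢ(q)` satisfies an ordinary integral equation. This holds almost surely for one initial
point, one chart and one time interval. Countable dense sets, together with the assumed joint
continuity of the flow, give a single null set for all of them
(`IsStochasticFlow.ae_satisfiesEquation`). What remains is deterministic and concerns an
`IsDrivenFlow`.

For conservation, let `ℓ = L(q, v) - ∑ wᵢ dγᵢ(q) v`. The Legendre relation and the symmetry of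
second derivatives give `dℓ = (dp̃/dt) dq + p̃ dv`, so `∫ dℓ dt` is the increment of `p̃ dq`
(`hasFDerivAt_action`). The difference `p dq - p̃ dq = ∑ wᵢ d(γᵢ(q))` is exact at each fixed time,
so the increment of `p dq` is exact (`exists_hasFDerivAt_increment`). Exactness near a point is
transitive in time, and connectedness of `[a, b]` carries it across changes of chart. Since the flow
is only `C¹`, the form `F_t^* Θ` cannot be differentiated naively; `wedge_eq_of_exact` obtains the
equality of two-forms from the symmetry of the second derivative of a corrected primitive.

For smoothness, `C³` potentials make the field of the shifted equation `C¹` in the state. The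
difference of two trajectories solves a linear equation whose resolvent depends continuously on both
initial points, and this gives the derivative of the flow (`exists_hasFDerivAt_flow`). Local steps
are again joined by connectedness of `[a, b]`, starting from `F_a = id`. Neither part uses
uniqueness of solutions of the nonlinear equations: the flow is given and continuous. -/

namespace StochasticHP

/-! ### Differential calculus: exactness at low regularity, integrals with parameters, first
variation. -/

section Calculus

variable {Y : Type*} [NormedAddCommGroup Y] [NormedSpace ℝ Y]
  {Z : Type*} [NormedAddCommGroup Z] [NormedSpace ℝ Z]
  {E : Type*} [NormedAddCommGroup E] [NormedSpace ℝ E]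
  {G : Type*} [NormedAddCommGroup G] [NormedSpace ℝ G]

/-- The product of a differentiable map vanishing at a point with a map that is merely continuous
there is differentiable at this point. -/
theorem hasFDerivAt_bilinear_of_eq_zero (b : Z →L[ℝ] E →L[ℝ] G) {f : Y → Z} {f' : Y →L[ℝ] Z}
    {d : Y → E} {y₀ : Y} (hf : HasFDerivAt f f' y₀) (hf0 : f y₀ = 0) (hd : ContinuousAt d y₀) :
    HasFDerivAt (fun y => b (f y) (d y)) ((b.flip (d y₀)).comp f') y₀ := by
  have h1 : HasFDerivAt (fun y => b (f y) (d y₀)) ((b.flip (d y₀)).comp f') y₀ :=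
    (b.flip (d y₀)).hasFDerivAt.comp y₀ hf
  -- Here `f y = O(y - y₀)` because `f` vanishes at `y₀`, and `d y - d y₀ = o(1)`; the product is
  -- `o(y - y₀)`.
  have h2 : HasFDerivAt (fun y => b (f y) (d y - d y₀)) (0 : Y →L[ℝ] G) y₀ := by
    rw [hasFDerivAt_iff_isLittleO]
    simp only [hf0, map_zero, zero_apply, sub_self, sub_zero]
    have hO : (fun y => f y) =O[𝓝 y₀] fun y => y - y₀ := by
      simpa [hf0] using hf.isBigO_sub
    have ho : (fun y => d y - d y₀) =o[𝓝 y₀] fun _ => (1 : ℝ) := by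
      rw [Asymptotics.isLittleO_one_iff]
      simpa using hd.tendsto.sub_const (d y₀)
    have hb : (fun y => b (f y) (d y - d y₀)) =O[𝓝 y₀] fun y => ‖f y‖ * ‖d y - d y₀‖ := by
      refine Asymptotics.IsBigO.of_bound ‖b‖ (Eventually.of_forall fun y => ?_)
      rw [Real.norm_of_nonneg (by positivity), ← mul_assoc]
      exact b.le_opNorm₂ _ _
    refine hb.trans_isLittleO ?_
    simpa using (hO.norm_norm.mul_isLittleO ho.norm_left).norm_right
  refine (h1.add h2).congr_of_eventuallyEq (Eventually.of_forall fun y => ?_) |>.congr_fderiv ?_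
  · simp
  · simp

/-- If `p dq - p₂ dq₂` is exact near `y₀` then `dp ∧ dq = dp₂ ∧ dq₂` at `y₀`; the maps are only
once differentiable, the potential is only assumed to be a primitive. -/
theorem wedge_eq_of_exact {p p₂ : Y → E →L[ℝ] ℝ} {q q₂ : Y → E} {q' q₂' : Y → Y →L[ℝ] E}
    {p' p₂' : Y →L[ℝ] E →L[ℝ] ℝ} {S : Y → ℝ} {y₀ : Y}
    (hq : ∀ᶠ y in 𝓝 y₀, HasFDerivAt q (q' y) y) (hq' : ContinuousAt q' y₀)
    (hp : HasFDerivAt p p' y₀)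
    (hq₂ : ∀ᶠ y in 𝓝 y₀, HasFDerivAt q₂ (q₂' y) y) (hq₂' : ContinuousAt q₂' y₀)
    (hp₂ : HasFDerivAt p₂ p₂' y₀)
    (hS : ∀ᶠ y in 𝓝 y₀, HasFDerivAt S ((p y).comp (q' y) - (p₂ y).comp (q₂' y)) y) (u w : Y) :
    p' u (q' y₀ w) - p' w (q' y₀ u) = p₂' u (q₂' y₀ w) - p₂' w (q₂' y₀ u) := by
  have key : ∀ (p : Y → E →L[ℝ] ℝ) (q' : Y → Y →L[ℝ] E) (p' : Y →L[ℝ] E →L[ℝ] ℝ),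
      ContinuousAt q' y₀ → HasFDerivAt p p' y₀ →
      HasFDerivAt (fun y => (p y - p y₀).comp (q' y))
        (((ContinuousLinearMap.compL ℝ Y E ℝ).flip (q' y₀)).comp p') y₀ := by
    intro p q' p' hq' hp
    exact hasFDerivAt_bilinear_of_eq_zero (ContinuousLinearMap.compL ℝ Y E ℝ)
      (hp.sub_const (p y₀)) (sub_self _) hq'
  have h := (key p q' p' hq' hp).sub (key p₂ q₂' p₂' hq₂' hp₂)
  -- Correcting `S` by the functions `p y₀ ∘ q` and `p₂ y₀ ∘ q₂` replaces the coefficients `p`, `p₂`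
  -- by ones that vanish at `y₀`. The derivative of the corrected primitive is then differentiable
  -- at `y₀` although `q'` and `q₂'` are only continuous, and the symmetry of this second derivative
  -- is the claim.
  have hT : ∀ᶠ y in 𝓝 y₀, HasFDerivAt (fun y => S y - p y₀ (q y) + p₂ y₀ (q₂ y))
      ((p y - p y₀).comp (q' y) - (p₂ y - p₂ y₀).comp (q₂' y)) y := by
    filter_upwards [hq, hq₂, hS] with y h1 h2 h3
    refine ((h3.sub ((p y₀).hasFDerivAt.comp y h1)).add
      ((p₂ y₀).hasFDerivAt.comp y h2)).congr_fderiv ?_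
    ext v
    simp
    ring
  have := second_derivative_symmetric_of_eventually hT h u w
  simp at this
  linarith

variable {s t : ℝ}

/-- The tube lemma for a map that is jointly continuous on a product set. -/
theorem eventually_forall_mem_of_continuousOn {R X M : Type*} [TopologicalSpace R]
    [TopologicalSpace X] [TopologicalSpace M] {K : Set R} (hK : IsCompact K) {U : Set X}
    (hU : IsOpen U) {f : R → X → M}
    (hf : ContinuousOn (fun x : R × X => f x.1 x.2) (K ×ˢ U)) {O : Set M} (hO : IsOpen O)
    {y₀ : X} (hy₀ : y₀ ∈ U) (h : ∀ r ∈ K, f r y₀ ∈ O) :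
    ∀ᶠ y in 𝓝 y₀, ∀ r ∈ K, f r y ∈ O := by
  have := hK.eventually_forall_of_forall_eventually
    (x₀ := y₀) (P := fun y r => r ∈ K → f r y ∈ O) ?_
  · filter_upwards [this] with y hy r hr using hy r hr hr
  · intro r hr
    have h1 := (hf (r, y₀) ⟨hr, hy₀⟩).eventually (hO.mem_nhds (h r hr))
    rw [eventually_nhdsWithin_iff] at h1
    have hsw : Tendsto (Prod.swap : X × R → R × X) (𝓝 (y₀, r)) (𝓝 (r, y₀)) :=
      continuous_swap.tendsto _
    filter_upwards [hsw.eventually h1,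
      continuous_fst.continuousAt.eventually (hU.mem_nhds hy₀)] with x hx hxU hxK
    exact hx ⟨hxK, hxU⟩

/-- An interval integral of a jointly continuous function depends continuously on parameters. -/
theorem continuousOn_intervalIntegral_of_continuousOn {X : Type*} [TopologicalSpace X]
    [CompleteSpace G] (hst : s ≤ t) {U : Set X} {f : ℝ → X → G}
    (hf : ContinuousOn (fun x : ℝ × X => f x.1 x.2) (Icc s t ×ˢ U)) :
    ContinuousOn (fun y => ∫ r in s..t, f r y) U := by
  rw [continuousOn_iff_continuous_domRestrict]
  have hc : Continuous (Function.uncurry fun (y : U) (r : ℝ) => f (projIcc s t hst r) y) := by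
    refine hf.comp_continuous (f := fun x : U × ℝ => ((projIcc s t hst x.2 : ℝ), (x.1 : X)))
      (by fun_prop) fun x => ⟨(projIcc s t hst x.2).2, x.1.2⟩
  refine (intervalIntegral.continuous_parametric_intervalIntegral_of_continuous' (μ := volume) hc s t).congr ?_
  intro y
  refine intervalIntegral.integral_congr fun r hr => ?_
  rw [uIcc_of_le hst] at hr
  simp [projIcc_of_mem hst hr]

/-- Differentiation under the integral sign, for a jointly continuous derivative. -/
theorem hasFDerivAt_intervalIntegral_of_continuousOn [CompleteSpace G] (hst : s ≤ t) {U : Set Y}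
    (hU : IsOpen U) {f : ℝ → Y → G} {f' : ℝ → Y → Y →L[ℝ] G}
    (hf : ∀ y ∈ U, ContinuousOn (fun r => f r y) (Icc s t))
    (hd : ∀ r ∈ Icc s t, ∀ y ∈ U, HasFDerivAt (f r) (f' r y) y)
    (hf' : ContinuousOn (fun x : ℝ × Y => f' x.1 x.2) (Icc s t ×ˢ U)) {y₀ : Y} (hy₀ : y₀ ∈ U) :
    HasFDerivAt (fun y => ∫ r in s..t, f r y) (∫ r in s..t, f' r y₀) y₀ := by
  have hslice : ContinuousOn (fun r => f' r y₀) (Icc s t) :=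
    hf'.comp (f := fun r => (r, y₀)) (by fun_prop) fun r hr => ⟨hr, hy₀⟩
  obtain ⟨C, hC⟩ := isCompact_Icc.exists_bound_of_continuousOn hslice
  -- The bound `C` holds along `y₀` only; the tube lemma extends the strict bound `C + 1` to a
  -- neighbourhood, uniformly in time, which gives the dominating constant.
  have hV : ∀ᶠ y in 𝓝 y₀, ∀ r ∈ Icc s t, f' r y ∈ Metric.ball 0 (C + 1) :=
    eventually_forall_mem_of_continuousOn isCompact_Icc hU hf' Metric.isOpen_ball hy₀ fun r hr => by
      simpa using (hC r hr).trans_lt (lt_add_one C)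
  have hioc : ∀ r ∈ uIoc s t, r ∈ Icc s t := by
    rw [uIoc_of_le hst]
    exact fun r hr => Ioc_subset_Icc_self hr
  have hmeas : ∀ y ∈ U, AEStronglyMeasurable (fun r => f r y) (volume.restrict (uIoc s t)) :=
    fun y hy => ((hf y hy).intervalIntegrable_of_Icc hst).def'.aestronglyMeasurable
  refine intervalIntegral.hasFDerivAt_integral_of_dominated_of_fderiv_le (μ := volume)
    (F' := fun y r => f' r y) (bound := fun _ => C + 1)
    (Filter.inter_mem (hU.mem_nhds hy₀) hV) ?_ ?_ ?_ ?_ ?_ ?_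
  · filter_upwards [hU.mem_nhds hy₀] with y hy using hmeas y hy
  · exact (hf y₀ hy₀).intervalIntegrable_of_Icc hst
  · exact (hslice.intervalIntegrable_of_Icc hst).def'.aestronglyMeasurable
  · refine Eventually.of_forall fun r hr y hy => ?_
    simpa using (mem_ball_zero_iff.1 (hy.2 r (hioc r hr))).le
  · exact intervalIntegrable_const
  · exact Eventually.of_forall fun r hr y hy => hd r (hioc r hr) y hy.1

theorem continuousOn_slice {R X M : Type*} [TopologicalSpace R] [TopologicalSpace X]
    [TopologicalSpace M] {K : Set R} {U : Set X} {φ : R → X → M}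
    (hφ : ContinuousOn (fun x : R × X => φ x.1 x.2) (K ×ˢ U)) {y : X} (hy : y ∈ U) :
    ContinuousOn (fun r => φ r y) K :=
  hφ.comp (f := fun r => (r, y)) (by fun_prop) fun _ hr => ⟨hr, hy⟩

theorem hasDerivAt_of_sub_eq_integral [CompleteSpace G] {φ ψ : ℝ → G}
    (hψ : ContinuousOn ψ (Icc s t)) (hφ : ∀ r ∈ Icc s t, φ r - φ s = ∫ x in s..r, ψ x) :
    ∀ r ∈ Ioo s t, HasDerivAt φ (ψ r) r := by
  intro r hr
  have h1 : HasDerivAt (fun r => φ s + ∫ x in s..r, ψ x) (ψ r) r := by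
    refine (intervalIntegral.integral_hasDerivAt_right ?_ ?_ ?_).const_add _
    · exact (hψ.mono (Icc_subset_Icc_right hr.2.le)).intervalIntegrable_of_Icc hr.1.le
    · exact (hψ.mono Ioo_subset_Icc_self).stronglyMeasurableAtFilter isOpen_Ioo r hr
    · exact hψ.continuousAt (Icc_mem_nhds hr.1 hr.2)
  refine h1.congr_of_eventuallyEq ?_
  filter_upwards [Ioo_mem_nhds hr.1 hr.2] with x hx
  rw [← hφ x (Ioo_subset_Icc_self hx)]
  abel

/-- First variation of an action integral. If `ξ` is a primitive of `u` and `c` a primitive of `k`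
in time, and `f` is a Lagrangian with derivative `k ∘ ξ' + c ∘ u'` in the parameter, then the
derivative of the action is the increment of `c ∘ ξ'`. -/
theorem hasFDerivAt_action [CompleteSpace E] (hst : s ≤ t) {U : Set Y} (hU : IsOpen U)
    {ξ u : ℝ → Y → E} {ξ' u' : ℝ → Y → Y →L[ℝ] E} {c k : ℝ → Y → E →L[ℝ] ℝ} {f : ℝ → Y → ℝ}
    (hf : ∀ y ∈ U, ContinuousOn (fun r => f r y) (Icc s t))
    (hξ : ∀ r ∈ Icc s t, ∀ y ∈ U, HasFDerivAt (ξ r) (ξ' r y) y)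
    (hu : ∀ r ∈ Icc s t, ∀ y ∈ U, HasFDerivAt (u r) (u' r y) y)
    (hξ' : ContinuousOn (fun x : ℝ × Y => ξ' x.1 x.2) (Icc s t ×ˢ U))
    (huc : ContinuousOn (fun x : ℝ × Y => u x.1 x.2) (Icc s t ×ˢ U))
    (hu' : ContinuousOn (fun x : ℝ × Y => u' x.1 x.2) (Icc s t ×ˢ U))
    (hc : ContinuousOn (fun x : ℝ × Y => c x.1 x.2) (Icc s t ×ˢ U))
    (hk : ContinuousOn (fun x : ℝ × Y => k x.1 x.2) (Icc s t ×ˢ U))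
    (hξu : ∀ r ∈ Icc s t, ∀ y ∈ U, ξ r y - ξ s y = ∫ x in s..r, u x y)
    (hck : ∀ r ∈ Icc s t, ∀ y ∈ U, c r y - c s y = ∫ x in s..r, k x y)
    (hfd : ∀ r ∈ Icc s t, ∀ y ∈ U,
      HasFDerivAt (f r) ((k r y).comp (ξ' r y) + (c r y).comp (u' r y)) y)
    {y₀ : Y} (hy₀ : y₀ ∈ U) :
    HasFDerivAt (fun y => ∫ r in s..t, f r y)
      ((c t y₀).comp (ξ' t y₀) - (c s y₀).comp (ξ' s y₀)) y₀ := by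
  -- Variation commutes with the time integral, so the variation of `ξ` is a primitive of the
  -- variation of `u`. With this, `k ∘ ξ' + c ∘ u'` is the time derivative of `c ∘ ξ'`.
  have hξu' : ∀ r ∈ Icc s t, ξ' r y₀ - ξ' s y₀ = ∫ x in s..r, u' x y₀ := by
    intro r hr
    have hsub : Icc s r ⊆ Icc s t := Icc_subset_Icc_right hr.2
    have h1 := hasFDerivAt_intervalIntegral_of_continuousOn hr.1 hU (f := u) (f' := u')
      (fun y hy => (continuousOn_slice huc hy).mono hsub) (fun x hx => hu x (hsub hx))
      (hu'.mono (prod_mono_left hsub)) hy₀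
    have h2 := (hξ r hr y₀ hy₀).sub (hξ s (left_mem_Icc.2 hst) y₀ hy₀)
    refine h2.unique (h1.congr_of_eventuallyEq ?_)
    filter_upwards [hU.mem_nhds hy₀] with y hy using hξu r hr y hy
  refine (hasFDerivAt_intervalIntegral_of_continuousOn hst hU hf hfd ?_ hy₀).congr_fderiv ?_
  · exact (hk.clm_comp hξ').add (hc.clm_comp hu')
  · refine intervalIntegral.integral_eq_sub_of_hasDerivAt_of_le hst
      (f := fun r => (c r y₀).comp (ξ' r y₀)) ?_ ?_ ?_
    · exact (continuousOn_slice hc hy₀).clm_comp (continuousOn_slice hξ' hy₀)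
    · intro r hr
      exact (hasDerivAt_of_sub_eq_integral (continuousOn_slice hk hy₀)
        (fun r hr => hck r hr y₀ hy₀) r hr).clm_comp
        (hasDerivAt_of_sub_eq_integral (continuousOn_slice hu' hy₀) hξu' r hr)
    · refine ContinuousOn.intervalIntegrable_of_Icc hst ?_
      exact ((continuousOn_slice hk hy₀).clm_comp (continuousOn_slice hξ' hy₀)).add
        ((continuousOn_slice hc hy₀).clm_comp (continuousOn_slice hu' hy₀))

end Calculus

/-! ### Stratonovich integrals of integrands that are `C¹` in time. -/

section Stratonovich

variable {V : Type*} [NormedAddCommGroup V] [NormedSpace ℝ V] {s t : ℝ}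

theorem IsPartition.mem_Icc {N : ℕ} {τ : ℕ → ℝ} (h : IsPartition s t N τ) {k : ℕ} (hk : k ≤ N) :
    τ k ∈ Icc s t := by
  have hmono : ∀ i j, i ≤ j → j ≤ N → τ i ≤ τ j := by
    intro i j hij
    induction j, hij using Nat.le_induction with
    | base => exact fun _ => le_rfl
    | succ j _ ih => exact fun hj => (ih (by omega)).trans (h.2.2 j (by omega))
  exact ⟨h.1 ▸ hmono 0 k (Nat.zero_le k) hk, h.2.1 ▸ hmono k N hk le_rfl⟩

/-- Summation by parts in a Stratonovich sum. -/
theorem stratonovichSum_eq {Ω : Type*} (f : ℝ → Ω → V) (B : ℝ → Ω → ℝ) (N : ℕ) (τ : ℕ → ℝ)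
    (η : Ω) :
    stratonovichSum f B N τ η = B (τ N) η • f (τ N) η - B (τ 0) η • f (τ 0) η -
      ∑ k ∈ Finset.range N, ((1 / 2 : ℝ) * (B (τ (k + 1)) η + B (τ k) η)) •
        (f (τ (k + 1)) η - f (τ k) η) := by
  rw [eq_sub_iff_add_eq, stratonovichSum, ← Finset.sum_add_distrib,
    ← Finset.sum_range_sub (fun k => B (τ k) η • f (τ k) η)]
  refine Finset.sum_congr rfl fun k _ => ?_
  module

/-- For an integrand that is `C¹` in time the Stratonovich sums converge pathwise. -/
theorem tendsto_stratonovichSum [CompleteSpace V] {Ω : Type*} {f : ℝ → Ω → V} {B : ℝ → Ω → ℝ}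
    {η : Ω} {f' : ℝ → V} (hst : s ≤ t)
    (hB : ContinuousOn (fun r => B r η) (Icc s t)) (hf' : ContinuousOn f' (Icc s t))
    (hf : ∀ r ∈ Icc s t, HasDerivWithinAt (fun r => f r η) (f' r) (Icc s t) r)
    {N : ℕ → ℕ} {τ : ℕ → ℕ → ℝ} (hτ : ∀ n, IsPartition s t (N n) (τ n))
    (hmesh : ∀ δ > 0, ∀ᶠ n in atTop, ∀ k < N n, τ n (k + 1) - τ n k < δ) :
    Tendsto (fun n => stratonovichSum f B (N n) (τ n) η) atTop
      (𝓝 (B t η • f t η - B s η • f s η - ∫ r in s..t, B r η • f' r)) := by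
  obtain ⟨C, hC⟩ := isCompact_Icc.exists_bound_of_continuousOn hf'
  have hC0 : 0 ≤ C := (norm_nonneg _).trans (hC s (left_mem_Icc.2 hst))
  have huc := isCompact_Icc.uniformContinuousOn_of_continuous hB
  rw [Metric.uniformContinuousOn_iff_le] at huc
  simp_rw [stratonovichSum_eq, fun n => (hτ n).1, fun n => (hτ n).2.1]
  refine tendsto_const_nhds.sub ?_
  rw [Metric.tendsto_atTop']
  intro ε hε
  -- The final error is at most this oscillation of `B` times `C * (t - s)`, hence below `ε`; the
  -- added ones keep the denominator positive when `C = 0` or `s = t`.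
  obtain ⟨δ, hδ, hδB⟩ := huc (ε / (2 * (C + 1) * (t - s + 1))) (by
    have : 0 < t - s + 1 := by linarith
    positivity)
  obtain ⟨n₀, hn₀⟩ := eventually_atTop.1 (hmesh δ hδ)
  refine ⟨n₀, fun n hn => ?_⟩
  set ε' := ε / (2 * (C + 1) * (t - s + 1)) with hε'
  have hsmall := hn₀ n hn.le
  have hmem : ∀ k ≤ N n, τ n k ∈ Icc s t := fun k hk => (hτ n).mem_Icc hk
  have hsub : ∀ k < N n, Icc (τ n k) (τ n (k + 1)) ⊆ Icc s t := fun k hk =>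
    Icc_subset_Icc (hmem k hk.le).1 (hmem (k + 1) hk).2
  have hBf : ContinuousOn (fun r => B r η • f' r) (Icc s t) := hB.smul hf'
  have hint : ∀ {φ : ℝ → V}, ContinuousOn φ (Icc s t) → ∀ k < N n,
      IntervalIntegrable φ volume (τ n k) (τ n (k + 1)) := fun hφ k hk =>
    (hφ.mono (hsub k hk)).intervalIntegrable_of_Icc ((hτ n).2.2 k hk)
  have hsum : ∫ r in s..t, B r η • f' r =
      ∑ k ∈ Finset.range (N n), ∫ r in (τ n k)..(τ n (k + 1)), B r η • f' r := by
    rw [intervalIntegral.sum_integral_adjacent_intervals fun k hk => hint hBf k hk, (hτ n).1,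
      (hτ n).2.1]
  rw [hsum, dist_eq_norm, ← Finset.sum_sub_distrib]
  -- On a cell the increment of `f` is the integral of `f'`, and the mean of the two end values of
  -- `B` is within `ε'` of every value of `B` on the cell. Only uniform continuity of the path `B`
  -- is used, no bound on its variation.
  have hterm : ∀ k ∈ Finset.range (N n),
      ‖((1 / 2 : ℝ) * (B (τ n (k + 1)) η + B (τ n k) η)) • (f (τ n (k + 1)) η - f (τ n k) η) -
        ∫ r in (τ n k)..(τ n (k + 1)), B r η • f' r‖ ≤ ε' * C * (τ n (k + 1) - τ n k) := by
    intro k hk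
    rw [Finset.mem_range] at hk
    have hle := (hτ n).2.2 k hk
    have hftc : f (τ n (k + 1)) η - f (τ n k) η = ∫ r in (τ n k)..(τ n (k + 1)), f' r := by
      refine (intervalIntegral.integral_eq_sub_of_hasDerivAt_of_le hle
        (fun r hr => ((hf r (hsub k hk hr)).continuousWithinAt.mono (hsub k hk)))
        (fun r hr => ?_) (hint hf' k hk)).symm
      refine (hf r (hsub k hk (Ioo_subset_Icc_self hr))).hasDerivAt ?_
      exact mem_of_superset (Icc_mem_nhds hr.1 hr.2) (hsub k hk)
    have hcf : ContinuousOn (fun r => ((1 / 2 : ℝ) * (B (τ n (k + 1)) η + B (τ n k) η)) • f' r)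
        (Icc s t) := hf'.const_smul _
    rw [hftc, ← intervalIntegral.integral_smul, ← intervalIntegral.integral_sub
      (hint hcf k hk) (hint hBf k hk)]
    refine (intervalIntegral.norm_integral_le_of_norm_le_const (C := ε' * C) fun r hr => ?_).trans
      (by rw [abs_of_nonneg (sub_nonneg.2 hle)])
    rw [uIoc_of_le hle] at hr
    have hr' : r ∈ Icc (τ n k) (τ n (k + 1)) := Ioc_subset_Icc_self hr
    rw [← sub_smul, norm_smul]
    have hd := hsmall k hk
    have h1 := hδB _ (hmem (k + 1) hk) r (hsub k hk hr') (by
      rw [Real.dist_eq, abs_le]; constructor <;> linarith [hr'.1, hr'.2])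
    have h2 := hδB _ (hmem k hk.le) r (hsub k hk hr') (by
      rw [Real.dist_eq, abs_le]; constructor <;> linarith [hr'.1, hr'.2])
    rw [Real.dist_eq, abs_le] at h1 h2
    refine mul_le_mul ?_ (hC r (hsub k hk hr')) (norm_nonneg _) (by positivity)
    rw [Real.norm_eq_abs, abs_le]
    constructor <;> linarith [h1.1, h1.2, h2.1, h2.2]
  refine (norm_sum_le_of_le _ hterm).trans_lt ?_
  rw [← Finset.mul_sum, Finset.sum_range_sub, (hτ n).1, (hτ n).2.1, hε']
  have h1 : 0 < t - s + 1 := by linarith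
  rw [div_mul_eq_mul_div, div_mul_eq_mul_div, div_lt_iff₀ (by positivity)]
  nlinarith [mul_nonneg hC0 (sub_nonneg.2 hst), mul_pos hε h1, mul_nonneg hε.le hC0,
    mul_nonneg hε.le (mul_nonneg hC0 (sub_nonneg.2 hst)), mul_nonneg hε.le (sub_nonneg.2 hst)]

/-- On an event on which the integrand is `C¹` in time, the Stratonovich integral is almost surely
given by integration by parts. -/
theorem HasStratonovichIntegralOn.ae_eq [CompleteSpace V] {Ω : Type*} {mΩ : MeasurableSpace Ω}
    {P : Measure Ω} {A : Set Ω} {f : ℝ → Ω → V} {B : ℝ → Ω → ℝ} {J : Ω → V} (hst : s ≤ t)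
    (h : HasStratonovichIntegralOn P A f B s t J) (f' : ℝ → Ω → V) :
    ∀ᵐ η ∂P, η ∈ A → ContinuousOn (fun r => B r η) (Icc s t) →
      ContinuousOn (fun r => f' r η) (Icc s t) →
      (∀ r ∈ Icc s t, HasDerivWithinAt (fun r => f r η) (f' r η) (Icc s t) r) →
      J η = B t η • f t η - B s η • f s η - ∫ r in s..t, B r η • f' r η := by
  -- Equidistant partitions with `n + 1` cells, so that the cell length is defined for every `n`.
  set N : ℕ → ℕ := fun n => n + 1
  set τ : ℕ → ℕ → ℝ := fun n k => s + (k / (n + 1 : ℝ)) * (t - s)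
  have hτ : ∀ n, IsPartition s t (N n) (τ n) := by
    intro n
    have hn : (0 : ℝ) < n + 1 := by positivity
    refine ⟨by simp [τ], ?_, fun k _ => ?_⟩
    · simp only [τ, N, Nat.cast_add, Nat.cast_one, div_self hn.ne']
      ring
    · simp only [τ]
      gcongr
      · linarith
  have hmesh : ∀ δ > 0, ∀ᶠ n in atTop, ∀ k < N n, τ n (k + 1) - τ n k < δ := by
    intro δ hδ
    have hlim : Tendsto (fun n : ℕ => (t - s) * (1 / ((n : ℝ) + 1))) atTop (𝓝 0) := by
      simpa using tendsto_one_div_add_atTop_nhds_zero_nat.const_mul (t - s)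
    filter_upwards [hlim.eventually (gt_mem_nhds hδ)] with n hn k _
    refine lt_of_eq_of_lt ?_ hn
    simp only [τ, Nat.cast_add, Nat.cast_one]
    ring
  -- A subsequence converges almost everywhere on `A`, and its limit must be the pathwise one.
  -- Passing from the restricted measure to an implication does not require `A` to be measurable.
  obtain ⟨ns, hns, hlim⟩ := (h N τ hτ hmesh).exists_seq_tendsto_ae
  filter_upwards [ae_imp_of_ae_restrict hlim] with η hη hA hB hf' hf
  exact tendsto_nhds_unique (hη hA)
    ((tendsto_stratonovichSum hst hB hf' hf hτ hmesh).comp hns.tendsto_atTop)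

end Stratonovich

/-! ### Differentiability of a continuous flow in its initial condition. -/

section FlowDifferentiability

variable {Y : Type*} [NormedAddCommGroup Y] [NormedSpace ℝ Y]
  {Z : Type*} [NormedAddCommGroup Z] [NormedSpace ℝ Z] [CompleteSpace Z] {α β : ℝ}

open scoped BoundedContinuousFunction

/-- Linear integral equations on a short time interval, depending continuously on a parameter,
have solutions depending continuously on the parameter. -/
theorem exists_resolvent {K : Type*} [TopologicalSpace K] (hαβ : α ≤ β)
    {A : Icc α β × K → Z →L[ℝ] Z} (hA : Continuous A) {M : ℝ} (hAM : ∀ x, ‖A x‖ ≤ M)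
    (hM : M * (β - α) ≤ 1 / 2) (s : Icc α β) :
    ∃ R : Icc α β × K → Z →L[ℝ] Z, Continuous R ∧ ∀ r κ,
      R (r, κ) = ContinuousLinearMap.id ℝ Z +
        ∫ x in (s : ℝ)..r, (A (projIcc α β hαβ x, κ)).comp (R (projIcc α β hαβ x, κ)) := by
  have hcont : ∀ R : Icc α β × K → Z →L[ℝ] Z, Continuous R → Continuous fun x : Icc α β × K =>
      ∫ r in (s : ℝ)..x.1, (A (projIcc α β hαβ r, x.2)).comp (R (projIcc α β hαβ r, x.2)) := by
    intro R hR
    refine intervalIntegral.continuous_parametric_intervalIntegral_of_continuous (μ := volume)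
      (f := fun (x : Icc α β × K) r =>
        (A (projIcc α β hαβ r, x.2)).comp (R (projIcc α β hαβ r, x.2))) ?_
      (continuous_subtype_val.comp continuous_fst)
    have h1 : Continuous fun p : (Icc α β × K) × ℝ => (projIcc α β hαβ p.2, p.1.2) := by fun_prop
    exact (hA.comp h1).clm_comp (hR.comp h1)
  have hbound : ∀ (R : Icc α β × K → Z →L[ℝ] Z) (C : ℝ), (∀ x, ‖R x‖ ≤ C) → ∀ x : Icc α β × K,
      ‖∫ r in (s : ℝ)..x.1, (A (projIcc α β hαβ r, x.2)).comp (R (projIcc α β hαβ r, x.2))‖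
        ≤ C / 2 := by
    intro R C hC x
    have hC0 : 0 ≤ C := (norm_nonneg _).trans (hC x)
    have hM0 : 0 ≤ M := (norm_nonneg _).trans (hAM x)
    have hlen : |(x.1 : ℝ) - s| ≤ β - α := by
      rw [abs_le]
      constructor <;> linarith [x.1.2.1, x.1.2.2, s.2.1, s.2.2]
    refine (intervalIntegral.norm_integral_le_of_norm_le_const (C := M * C) fun r _ => ?_).trans ?_
    · exact (ContinuousLinearMap.opNorm_comp_le _ _).trans
        (mul_le_mul (hAM _) (hC _) (norm_nonneg _) hM0)
    · calc M * C * |(x.1 : ℝ) - s| ≤ M * C * (β - α) := by gcongr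
        _ = M * (β - α) * C := by ring
        _ ≤ 1 / 2 * C := by gcongr
        _ = C / 2 := by ring
  -- The Picard operator acts on bounded continuous functions of time and parameter together, so its
  -- fixed point is automatically continuous in the parameter. `K` need not be compact because the
  -- bound `M` is uniform.
  let T : (Icc α β × K →ᵇ Z →L[ℝ] Z) → (Icc α β × K →ᵇ Z →L[ℝ] Z) := fun R =>
    BoundedContinuousFunction.ofNormedAddCommGroup
      (fun x => ContinuousLinearMap.id ℝ Z +
        ∫ r in (s : ℝ)..x.1, (A (projIcc α β hαβ r, x.2)).comp (R (projIcc α β hαβ r, x.2)))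
      (continuous_const.add (hcont R R.continuous))
      (‖ContinuousLinearMap.id ℝ Z‖ + ‖R‖ / 2)
      (fun x => (norm_add_le _ _).trans (by gcongr; exact hbound R ‖R‖ R.norm_coe_le_norm x))
  have hint : ∀ (R : Icc α β × K →ᵇ Z →L[ℝ] Z) (κ : K) (a b : ℝ), IntervalIntegrable
      (fun r => (A (projIcc α β hαβ r, κ)).comp (R (projIcc α β hαβ r, κ))) volume a b := by
    intro R κ a b
    have h1 : Continuous fun r : ℝ => (projIcc α β hαβ r, κ) := by fun_prop
    exact ((hA.comp h1).clm_comp (R.continuous.comp h1)).intervalIntegrable a b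
  have hT : ContractingWith (1 / 2) T := by
    refine ⟨by rw [one_div]; exact NNReal.inv_lt_one_iff (by norm_num) |>.2 (by norm_num),
      LipschitzWith.of_dist_le_mul fun R₁ R₂ => ?_⟩
    rw [BoundedContinuousFunction.dist_le (by positivity)]
    intro x
    simp only [T, BoundedContinuousFunction.coe_ofNormedAddCommGroup, dist_add_left]
    rw [dist_eq_norm, ← intervalIntegral.integral_sub (hint R₁ x.2 _ _) (hint R₂ x.2 _ _)]
    have h := hbound (fun y => R₁ y - R₂ y) (dist R₁ R₂)
      (fun y => by rw [← dist_eq_norm]; exact BoundedContinuousFunction.dist_coe_le_dist y) x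
    simp only [ContinuousLinearMap.comp_sub] at h
    refine h.trans_eq ?_
    simp
    ring
  obtain ⟨R, hR⟩ : ∃ R, T R = R := ⟨_, hT.fixedPoint_isFixedPt⟩
  exact ⟨R, R.continuous, fun r κ =>
    (congrArg (fun R : Icc α β × K →ᵇ Z →L[ℝ] Z => R (r, κ)) hR).symm⟩

/-- A continuous solution of a linear homogeneous integral equation on a short interval
vanishes. -/
theorem eq_zero_of_eq_integral {Z : Type*} [NormedAddCommGroup Z] [NormedSpace ℝ Z] {α β : ℝ}
    (hαβ : α ≤ β) {e : ℝ → Z} {A : ℝ → Z →L[ℝ] Z}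
    (he : ContinuousOn e (Icc α β)) {M : ℝ} (hAM : ∀ r ∈ Icc α β, ‖A r‖ ≤ M)
    (hM : M * (β - α) ≤ 1 / 2) {s : ℝ} (hs : s ∈ Icc α β)
    (h : ∀ r ∈ Icc α β, e r = ∫ x in s..r, A x (e x)) : ∀ r ∈ Icc α β, e r = 0 := by
  -- At a maximum of the norm the equation gives `‖e r₀‖ ≤ ½ ‖e r₀‖`, which replaces a Grönwall
  -- argument.
  obtain ⟨r₀, hr₀, hmax⟩ := isCompact_Icc.exists_isMaxOn (nonempty_Icc.2 hαβ) he.norm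
  have hM0 : 0 ≤ M := (norm_nonneg _).trans (hAM s hs)
  have h1 : ‖e r₀‖ ≤ M * ‖e r₀‖ * |r₀ - s| := by
    conv_lhs => rw [h r₀ hr₀]
    refine intervalIntegral.norm_integral_le_of_norm_le_const fun x hx => ?_
    have hx' : x ∈ Icc α β := uIoc_subset_uIcc.trans (uIcc_subset_Icc hs hr₀) hx
    exact (ContinuousLinearMap.le_opNorm _ _).trans
      (mul_le_mul (hAM x hx') (hmax hx') (norm_nonneg _) hM0)
  have hlen : |r₀ - s| ≤ β - α := by
    rw [abs_le]
    constructor <;> linarith [hr₀.1, hr₀.2, hs.1, hs.2]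
  have h2 : ‖e r₀‖ ≤ 1 / 2 * ‖e r₀‖ := calc
    ‖e r₀‖ ≤ M * ‖e r₀‖ * (β - α) := h1.trans (by gcongr)
    _ = M * (β - α) * ‖e r₀‖ := by ring
    _ ≤ 1 / 2 * ‖e r₀‖ := by gcongr
  intro r hr
  have h3 : ‖e r‖ ≤ ‖e r₀‖ := hmax hr
  exact norm_le_zero_iff.1 (by linarith [norm_nonneg (e r₀)])

/-- Differentiability in the initial condition of a continuous family of solutions of an integral
equation with `C¹` right-hand side, on a short time interval. -/
theorem exists_hasFDerivAt_flow (hαβ : α ≤ β) {U : Set Y} (hU : IsOpen U) {B : Set Z}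
    (hB : Convex ℝ B) {X : ℝ → Z → Z} {X' : ℝ → Z → Z →L[ℝ] Z}
    (hX : ∀ r ∈ Icc α β, ∀ x ∈ B, HasFDerivAt (X r) (X' r x) x)
    (hXc : ContinuousOn (fun x : ℝ × Z => X x.1 x.2) (Icc α β ×ˢ B))
    (hX' : ContinuousOn (fun x : ℝ × Z => X' x.1 x.2) (Icc α β ×ˢ B))
    {M : ℝ} (hXM : ∀ r ∈ Icc α β, ∀ x ∈ B, ‖X' r x‖ ≤ M) (hM : M * (β - α) ≤ 1 / 2)
    {g : ℝ → Y → Z} (hg : ContinuousOn (fun x : ℝ × Y => g x.1 x.2) (Icc α β ×ˢ U))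
    (hgB : ∀ r ∈ Icc α β, ∀ y ∈ U, g r y ∈ B) {s : ℝ} (hs : s ∈ Icc α β)
    (hint : ∀ r ∈ Icc α β, ∀ y ∈ U, g r y - g s y = ∫ x in s..r, X x (g x y))
    {gs' : Y → Y →L[ℝ] Z} (hgs : ∀ y ∈ U, HasFDerivAt (g s) (gs' y) y)
    (hgs' : ContinuousOn gs' U) :
    ∃ g' : ℝ → Y → Y →L[ℝ] Z, (∀ r ∈ Icc α β, ∀ y ∈ U, HasFDerivAt (g r) (g' r y) y) ∧
      ContinuousOn (fun x : ℝ × Y => g' x.1 x.2) (Icc α β ×ˢ U) := by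
  -- The mean of `X'` over the segment between two trajectories, which lies in the convex set `B`.
  -- It turns the difference of the fields into a linear map applied to the difference of the
  -- states, exactly and without remainder. The projection of `θ` only makes the integrand
  -- continuous on the whole line.
  let A : Icc α β × (U × U) → Z →L[ℝ] Z := fun x =>
    ∫ θ in (0 : ℝ)..1, X' x.1 (g x.1 x.2.1 + (projIcc 0 1 zero_le_one θ : ℝ) •
      (g x.1 x.2.2 - g x.1 x.2.1))
  have hseg : ∀ r ∈ Icc α β, ∀ y ∈ U, ∀ y' ∈ U, ∀ θ ∈ Icc (0 : ℝ) 1,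
      g r y + θ • (g r y' - g r y) ∈ B := fun r hr y hy y' hy' θ hθ =>
    hB.add_smul_sub_mem (hgB r hr y hy) (hgB r hr y' hy') hθ
  have hA : Continuous A := by
    refine intervalIntegral.continuous_parametric_intervalIntegral_of_continuous' (μ := volume)
      (f := fun (x : Icc α β × (U × U)) (θ : ℝ) => X' x.1 (g x.1 x.2.1 +
        (projIcc 0 1 zero_le_one θ : ℝ) • (g x.1 x.2.2 - g x.1 x.2.1))) ?_ 0 1
    have h1 : Continuous fun p : (Icc α β × (U × U)) × ℝ => g p.1.1 p.1.2.1 :=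
      hg.comp_continuous (f := fun p : (Icc α β × (U × U)) × ℝ => ((p.1.1 : ℝ), (p.1.2.1 : Y)))
        (by fun_prop) fun p => ⟨p.1.1.2, p.1.2.1.2⟩
    have h2 : Continuous fun p : (Icc α β × (U × U)) × ℝ => g p.1.1 p.1.2.2 :=
      hg.comp_continuous (f := fun p : (Icc α β × (U × U)) × ℝ => ((p.1.1 : ℝ), (p.1.2.2 : Y)))
        (by fun_prop) fun p => ⟨p.1.1.2, p.1.2.2.2⟩
    refine hX'.comp_continuous (f := fun p : (Icc α β × (U × U)) × ℝ => ((p.1.1 : ℝ),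
      g p.1.1 p.1.2.1 + (projIcc 0 1 zero_le_one p.2 : ℝ) • (g p.1.1 p.1.2.2 - g p.1.1 p.1.2.1)))
      ?_ fun p => ⟨p.1.1.2, hseg _ p.1.1.2 _ p.1.2.1.2 _ p.1.2.2.2 _
        (projIcc 0 1 zero_le_one p.2).2⟩
    have h3 : Continuous fun p : (Icc α β × (U × U)) × ℝ => (p.1.1 : ℝ) := by fun_prop
    have h4 : Continuous fun p : (Icc α β × (U × U)) × ℝ =>
        (projIcc 0 1 zero_le_one p.2 : ℝ) := by fun_prop
    exact h3.prodMk (h1.add (h4.smul (h2.sub h1)))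
  have hAM : ∀ x, ‖A x‖ ≤ M := by
    intro x
    refine (intervalIntegral.norm_integral_le_of_norm_le_const fun θ _ =>
      hXM _ x.1.2 _ (hseg _ x.1.2 _ x.2.1.2 _ x.2.2.2 _ (projIcc 0 1 zero_le_one θ).2)).trans ?_
    simp
  have hXA : ∀ (r : Icc α β) (y y' : U),
      X r (g r y') - X r (g r y) = A (r, y, y') (g r y' - g r y) := by
    intro r y y'
    set v := g r y' - g r y with hv
    have hcurve : ∀ θ : ℝ, HasDerivAt (fun θ : ℝ => g r y + θ • v) v θ := fun θ => by
      simpa using ((hasDerivAt_id θ).smul_const v).const_add (g r y)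
    have hsegc : ContinuousOn (fun θ : ℝ => X' r (g r y + θ • v)) (Icc 0 1) :=
      hX'.comp (f := fun θ : ℝ => ((r : ℝ), g r y + θ • v)) (by fun_prop)
        fun θ hθ => ⟨r.2, hseg r r.2 y y.2 y' y'.2 θ hθ⟩
    have h1 : ∫ θ in (0 : ℝ)..1, X' r (g r y + θ • v) v =
        X r (g r y + (1 : ℝ) • v) - X r (g r y + (0 : ℝ) • v) := by
      refine intervalIntegral.integral_eq_sub_of_hasDerivAt
        (f := fun θ : ℝ => X r (g r y + θ • v)) (fun θ hθ => ?_) ?_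
      · rw [uIcc_of_le zero_le_one] at hθ
        exact (hX r r.2 _ (hseg r r.2 y y.2 y' y'.2 θ hθ)).comp_hasDerivAt θ (hcurve θ)
      · exact (hsegc.clm_apply continuousOn_const).intervalIntegrable_of_Icc zero_le_one
    have h2 : A (r, y, y') v = ∫ θ in (0 : ℝ)..1, X' r (g r y + θ • v) v := by
      have hA' : A (r, y, y') = ∫ θ in (0 : ℝ)..1, X' r (g r y + θ • v) := by
        refine intervalIntegral.integral_congr fun θ hθ => ?_
        rw [uIcc_of_le zero_le_one] at hθ
        simp only [projIcc_of_mem zero_le_one hθ, hv]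
      rw [hA', ContinuousLinearMap.intervalIntegral_apply
        (hsegc.intervalIntegrable_of_Icc zero_le_one)]
    rw [h2, h1]
    simp [hv]
  obtain ⟨R, hR, hReq⟩ := exists_resolvent hαβ hA hAM hM ⟨s, hs⟩
  have hslice : ∀ y ∈ U, ContinuousOn (fun r => g r y) (Icc α β) := fun y hy =>
    continuousOn_slice hg hy
  have hXg : ∀ y ∈ U, ContinuousOn (fun r => X r (g r y)) (Icc α β) := fun y hy =>
    hXc.comp (f := fun r => (r, g r y)) (continuousOn_id.prodMk (hslice y hy))
      fun r hr => ⟨hr, hgB r hr y hy⟩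
  -- Both sides solve the same linear equation with the same value at time `s`, so their difference
  -- vanishes by `eq_zero_of_eq_integral`.
  have hflow : ∀ (r : Icc α β) (y y' : U),
      g r y' - g r y = R (r, y, y') (g s y' - g s y) := by
    intro r y y'
    set δ := g s y' - g s y with hδ
    have hRc : Continuous fun x : ℝ => R (projIcc α β hαβ x, y, y') := by fun_prop
    have hAc : Continuous fun x : ℝ => A (projIcc α β hαβ x, y, y') := by fun_prop
    have hdc : ContinuousOn (fun x => g x y' - g x y) (Icc α β) :=
      (hslice y' y'.2).sub (hslice y y.2)
    have h0 := eq_zero_of_eq_integral hαβ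
      (e := fun x => g x y' - g x y - R (projIcc α β hαβ x, y, y') δ)
      (A := fun x => A (projIcc α β hαβ x, y, y'))
      (hdc.sub (hRc.clm_apply continuous_const).continuousOn) (fun x _ => hAM _) hM hs ?_ r r.2
    · rw [projIcc_val] at h0
      exact sub_eq_zero.1 h0
    · intro x hx
      have hsub : uIcc s x ⊆ Icc α β := uIcc_subset_Icc hs hx
      have hii : ∀ {φ : ℝ → Z}, ContinuousOn φ (Icc α β) → IntervalIntegrable φ volume s x :=
        fun hφ => (hφ.mono hsub).intervalIntegrable
      have e1 : g x y' - g x y = δ + ∫ w in s..x, A (projIcc α β hαβ w, y, y') (g w y' - g w y) := by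
        have e2 : ∫ w in s..x, A (projIcc α β hαβ w, y, y') (g w y' - g w y) =
            ∫ w in s..x, (X w (g w y') - X w (g w y)) := by
          refine intervalIntegral.integral_congr fun w hw => ?_
          have := hXA ⟨w, hsub hw⟩ y y'
          simp only [projIcc_of_mem hαβ (hsub hw)]
          exact this.symm
        rw [e2, intervalIntegral.integral_sub (hii (hXg y' y'.2)) (hii (hXg y y.2)),
          ← hint x hx y' y'.2, ← hint x hx y y.2, hδ]
        abel
      have e3 : R (projIcc α β hαβ x, y, y') δ = δ +
          ∫ w in s..x, A (projIcc α β hαβ w, y, y') (R (projIcc α β hαβ w, y, y') δ) := by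
        have := congrArg (fun T : Z →L[ℝ] Z => T δ) (hReq (projIcc α β hαβ x) (y, y'))
        simp only [projIcc_of_mem hαβ hx, add_apply, ContinuousLinearMap.id_apply] at this
        rw [projIcc_of_mem hαβ hx, this, ContinuousLinearMap.intervalIntegral_apply
          ((hAc.clm_comp hRc).intervalIntegrable _ _)]
        rfl
      rw [e1, e3, add_sub_add_left_eq_sub, ← intervalIntegral.integral_sub]
      · refine intervalIntegral.integral_congr fun w _ => ?_
        simp only [map_sub]
      · exact hii (hAc.continuousOn.clm_apply hdc)
      · exact (hAc.clm_apply (hRc.clm_apply continuous_const)).intervalIntegrable _ _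
  classical
  -- The derivative is the resolvent on the diagonal `y' = y`; outside `U` the value is irrelevant.
  let D : ℝ → Y → Z →L[ℝ] Z := fun r y =>
    if h : y ∈ U then R (projIcc α β hαβ r, ⟨y, h⟩, ⟨y, h⟩) else 0
  refine ⟨fun r y => (D r y).comp (gs' y), fun r hr y hy => ?_, ?_⟩
  · let R' : Y → Z →L[ℝ] Z := fun y' =>
      if h : y' ∈ U then R (⟨r, hr⟩, ⟨y, hy⟩, ⟨y', h⟩) else 0
    have hR' : ContinuousAt R' y := by
      refine ContinuousOn.continuousAt (s := U) ?_ (hU.mem_nhds hy)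
      rw [continuousOn_iff_continuous_domRestrict]
      have : Continuous fun y' : U => R (⟨r, hr⟩, ⟨y, hy⟩, y') := by fun_prop
      refine this.congr fun y' => ?_
      simp [R']
    -- The factor `g s y' - g s y` vanishes at `y' = y`, so continuity of the resolvent in `y'` is
    -- enough.
    have h1 := hasFDerivAt_bilinear_of_eq_zero (ContinuousLinearMap.apply ℝ Z : Z →L[ℝ] _)
      ((hgs y hy).sub_const (g s y)) (sub_self _) hR'
    refine ((h1.const_add (g r y)).congr_of_eventuallyEq ?_).congr_fderiv ?_
    · filter_upwards [hU.mem_nhds hy] with y' hy'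
      have := hflow ⟨r, hr⟩ ⟨y, hy⟩ ⟨y', hy'⟩
      simp only [R', hy', dite_true, ContinuousLinearMap.apply_apply]
      rw [← this]
      abel
    · ext v
      simp [R', D, hy, projIcc_of_mem hαβ hr]
  · refine ContinuousOn.clm_comp ?_ (hgs'.comp (f := Prod.snd) continuousOn_snd fun x hx => hx.2)
    rw [continuousOn_iff_continuous_domRestrict]
    have : Continuous fun x : (Icc α β ×ˢ U : Set (ℝ × Y)) =>
        R (⟨x.1.1, x.2.1⟩, ⟨x.1.2, x.2.2⟩, ⟨x.1.2, x.2.2⟩) := by fun_prop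
    refine this.congr fun x => ?_
    simp [D, x.2.2, projIcc_of_mem hαβ x.2.1]

end FlowDifferentiability

/-! ### Tangent maps read in charts. -/

section TangentCharts

variable {E : Type*} [NormedAddCommGroup E] [NormedSpace ℝ E] {H : Type*} [TopologicalSpace H]
  {I : ModelWithCorners ℝ E H} [I.Boundaryless]
  {M : Type*} [TopologicalSpace M] [ChartedSpace H M] [IsManifold I 1 M]
  {E' : Type*} [NormedAddCommGroup E'] [NormedSpace ℝ E'] {H' : Type*} [TopologicalSpace H']
  {I' : ModelWithCorners ℝ E' H'}
  {M' : Type*} [TopologicalSpace M'] [ChartedSpace H' M'] [IsManifold I' 1 M']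

omit [I.Boundaryless] in
/-- The chart of `TM` induced by the preferred chart at `p`. -/
theorem extChartAt_tangent_apply {p : TangentBundle I M} {u : TangentBundle I M}
    (hu : u.proj ∈ (chartAt H p.proj).source) :
    extChartAt I.tangent p u =
      (extChartAt I p.proj u.proj, mfderiv I 𝓘(ℝ, E) (extChartAt I p.proj) u.proj u.2) := by
  have h := TangentBundle.continuousLinearMapAt_trivializationAt (I := I) hu
  have h2 : ((trivializationAt E (TangentSpace I) p.proj).continuousLinearMapAt ℝ u.proj) u.2 =
      (trivializationAt E (TangentSpace I) p.proj u).2 := by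
    rw [Trivialization.continuousLinearMapAt_apply, Trivialization.linearMapAt_apply, if_pos]
    exact hu
  refine Prod.ext rfl ?_
  exact h2.symm.trans (congrArg (fun T : E →L[ℝ] E => T u.2) h)

theorem mdifferentiableAt_extChartAt_symm {p : M} {y : E} (hy : y ∈ (extChartAt I p).target) :
    MDifferentiableAt 𝓘(ℝ, E) I (extChartAt I p).symm y := by
  have h := mdifferentiableWithinAt_extChartAt_symm hy
  rwa [I.range_eq_univ, mdifferentiableWithinAt_univ] at h

/-- A differentiable map read in charts is differentiable, and its derivative is the tangent map
read in the induced charts. -/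
theorem extChartAt_tangentMap {F : M → M'} {p : TangentBundle I M} {p' : TangentBundle I' M'}
    {u : TangentBundle I M} (hF : MDifferentiableAt I I' F u.proj)
    (hu : u.proj ∈ (chartAt H p.proj).source) (hFu : F u.proj ∈ (chartAt H' p'.proj).source) :
    extChartAt I'.tangent p' (tangentMap I I' F u) =
      (extChartAt I' p'.proj (F u.proj),
        fderiv ℝ (fun y => extChartAt I' p'.proj (F ((extChartAt I p.proj).symm y)))
          (extChartAt I p.proj u.proj) (extChartAt I.tangent p u).2) := by
  have hu' : u.proj ∈ (extChartAt I p.proj).source := by rwa [extChartAt_source]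
  have hy := (extChartAt I p.proj).map_source hu'
  have hleft := (extChartAt I p.proj).left_inv hu'
  rw [extChartAt_tangent_apply (p := p') (u := tangentMap I I' F u) hFu,
    extChartAt_tangent_apply hu]
  refine Prod.ext rfl ?_
  have h1 := mdifferentiableAt_extChartAt_symm hy
  have h2 : MDifferentiableAt I I' F ((extChartAt I p.proj).symm (extChartAt I p.proj u.proj)) := by
    rwa [hleft]
  have h3 : MDifferentiableAt I' 𝓘(ℝ, E') (extChartAt I' p'.proj)
      (F ((extChartAt I p.proj).symm (extChartAt I p.proj u.proj))) := by
    rw [hleft]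
    exact mdifferentiableAt_extChartAt hFu
  have h4 : MDifferentiableAt 𝓘(ℝ, E) 𝓘(ℝ, E')
      (fun y => extChartAt I' p'.proj (F ((extChartAt I p.proj).symm y)))
      (extChartAt I p.proj u.proj) := by
    have h0 := h2.comp (extChartAt I p.proj u.proj) h1
    exact MDifferentiableAt.comp (extChartAt I p.proj u.proj) h3 h0
  -- The chain rule is applied to two factorizations of one germ, chart after `F` and written map
  -- after chart; comparing them gives the fibre component.
  have h5 := mfderiv_comp u.proj h4 (mdifferentiableAt_extChartAt (I := I) hu)
  have h6 := mfderiv_comp u.proj (mdifferentiableAt_extChartAt (I := I') hFu) hF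
  have h7 : (fun y => extChartAt I' p'.proj (F ((extChartAt I p.proj).symm y))) ∘
      (extChartAt I p.proj) =ᶠ[𝓝 u.proj] extChartAt I' p'.proj ∘ F := by
    filter_upwards [extChartAt_source_mem_nhds' hu'] with z hz
    simp only [Function.comp_apply, (extChartAt I p.proj).left_inv hz]
  rw [← mfderiv_eq_fderiv]
  have h8 := h7.mfderiv_eq (I := I) (I' := 𝓘(ℝ, E'))
  rw [h5, h6] at h8
  exact (congrArg (fun T => T u.2) h8).symm

theorem differentiableAt_written_of_mdifferentiableAt {F : M → M'} {p : M} {p' : M'} {y : E}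
    (hy : y ∈ (extChartAt I p).target)
    (hF : MDifferentiableAt I I' F ((extChartAt I p).symm y))
    (hFy : F ((extChartAt I p).symm y) ∈ (chartAt H' p').source) :
    DifferentiableAt ℝ (fun y => extChartAt I' p' (F ((extChartAt I p).symm y))) y :=
  ((mdifferentiableAt_extChartAt hFy).comp y
    (hF.comp y (mdifferentiableAt_extChartAt_symm hy))).differentiableAt

/-- If the tangent maps of a family are jointly continuous then so are the derivatives of the
family read in charts. -/
theorem continuousOn_fderiv_written [FiniteDimensional ℝ E] {T : Set ℝ} {U : Set E}
    {F : ℝ → M → M'} {p : M} {p' : M'} (hU : U ⊆ (extChartAt I p).target)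
    (hF : ∀ t ∈ T, MDifferentiable I I' (F t))
    (hFt : ContinuousOn (fun x : ℝ × TangentBundle I M => tangentMap I I' (F x.1) x.2)
      (T ×ˢ univ))
    (hFU : ∀ t ∈ T, ∀ y ∈ U, F t ((extChartAt I p).symm y) ∈ (chartAt H' p').source) :
    ContinuousOn (fun x : ℝ × E =>
      fderiv ℝ (fun y => extChartAt I' p' (F x.1 ((extChartAt I p).symm y))) x.2) (T ×ˢ U) := by
  -- In finite dimension it suffices to test on each fixed vector `v`, and the derivative applied to
  -- `v` is the fibre component of the tangent map in the induced charts.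
  rw [continuousOn_clm_apply]
  intro v
  let P : TangentBundle I M := ⟨p, 0⟩
  let P' : TangentBundle I' M' := ⟨p', 0⟩
  have htar : ∀ y ∈ U, (y, v) ∈ (extChartAt I.tangent P).target := by
    intro y hy
    have hy' := hU hy
    rw [FiberBundle.extChartAt_target]
    refine ⟨⟨hy', ?_⟩, mem_univ _⟩
    have := (extChartAt I p).map_target hy'
    rwa [extChartAt_source] at this
  have hproj : ∀ y ∈ U, ((extChartAt I.tangent P).symm (y, v)).proj = (extChartAt I p).symm y := 
    fun y _ => rfl
  have hc : ContinuousOn (fun x : ℝ × E => extChartAt I'.tangent P'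
      (tangentMap I I' (F x.1) ((extChartAt I.tangent P).symm (x.2, v)))) (T ×ˢ U) := by
    refine (continuousOn_extChartAt P').comp ?_ ?_
    · refine hFt.comp (f := fun x : ℝ × E => (x.1, (extChartAt I.tangent P).symm (x.2, v)))
        (continuousOn_fst.prodMk ?_) fun x hx => ⟨hx.1, mem_univ _⟩
      exact (continuousOn_extChartAt_symm P).comp (f := fun x : ℝ × E => (x.2, v)) (by fun_prop)
        fun x hx => htar x.2 hx.2
    · intro x hx
      rw [extChartAt_source, TangentBundle.mem_chart_source_iff]
      exact hFU x.1 hx.1 x.2 hx.2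
  refine (continuous_snd.comp_continuousOn hc).congr fun x hx => ?_
  have hsrc : ((extChartAt I.tangent P).symm (x.2, v)).proj ∈ (chartAt H p).source := by
    have := (extChartAt I p).map_target (hU hx.2)
    rwa [extChartAt_source] at this
  have h := extChartAt_tangentMap (p := P) (p' := P') (F := F x.1)
    (u := (extChartAt I.tangent P).symm (x.2, v)) (hF x.1 hx.1 _) hsrc (hFU x.1 hx.1 x.2 hx.2)
  simp only [Function.comp_apply]
  rw [h, (extChartAt I.tangent P).right_inv (htar x.2 hx.2)]
  have h2 : extChartAt I P.proj ((extChartAt I.tangent P).symm (x.2, v)).proj = x.2 :=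
    (extChartAt I p).right_inv (hU hx.2)
  rw [h2]

/-- If a family read in charts is `C¹` with jointly continuous derivatives, then its tangent maps
are jointly continuous. -/
theorem continuousOn_tangentMap_of_written {T : Set ℝ} {U : Set E} (hUo : IsOpen U)
    {F : ℝ → M → M'} {p : M} {p' : M'} (hU : U ⊆ (extChartAt I p).target)
    (hF : ∀ t ∈ T, ∀ y ∈ U, ContinuousAt (F t) ((extChartAt I p).symm y))
    (hFU : ∀ t ∈ T, ∀ y ∈ U, F t ((extChartAt I p).symm y) ∈ (chartAt H' p').source)
    {f' : ℝ → E → E →L[ℝ] E'}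
    (hf : ContinuousOn (fun x : ℝ × E => extChartAt I' p' (F x.1 ((extChartAt I p).symm x.2)))
      (T ×ˢ U))
    (hf' : ContinuousOn (fun x : ℝ × E => f' x.1 x.2) (T ×ˢ U))
    (hd : ∀ t ∈ T, ∀ y ∈ U,
      HasFDerivAt (fun y => extChartAt I' p' (F t ((extChartAt I p).symm y))) (f' t y) y) :
    (∀ t ∈ T, ∀ y ∈ U, ContMDiffAt I I' 1 (F t) ((extChartAt I p).symm y)) ∧
    ContinuousOn (fun x : ℝ × TangentBundle I M => tangentMap I I' (F x.1) x.2)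
      (T ×ˢ {u | u.proj ∈ (chartAt H p).source ∧ extChartAt I p u.proj ∈ U}) := by
  have hC1 : ∀ t ∈ T, ∀ y ∈ U, ContMDiffAt I I' 1 (F t) ((extChartAt I p).symm y) := by
    intro t ht y hy
    have hsrc := (extChartAt I p).map_target (hU hy)
    rw [extChartAt_source] at hsrc
    rw [contMDiffAt_iff_of_mem_source hsrc (hFU t ht y hy)]
    refine ⟨hF t ht y hy, ?_⟩
    rw [I.range_eq_univ, contDiffWithinAt_univ, (extChartAt I p).right_inv (hU hy)]
    rw [contDiffAt_one_iff]
    refine ⟨f' t, U, hUo.mem_nhds hy, ?_, fun w hw => hd t ht w hw⟩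
    exact hf'.comp (f := fun w => (t, w)) (by fun_prop) fun w hw => ⟨ht, hw⟩
  refine ⟨hC1, ?_⟩
  let P : TangentBundle I M := ⟨p, 0⟩
  let P' : TangentBundle I' M' := ⟨p', 0⟩
  set S : Set (ℝ × TangentBundle I M) :=
    T ×ˢ {u | u.proj ∈ (chartAt H p).source ∧ extChartAt I p u.proj ∈ U} with hS
  have hchart : ContinuousOn (fun x : ℝ × TangentBundle I M => extChartAt I.tangent P x.2) S := by
    refine (continuousOn_extChartAt P).comp continuousOn_snd fun x hx => ?_
    rw [extChartAt_source, TangentBundle.mem_chart_source_iff]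
    exact hx.2.1
  have hbase : ContinuousOn (fun x : ℝ × TangentBundle I M => (x.1, extChartAt I p x.2.proj)) S :=
    continuousOn_fst.prodMk (continuous_fst.comp_continuousOn hchart :)
  have hmaps : MapsTo (fun x : ℝ × TangentBundle I M => (x.1, extChartAt I p x.2.proj)) S
      (T ×ˢ U) := fun x hx => ⟨hx.1, hx.2.2⟩
  have hg : ContinuousOn (fun x : ℝ × TangentBundle I M =>
      (extChartAt I' p' (F x.1 ((extChartAt I p).symm (extChartAt I p x.2.proj))),
        f' x.1 (extChartAt I p x.2.proj) (extChartAt I.tangent P x.2).2)) S :=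
    (hf.comp hbase hmaps).prodMk
      ((hf'.comp hbase hmaps).clm_apply (continuous_snd.comp_continuousOn hchart))
  have htar : ∀ x ∈ S, (extChartAt I' p' (F x.1 ((extChartAt I p).symm (extChartAt I p x.2.proj))),
        f' x.1 (extChartAt I p x.2.proj) (extChartAt I.tangent P x.2).2)
          = extChartAt I'.tangent P' (tangentMap I I' (F x.1) x.2) := by
    intro x hx
    have hs : x.2.proj ∈ (extChartAt I p).source := by
      rw [extChartAt_source]
      exact hx.2.1
    have hl := (extChartAt I p).left_inv hs
    have h1 := (hC1 x.1 hx.1 _ hx.2.2).mdifferentiableAt one_ne_zero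
    have h2 := hFU x.1 hx.1 _ hx.2.2
    rw [hl] at h1 h2
    rw [extChartAt_tangentMap (p := P) (p' := P') h1 hx.2.1 h2, (hd x.1 hx.1 _ hx.2.2).fderiv, hl]
  have hsrc' : ∀ x ∈ S, tangentMap I I' (F x.1) x.2 ∈ (extChartAt I'.tangent P').source := by
    intro x hx
    have hs : x.2.proj ∈ (extChartAt I p).source := by
      rw [extChartAt_source]
      exact hx.2.1
    have h2 := hFU x.1 hx.1 _ hx.2.2
    rw [(extChartAt I p).left_inv hs] at h2
    rw [extChartAt_source, TangentBundle.mem_chart_source_iff]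
    exact h2
  -- The tangent map is recovered by applying the inverse chart of the target tangent bundle to its
  -- continuous coordinate expression.
  refine ((continuousOn_extChartAt_symm (I := I'.tangent) P').comp hg fun x hx => ?_).congr fun x hx => ?_
  · rw [htar x hx]
    exact (extChartAt I'.tangent P').map_source (hsrc' x hx)
  · simp only [Function.comp_apply]
    rw [htar x hx, (extChartAt I'.tangent P').left_inv (hsrc' x hx)]

end TangentCharts

/-! ### Canonical coordinates on `T*Q`, the symplectic form and the Legendre transform. -/

section Geometry

variable {E : Type*} [NormedAddCommGroup E] [NormedSpace ℝ E]
  {Q : Type*} [TopologicalSpace Q] [ChartedSpace E Q] [IsManifold 𝓘(ℝ, E) ∞ Q]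

variable (E) in
/-- The canonical coordinates `(q, p)` of `T*Q` induced by the preferred chart of `Q` at `x`. -/
noncomputable def coord (x : Q) : PartialEquiv (Cotangent E Q) (E × (E →L[ℝ] ℝ)) :=
  extChartAt (cotangentModel E) (⟨x, 0⟩ : Cotangent E Q)

theorem mem_cotangent_chart_source {x : Q} {z : Cotangent E Q} :
    z ∈ (chartAt (ModelProd E (E →L[ℝ] ℝ)) (⟨x, 0⟩ : Cotangent E Q)).source ↔
      z.proj ∈ (chartAt E x).source := by
  simp only [FiberBundle.chartedSpace_chartAt, mfld_simps]
  exact ⟨fun h => h.1.1, fun h => ⟨⟨h, mem_univ _⟩, h⟩⟩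

theorem mem_coord_source {x : Q} {z : Cotangent E Q} :
    z ∈ (coord E x).source ↔ z.proj ∈ (chartAt E x).source := by
  rw [coord, extChartAt_source, mem_cotangent_chart_source]

theorem coord_target (x : Q) :
    (coord E x).target = (chartAt E x).target ×ˢ (univ : Set (E →L[ℝ] ℝ)) := by
  rw [coord, FiberBundle.extChartAt_target]
  ext y
  simp only [mfld_simps]
  exact ⟨fun h => h.1, fun h => ⟨h, (chartAt E x).map_target h, mem_univ _⟩⟩

theorem isOpen_coord_target (x : Q) : IsOpen (coord E x).target := by
  rw [coord_target]
  exact (chartAt E x).open_target.prod isOpen_univ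

theorem isOpen_coord_source (x : Q) : IsOpen (coord E x).source :=
  isOpen_extChartAt_source _

theorem chartAt_mdifferentiable (x : Q) :
    (chartAt E x).MDifferentiable 𝓘(ℝ, E) 𝓘(ℝ, E) :=
  mdifferentiable_chart x

/-- The trivialization of a hom-bundle conjugates by those of its two factors: on `TQ` the inverse
one is the derivative of the inverse chart, and on the trivial line bundle it is the identity. -/
theorem coord_snd {x : Q} {z : Cotangent E Q} (hz : z.proj ∈ (chartAt E x).source) :
    (coord E x z).2 = (z.2 : TangentSpace 𝓘(ℝ, E) z.proj →L[ℝ] ℝ).comp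
      (mfderiv 𝓘(ℝ, E) 𝓘(ℝ, E) (chartAt E x).symm (chartAt E x z.proj)) := by
  have h := TangentBundle.symmL_trivializationAt (I := 𝓘(ℝ, E)) (x₀ := x) (x := z.proj) hz
  simp only [extChartAt, mfld_simps, mfderivWithin_univ] at h
  have h2 : (coord E x z).2 =
      ((trivializationAt ℝ (Bundle.Trivial Q ℝ) x).continuousLinearMapAt ℝ z.proj).comp
        (ContinuousLinearMap.comp z.2
          ((trivializationAt E (TangentSpace 𝓘(ℝ, E)) x).symmL ℝ z.proj)) := rfl
  have h3 : ∀ c : ℝ, (trivializationAt ℝ (Bundle.Trivial Q ℝ) x).continuousLinearMapAt ℝ z.proj c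
      = c := by
    intro c
    rw [Trivialization.continuousLinearMapAt_apply, Trivialization.linearMapAt_apply, if_pos]
    · rfl
    · exact mem_univ z.proj
  rw [h2, h]
  ext v
  exact h3 _

/-- Links the momentum equation, which uses the inverse of the derivative of the chart, to the
bundle coordinates, which use the derivative of the inverse chart. -/
theorem momentumInChart_eq {x : Q} {z : Cotangent E Q} (hz : z.proj ∈ (chartAt E x).source) :
    momentumInChart (chartAt E x) z.proj z.2 = (coord E x z).2 := by
  rw [coord_snd hz, momentumInChart]
  have h1 := (chartAt_mdifferentiable x).symm_comp_deriv hz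
  have h2 := (chartAt_mdifferentiable x).comp_symm_deriv ((chartAt E x).map_source hz)
  rw [(chartAt E x).left_inv hz] at h2
  congr 1
  exact ContinuousLinearMap.inverse_eq h2 h1

theorem continuousOn_coord (x : Q) :
    ContinuousOn (coord E x : Cotangent E Q → E × (E →L[ℝ] ℝ)) (coord E x).source :=
  continuousOn_extChartAt _

theorem continuousOn_coord_symm (x : Q) :
    ContinuousOn (coord E x : PartialEquiv (Cotangent E Q) _).symm (coord E x).target :=
  continuousOn_extChartAt_symm _

theorem contMDiffOn_coord_symm (x : Q) {n : WithTop ℕ∞}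
    [IsManifold (cotangentModel E) n (Cotangent E Q)] :
    ContMDiffOn 𝓘(ℝ, E × (E →L[ℝ] ℝ)) (cotangentModel E) n (coord E x).symm (coord E x).target :=
  contMDiffOn_extChartAt_symm _

theorem mdifferentiableAt_coord {x : Q} {z : Cotangent E Q} (hz : z.proj ∈ (chartAt E x).source) :
    MDifferentiableAt (cotangentModel E) 𝓘(ℝ, E × (E →L[ℝ] ℝ)) (coord E x) z :=
  mdifferentiableAt_extChartAt (mem_cotangent_chart_source.2 hz)

theorem mdifferentiableAt_coord_symm {x : Q} {y : E × (E →L[ℝ] ℝ)} (hy : y ∈ (coord E x).target) :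
    MDifferentiableAt 𝓘(ℝ, E × (E →L[ℝ] ℝ)) (cotangentModel E) (coord E x).symm y :=
  mdifferentiableAt_extChartAt_symm hy

/-- In canonical coordinates the canonical one-form is `p dq`. -/
theorem canonicalOneForm_apply {x : Q} {z : Cotangent E Q} (hz : z.proj ∈ (chartAt E x).source)
    (w : TangentSpace (cotangentModel E) z) :
    canonicalOneForm z w = (coord E x z).2
      (mfderiv (cotangentModel E) 𝓘(ℝ, E × (E →L[ℝ] ℝ)) (coord E x) z w).1 := by
  have hproj : MDifferentiableAt (cotangentModel E) 𝓘(ℝ, E)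
      (fun y : Cotangent E Q => y.proj) z :=
    ((contMDiff_proj (n := 1) _) z).mdifferentiableAt one_ne_zero
  have h1 := mfderiv_comp z ((chartAt_mdifferentiable x).mdifferentiableAt hz) hproj
  have hfst : MDifferentiableAt 𝓘(ℝ, E × (E →L[ℝ] ℝ)) 𝓘(ℝ, E) Prod.fst (coord E x z) :=
    (ContinuousLinearMap.fst ℝ E (E →L[ℝ] ℝ)).differentiableAt.mdifferentiableAt
  have h2 := mfderiv_comp z hfst (mdifferentiableAt_coord hz)
  have h3 : Prod.fst ∘ coord E x = chartAt E x ∘ (fun y : Cotangent E Q => y.proj) := rfl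
  have h4 := (chartAt_mdifferentiable x).symm_comp_deriv hz
  rw [h3, h1, mfderiv_eq_fderiv, fderiv_fst] at h2
  have h5 : (mfderiv (cotangentModel E) 𝓘(ℝ, E × (E →L[ℝ] ℝ)) (coord E x) z w).1 =
      mfderiv 𝓘(ℝ, E) 𝓘(ℝ, E) (chartAt E x) z.proj
        (mfderiv (cotangentModel E) 𝓘(ℝ, E) (fun y : Cotangent E Q => y.proj) z w) :=
    (congrArg (fun T => T w) h2).symm
  rw [h5, coord_snd hz]
  have h6 := congrArg (fun T => z.2 (T
    (mfderiv (cotangentModel E) 𝓘(ℝ, E) (fun y : Cotangent E Q => y.proj) z w))) h4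
  exact h6.symm

/-- The pullback of the canonical one-form by a differentiable map, in canonical coordinates. -/
theorem canonicalOneForm_comp_mfderiv {x : Q} {f : E × (E →L[ℝ] ℝ) → Cotangent E Q}
    {y : E × (E →L[ℝ] ℝ)}
    (hf : MDifferentiableAt 𝓘(ℝ, E × (E →L[ℝ] ℝ)) (cotangentModel E) f y)
    (hy : (f y).proj ∈ (chartAt E x).source) (v : E × (E →L[ℝ] ℝ)) :
    canonicalOneForm (f y) (mfderiv 𝓘(ℝ, E × (E →L[ℝ] ℝ)) (cotangentModel E) f y v) =
      (coord E x (f y)).2 (fderiv ℝ (fun y => coord E x (f y)) y v).1 := by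
  rw [canonicalOneForm_apply hy, ← mfderiv_eq_fderiv]
  have := mfderiv_comp y (mdifferentiableAt_coord hy) hf
  exact congrArg (fun T : (E × (E →L[ℝ] ℝ)) →L[ℝ] (E × (E →L[ℝ] ℝ)) =>
    (coord E x (f y)).2 (T v).1) this.symm

/-- In canonical coordinates the canonical symplectic form is `dq ∧ dp`. -/
theorem canonicalSymplecticForm_apply (z : Cotangent E Q)
    (u w : TangentSpace (cotangentModel E) z) :
    canonicalSymplecticForm z u w =
      (mfderiv (cotangentModel E) 𝓘(ℝ, E × (E →L[ℝ] ℝ)) (coord E z.proj) z w).2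
        (mfderiv (cotangentModel E) 𝓘(ℝ, E × (E →L[ℝ] ℝ)) (coord E z.proj) z u).1 -
      (mfderiv (cotangentModel E) 𝓘(ℝ, E × (E →L[ℝ] ℝ)) (coord E z.proj) z u).2
        (mfderiv (cotangentModel E) 𝓘(ℝ, E × (E →L[ℝ] ℝ)) (coord E z.proj) z w).1 := by
  -- As a map from points to one-forms, `p dq` is linear in `(q, p)`, so it is its own derivative
  -- and its exterior derivative is a plain antisymmetrization.
  let Φ : (E × (E →L[ℝ] ℝ)) →L[ℝ] (E × (E →L[ℝ] ℝ)) [⋀^Fin 1]→L[ℝ] ℝ :=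
    ((ContinuousAlternatingMap.ofSubsingletonLIE (𝕜 := ℝ) (E := E × (E →L[ℝ] ℝ)) (F := ℝ) (0 : Fin 1)
      ).toContinuousLinearEquiv : ((E × (E →L[ℝ] ℝ)) →L[ℝ] ℝ) →L[ℝ] _).comp
      (((ContinuousLinearMap.compL ℝ (E × (E →L[ℝ] ℝ)) E ℝ).flip
        (ContinuousLinearMap.fst ℝ E (E →L[ℝ] ℝ))).comp (ContinuousLinearMap.snd ℝ E (E →L[ℝ] ℝ)))
  have hΦ : ∀ y : E × (E →L[ℝ] ℝ), Φ y =
      ContinuousAlternatingMap.ofSubsingleton ℝ (E × (E →L[ℝ] ℝ)) ℝ (0 : Fin 1)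
        (y.2.comp (ContinuousLinearMap.fst ℝ E (E →L[ℝ] ℝ))) := fun y => rfl
  have hz : coord E z.proj z ∈ (coord E z.proj).target :=
    (coord E z.proj).map_source (mem_extChartAt_source z)
  have hev : canonicalOneFormInChart z =ᶠ[𝓝 (coord E z.proj z)] Φ := by
    filter_upwards [(isOpen_coord_target z.proj).mem_nhds hz] with y hy
    rw [hΦ]
    refine congrArg (ContinuousAlternatingMap.ofSubsingleton ℝ (E × (E →L[ℝ] ℝ)) ℝ (0 : Fin 1)) ?_
    refine ContinuousLinearMap.ext fun v => ?_
    have hs : ((coord E z.proj).symm y).proj ∈ (chartAt E z.proj).source :=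
      mem_coord_source.1 ((coord E z.proj).map_target hy)
    have h1 := canonicalOneForm_comp_mfderiv (mdifferentiableAt_coord_symm hy) hs v
    have h2 : (fun y => coord E z.proj ((coord E z.proj).symm y)) =ᶠ[𝓝 y] id := by
      filter_upwards [(isOpen_coord_target z.proj).mem_nhds hy] with y' hy'
      exact (coord E z.proj).right_inv hy'
    rw [h2.fderiv_eq, fderiv_id, (coord E z.proj).right_inv hy] at h1
    exact h1
  have hd : extDeriv (canonicalOneFormInChart z) (coord E z.proj z) =
      .alternatizeUncurryFin Φ := by
    have hΦd : fderiv ℝ Φ (coord E z.proj z) = Φ :=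
      ContinuousLinearMap.fderiv (F := (E × (E →L[ℝ] ℝ)) [⋀^Fin 1]→L[ℝ] ℝ) Φ
    rw [extDeriv, hev.fderiv_eq, hΦd]
  have hpair : ∀ v₁ v₂ : E × (E →L[ℝ] ℝ),
      ContinuousAlternatingMap.alternatizeUncurryFin Φ ![v₁, v₂] = v₁.2 v₂.1 - v₂.2 v₁.1 := by
    intro v₁ v₂
    rw [ContinuousAlternatingMap.alternatizeUncurryFin_apply]
    simp [hΦ, Fin.sum_univ_two, Fin.removeNth, sub_eq_add_neg]
  rw [canonicalSymplecticForm]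
  -- The preferred bundle chart at `z` depends only on the base point, so it agrees by definition
  -- with the one centred at the zero covector.
  change - (extDeriv (canonicalOneFormInChart z) (coord E z.proj z)) _ = _
  rw [hd]
  exact (congrArg Neg.neg (hpair _ _)).trans (neg_sub _ _)

/-- The Lagrangian in the coordinates `(q, v)` of `TQ` induced by the preferred chart at `x`. -/
noncomputable def lagInChart (L : TangentBundle 𝓘(ℝ, E) Q → ℝ) (x : Q) (y : E × E) : ℝ :=
  L ⟨(chartAt E x).symm y.1, mfderiv 𝓘(ℝ, E) 𝓘(ℝ, E) (chartAt E x).symm y.1 y.2⟩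

/-- The coordinates of the velocity `V (q, p)` as a function of the coordinates `(q, p)`. -/
noncomputable def velInChart (V : Cotangent E Q → TangentBundle 𝓘(ℝ, E) Q) (x : Q)
    (y : E × (E →L[ℝ] ℝ)) : E :=
  mfderiv 𝓘(ℝ, E) 𝓘(ℝ, E) (chartAt E x) (V ((coord E x).symm y)).proj (V ((coord E x).symm y)).2

/-- On this domain `lagInChart L x` is `L` composed with the inverse of the chart of `TQ` at `⟨x,
0⟩`. -/
theorem contDiffOn_lagInChart {L : TangentBundle 𝓘(ℝ, E) Q → ℝ} {n : WithTop ℕ∞}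
    [IsManifold 𝓘(ℝ, E).tangent n (TangentBundle 𝓘(ℝ, E) Q)]
    (hL : ContMDiff 𝓘(ℝ, E).tangent 𝓘(ℝ, ℝ) n L) (x : Q) :
    ContDiffOn ℝ n (lagInChart L x) ((chartAt E x).target ×ˢ univ) := by
  rw [← contMDiffOn_iff_contDiffOn]
  have h := contMDiffOn_extChartAt_symm (I := 𝓘(ℝ, E).tangent) (n := n)
    (⟨x, 0⟩ : TangentBundle 𝓘(ℝ, E) Q)
  have h2 : (extChartAt 𝓘(ℝ, E).tangent (⟨x, 0⟩ : TangentBundle 𝓘(ℝ, E) Q)).target =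
      (chartAt E x).target ×ˢ univ := by
    rw [FiberBundle.extChartAt_target]
    ext y
    simp only [mfld_simps]
    exact ⟨fun h => h.1, fun h => ⟨h, (chartAt E x).map_target h⟩⟩
  rw [← h2]
  refine (hL.comp_contMDiffOn h).congr fun y hy => ?_
  rw [h2] at hy
  have := tangentMap_chart_symm (I := 𝓘(ℝ, E)) (p := (⟨x, 0⟩ : TangentBundle 𝓘(ℝ, E) Q))
    (q := ⟨y.1, y.2⟩) hy.1
  exact congrArg L this

/-- Since `V` covers the identity of `Q`, the chart at `x` serves on both sides, and `velInChart` is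
the fibre component of `V` written in the induced charts. -/
theorem contDiffOn_velInChart {V : Cotangent E Q → TangentBundle 𝓘(ℝ, E) Q}
    (hV : ContMDiff (cotangentModel E) 𝓘(ℝ, E).tangent 1 V) (hVp : ∀ z, (V z).proj = z.proj)
    (x : Q) : ContDiffOn ℝ 1 (velInChart V x) ((chartAt E x).target ×ˢ univ) := by
  rw [← contMDiffOn_iff_contDiffOn, ← coord_target]
  have h1 := hV.comp_contMDiffOn (contMDiffOn_coord_symm x (n := 1))
  have h2 := (contMDiffOn_extChartAt (I := 𝓘(ℝ, E).tangent) (n := 1)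
    (x := (⟨x, 0⟩ : TangentBundle 𝓘(ℝ, E) Q))).comp h1 fun y hy => by
      refine TangentBundle.mem_chart_source_iff _ _ |>.2 ?_
      change (V ((coord E x).symm y)).proj ∈ _
      rw [hVp]
      exact mem_coord_source.1 ((coord E x).map_target hy)
  have h3 : ContMDiff 𝓘(ℝ, E × E) 𝓘(ℝ, E) 1 (Prod.snd : E × E → E) :=
    contDiff_snd.contMDiff
  refine (h3.comp_contMDiffOn h2).congr fun y hy => ?_
  have hs : (V ((coord E x).symm y)).proj ∈ (chartAt E x).source := by
    rw [hVp]
    exact mem_coord_source.1 ((coord E x).map_target hy)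
  have := extChartAt_tangent_apply (I := 𝓘(ℝ, E)) (p := (⟨x, 0⟩ : TangentBundle 𝓘(ℝ, E) Q)) hs
  exact (congrArg Prod.snd this).symm

omit [IsManifold 𝓘(ℝ, E) ∞ Q] in
theorem contDiffOn_comp_chart_symm {γ : Q → ℝ} {n : WithTop ℕ∞} [IsManifold 𝓘(ℝ, E) n Q]
    (hγ : ContMDiff 𝓘(ℝ, E) 𝓘(ℝ, ℝ) n γ) (x : Q) :
    ContDiffOn ℝ n (fun y => γ ((chartAt E x).symm y)) (chartAt E x).target := by
  rw [← contMDiffOn_iff_contDiffOn]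
  exact hγ.comp_contMDiffOn contMDiffOn_chart_symm

/-- The Legendre transform in coordinates. -/
theorem coord_legendre_snd {L : TangentBundle 𝓘(ℝ, E) Q → ℝ}
    [IsManifold 𝓘(ℝ, E).tangent 1 (TangentBundle 𝓘(ℝ, E) Q)]
    (hL : ContMDiff 𝓘(ℝ, E).tangent 𝓘(ℝ, ℝ) 1 L) {x : Q} {τ : TangentBundle 𝓘(ℝ, E) Q}
    (hτ : τ.proj ∈ (chartAt E x).source) :
    HasFDerivAt (fun u : E => lagInChart L x (chartAt E x τ.proj, u))
      (coord E x (legendre L τ)).2 (mfderiv 𝓘(ℝ, E) 𝓘(ℝ, E) (chartAt E x) τ.proj τ.2) := by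
  have hmem := (chartAt E x).map_source hτ
  let A : E →L[ℝ] E := mfderiv 𝓘(ℝ, E) 𝓘(ℝ, E) (chartAt E x) τ.proj
  let B : E →L[ℝ] E := mfderiv 𝓘(ℝ, E) 𝓘(ℝ, E) (chartAt E x).symm (chartAt E x τ.proj)
  have hAB : ∀ u : E, A (B u) = u := by
    have h := (chartAt_mdifferentiable x).comp_symm_deriv hmem
    rw [(chartAt E x).left_inv hτ] at h
    exact fun u => congrArg (fun T : E →L[ℝ] E => T u) h
  have hBA : ∀ u : E, B (A u) = u := fun u =>
    congrArg (fun T : E →L[ℝ] E => T u) ((chartAt_mdifferentiable x).symm_comp_deriv hτ)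
  let Lq : E → ℝ := fun w => L ⟨τ.proj, w⟩
  have hlag : ∀ u : E, lagInChart L x (chartAt E x τ.proj, u) = Lq (B u) := fun u =>
    congrArg (fun q' : Q => L ⟨q', (B u : E)⟩) ((chartAt E x).left_inv hτ)
  have hLq : ∀ w : E, Lq w = lagInChart L x (chartAt E x τ.proj, A w) := fun w => by
    rw [hlag, hBA]
  let w₀ : E := τ.2
  have hdiff : DifferentiableAt ℝ Lq w₀ := by
    have h1 : DifferentiableAt ℝ (lagInChart L x) (chartAt E x τ.proj, A w₀) :=
      ((contDiffOn_lagInChart hL x).contDiffAt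
        (((chartAt E x).open_target.prod isOpen_univ).mem_nhds ⟨hmem, mem_univ _⟩)
        ).differentiableAt one_ne_zero
    have h2 : DifferentiableAt ℝ (fun w : E => (chartAt E x τ.proj, A w)) w₀ :=
      (differentiableAt_const _).prodMk A.differentiableAt
    have h3 : DifferentiableAt ℝ (fun w : E => lagInChart L x (chartAt E x τ.proj, A w)) w₀ :=
      DifferentiableAt.comp (g := lagInChart L x) w₀ h1 h2
    exact h3.congr_of_eventuallyEq (Eventually.of_forall hLq)
  have h1 : HasFDerivAt Lq (fderiv ℝ Lq w₀) (B (A w₀)) := by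
    rw [hBA]
    exact hdiff.hasFDerivAt
  have h2 : HasFDerivAt (fun u : E => lagInChart L x (chartAt E x τ.proj, u))
      ((fderiv ℝ Lq w₀).comp B) (A w₀) :=
    (h1.comp (A w₀) B.hasFDerivAt).congr_of_eventuallyEq (Eventually.of_forall hlag)
  rw [coord_snd (z := legendre L τ) hτ]
  exact h2

end Geometry

/-! ### From the stochastic equations to pathwise integral equations. -/

section LocalEquations

variable {E : Type*} [NormedAddCommGroup E] [NormedSpace ℝ E]
  {Q : Type*} [TopologicalSpace Q] [ChartedSpace E Q] [IsManifold 𝓘(ℝ, E) ∞ Q]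
  {m : ℕ}

/-- The differential of a potential in the preferred chart at `x`. -/
noncomputable def dpot (γ : Q → ℝ) (x : Q) : E → E →L[ℝ] ℝ :=
  fderiv ℝ (fun y : E => γ ((chartAt E x).symm y))

/-- The coordinates `(q, p - ∑ cᵢ dγᵢ(q))`, in which the equations are ordinary differential
equations when `c` is the noise. -/
noncomputable def shiftedState (γ : Fin m → Q → ℝ) (x : Q) (c : Fin m → ℝ)
    (y : E × (E →L[ℝ] ℝ)) : E × (E →L[ℝ] ℝ) :=
  (y.1, y.2 - ∑ i, c i • dpot (γ i) x y.1)

/-- The right-hand side of the ordinary differential equation for the shifted state. -/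
noncomputable def shiftedField (L : TangentBundle 𝓘(ℝ, E) Q → ℝ)
    (V : Cotangent E Q → TangentBundle 𝓘(ℝ, E) Q) (γ : Fin m → Q → ℝ) (x : Q) (c : Fin m → ℝ)
    (y : E × (E →L[ℝ] ℝ)) : E × (E →L[ℝ] ℝ) :=
  (velInChart V x y,
    (fderiv ℝ (lagInChart L x) (y.1, velInChart V x y)).comp (ContinuousLinearMap.inl ℝ E E) -
      ∑ i, c i • fderiv ℝ (dpot (γ i) x) y.1 (velInChart V x y))

variable {L : TangentBundle 𝓘(ℝ, E) Q → ℝ} {V : Cotangent E Q → TangentBundle 𝓘(ℝ, E) Q}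
  {γ : Fin m → Q → ℝ}

omit [IsManifold 𝓘(ℝ, E) ∞ Q] in
theorem contDiffOn_dpot {γ : Q → ℝ} {n k : WithTop ℕ∞} [IsManifold 𝓘(ℝ, E) n Q]
    (hγ : ContMDiff 𝓘(ℝ, E) 𝓘(ℝ, ℝ) n γ) (x : Q) (hk : k + 1 ≤ n) :
    ContDiffOn ℝ k (dpot γ x) (chartAt E x).target :=
  (contDiffOn_comp_chart_symm hγ x).fderiv_of_isOpen (chartAt E x).open_target hk

theorem contDiffOn_chartVelocity (hV : ContMDiff (cotangentModel E) 𝓘(ℝ, E).tangent 1 V)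
    (hVp : ∀ z, (V z).proj = z.proj) (x : Q) :
    ContDiffOn ℝ 1 (fun y : E × (E →L[ℝ] ℝ) => (y.1, velInChart V x y))
      ((chartAt E x).target ×ˢ univ) :=
  contDiff_fst.contDiffOn.prodMk (contDiffOn_velInChart hV hVp x)

omit [IsManifold 𝓘(ℝ, E) ∞ Q] in
/-- The shifted state depends smoothly on the state, the noise being a parameter. -/
theorem contDiffOn_shiftedState {n k : WithTop ℕ∞} [IsManifold 𝓘(ℝ, E) n Q]
    (hγ : ∀ i, ContMDiff 𝓘(ℝ, E) 𝓘(ℝ, ℝ) n (γ i)) (x : Q) (hk : k + 1 ≤ n) :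
    ContDiffOn ℝ k (fun a : (Fin m → ℝ) × (E × (E →L[ℝ] ℝ)) => shiftedState γ x a.1 a.2)
      (univ ×ˢ ((chartAt E x).target ×ˢ univ)) := by
  have hy1 : ContDiffOn ℝ k (fun a : (Fin m → ℝ) × (E × (E →L[ℝ] ℝ)) => a.2.1)
      (univ ×ˢ ((chartAt E x).target ×ˢ univ)) := by fun_prop
  refine hy1.prodMk (ContDiffOn.sub
    (contDiff_snd.comp contDiff_snd).contDiffOn (ContDiffOn.sum fun i _ => ?_))
  refine ContDiffOn.smul ((contDiff_apply ℝ ℝ i).comp contDiff_fst).contDiffOn ?_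
  exact (contDiffOn_dpot (hγ i) x hk).comp hy1 fun a ha => ha.2.1

/-- The field contains second derivatives of the potentials, hence `k + 2 ≤ n`, while `V` and the
derivative of `L` are only `C¹`, hence `k ≤ 1`. The case `k = 0` serves `C²` potentials, and `k = 1`
serves `C³` ones. -/
theorem contDiffOn_shiftedField {n k : WithTop ℕ∞} [IsManifold 𝓘(ℝ, E) n Q]
    (hV : ContMDiff (cotangentModel E) 𝓘(ℝ, E).tangent 1 V) (hVp : ∀ z, (V z).proj = z.proj)
    (hL : ContMDiff 𝓘(ℝ, E).tangent 𝓘(ℝ, ℝ) 2 L)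
    (hγ : ∀ i, ContMDiff 𝓘(ℝ, E) 𝓘(ℝ, ℝ) n (γ i)) (x : Q) (hk : k + 1 + 1 ≤ n) (hk1 : k ≤ 1) :
    ContDiffOn ℝ k (fun a : (Fin m → ℝ) × (E × (E →L[ℝ] ℝ)) => shiftedField L V γ x a.1 a.2)
      (univ ×ˢ ((chartAt E x).target ×ˢ univ)) := by
  have hop := (chartAt E x).open_target
  have hsnd : MapsTo (Prod.snd : (Fin m → ℝ) × (E × (E →L[ℝ] ℝ)) → _)
      (univ ×ˢ ((chartAt E x).target ×ˢ univ)) ((chartAt E x).target ×ˢ univ) := fun a ha => ha.2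
  have hvel : ContDiffOn ℝ k (fun a : (Fin m → ℝ) × (E × (E →L[ℝ] ℝ)) => velInChart V x a.2)
      (univ ×ˢ ((chartAt E x).target ×ˢ univ)) :=
    ((contDiffOn_velInChart hV hVp x).of_le hk1).comp contDiff_snd.contDiffOn hsnd
  have hcv : ContDiffOn ℝ k
      (fun a : (Fin m → ℝ) × (E × (E →L[ℝ] ℝ)) => (a.2.1, velInChart V x a.2))
      (univ ×ˢ ((chartAt E x).target ×ˢ univ)) :=
    ((contDiffOn_chartVelocity hV hVp x).of_le hk1).comp contDiff_snd.contDiffOn hsnd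
  have hlag : ContDiffOn ℝ k (fderiv ℝ (lagInChart L x)) ((chartAt E x).target ×ˢ univ) :=
    ((contDiffOn_lagInChart hL x).fderiv_of_isOpen (hop.prod isOpen_univ)
      (m := 1) (by norm_num)).of_le hk1
  refine hvel.prodMk (ContDiffOn.sub ?_ (ContDiffOn.sum fun i _ => ?_))
  · exact (hlag.comp hcv fun a ha => ⟨ha.2.1, mem_univ _⟩).clm_comp contDiffOn_const
  · refine ContDiffOn.smul ((contDiff_apply ℝ ℝ i).comp contDiff_fst).contDiffOn (ContDiffOn.clm_apply ?_ hvel)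
    exact ((contDiffOn_dpot (hγ i) x hk).fderiv_of_isOpen hop le_rfl).comp
      (contDiff_fst.comp contDiff_snd).contDiffOn fun a ha => ha.2.1

/-- Between the times `s` and `t`, the trajectory `Φ · z` satisfies in the preferred chart at `x`,
as long as it stays in it, the integral form of the equations driven by the path `w`. -/
def SatisfiesEquation (L : TangentBundle 𝓘(ℝ, E) Q → ℝ)
    (V : Cotangent E Q → TangentBundle 𝓘(ℝ, E) Q) (γ : Fin m → Q → ℝ) (w : ℝ → Fin m → ℝ)
    (Φ : ℝ → Cotangent E Q → Cotangent E Q) (x : Q) (z : Cotangent E Q) (s t : ℝ) : Prop :=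
  (∀ r ∈ Icc s t, (Φ r z).proj ∈ (chartAt E x).source) →
    shiftedState γ x (w t) (coord E x (Φ t z)) - shiftedState γ x (w s) (coord E x (Φ s z)) =
      ∫ r in s..t, shiftedField L V γ x (w r) (coord E x (Φ r z))

variable {Ω : Type*} {mΩ : MeasurableSpace Ω}

/-- The relation `p = ∂L/∂v` places `(q, p)` in the image of `(q, v)` under the Legendre transform,
which `V` inverts. The velocity of a solution is thereby a function of its state. -/
theorem velInChart_eq (hV : Function.LeftInverse V (legendre L)) {x : Q} {c : Pontryagin E Q}
    (hc : c.2.2 = fiberDeriv L c.proj c.2.1) (hx : c.proj ∈ (chartAt E x).source) :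
    velInChart V x (coord E x c.toCotangent) =
      mfderiv 𝓘(ℝ, E) 𝓘(ℝ, E) (chartAt E x) c.proj c.2.1 := by
  have h1 : c.toCotangent = legendre L ⟨c.proj, c.2.1⟩ := by
    rw [Pontryagin.toCotangent, hc]
    rfl
  have h2 : (coord E x).symm (coord E x c.toCotangent) = c.toCotangent :=
    (coord E x).left_inv (mem_coord_source.2 hx)
  rw [velInChart, h2, h1, hV]

theorem integral_prodMk_sub_sum {A B ι : Type*} [NormedAddCommGroup A] [NormedSpace ℝ A]
    [CompleteSpace A] [NormedAddCommGroup B] [NormedSpace ℝ B] [CompleteSpace B] [Fintype ι]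
    {s t : ℝ} (hst : s ≤ t) {v : ℝ → A} {f : ℝ → B} {g : ι → ℝ → B}
    (hv : ContinuousOn v (Icc s t)) (hf : ContinuousOn f (Icc s t))
    (hg : ∀ i, ContinuousOn (g i) (Icc s t)) :
    ∫ r in s..t, (v r, f r - ∑ i, g i r) =
      (∫ r in s..t, v r, (∫ r in s..t, f r) - ∑ i, ∫ r in s..t, g i r) := by
  have hgs : ContinuousOn (fun r => ∑ i, g i r) (Icc s t) := continuousOn_finsetSum _ fun i _ => hg i
  have hint := (hv.prodMk (hf.sub hgs)).intervalIntegrable_of_Icc (μ := volume) hst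
  refine Prod.ext ?_ ?_
  · exact ((ContinuousLinearMap.fst ℝ A B).intervalIntegral_comp_comm hint).symm
  · refine ((ContinuousLinearMap.snd ℝ A B).intervalIntegral_comp_comm hint).symm.trans ?_
    refine (intervalIntegral.integral_sub (hf.intervalIntegrable_of_Icc hst)
      (hgs.intervalIntegrable_of_Icc hst)).trans ?_
    rw [intervalIntegral.integral_finsetSum fun i _ => (hg i).intervalIntegrable_of_Icc hst]

theorem sub_sum_sub_eq_of_sub_eq {B ι : Type*} [AddCommGroup B] [Fintype ι] {p q I : B}
    {α β δ : ι → B} (h : p - q = I + ∑ i, (α i - β i - δ i)) :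
    p - ∑ i, α i - (q - ∑ i, β i) = I - ∑ i, δ i := by
  simp only [Finset.sum_sub_distrib] at h
  rw [eq_add_of_sub_eq h]
  abel

/-- Bookkeeping after integration by parts: the boundary terms `w dγᵢ(q)` are absorbed into the
shifted momentum, and the remaining time integrals into the field. -/
theorem shiftedState_sub_eq_integral [FiniteDimensional ℝ E]
    (hL : ContMDiff 𝓘(ℝ, E).tangent 𝓘(ℝ, ℝ) 2 L)
    (hγ : ∀ i, ContMDiff 𝓘(ℝ, E) 𝓘(ℝ, ℝ) 2 (γ i))
    (hV : ContMDiff (cotangentModel E) 𝓘(ℝ, E).tangent 1 V) (hVp : ∀ z, (V z).proj = z.proj)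
    (x : Q) {s t : ℝ} (hst : s ≤ t) {w : ℝ → Fin m → ℝ} {y : ℝ → E × (E →L[ℝ] ℝ)}
    (hw : ContinuousOn w (Icc s t)) (hyc : ContinuousOn y (Icc s t))
    (hyt : ∀ r ∈ Icc s t, y r ∈ (chartAt E x).target ×ˢ (univ : Set (E →L[ℝ] ℝ)))
    (hxi : ∀ r ∈ Icc s t, HasDerivWithinAt (fun r => (y r).1) (velInChart V x (y r))
      (Icc s t) r)
    (hmom : (y t).2 - (y s).2 = (∫ r in s..t, (fderiv ℝ (lagInChart L x)
        ((y r).1, velInChart V x (y r))).comp (ContinuousLinearMap.inl ℝ E E)) +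
      ∑ i, (w t i • dpot (γ i) x (y t).1 - w s i • dpot (γ i) x (y s).1 -
        ∫ r in s..t, w r i • fderiv ℝ (dpot (γ i) x) (y r).1 (velInChart V x (y r)))) :
    shiftedState γ x (w t) (y t) - shiftedState γ x (w s) (y s) =
      ∫ r in s..t, shiftedField L V γ x (w r) (y r) := by
  have hvc : ContinuousOn (fun r => velInChart V x (y r)) (Icc s t) :=
    (contDiffOn_velInChart hV hVp x).continuousOn.comp hyc hyt
  have hpotc : ∀ i, ContinuousOn (fun r => fderiv ℝ (dpot (γ i) x) (y r).1
      (velInChart V x (y r))) (Icc s t) := by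
    intro i
    have h1 := (contDiffOn_dpot (k := 1) (hγ i) x (by norm_num)).continuousOn_fderiv_of_isOpen
      (chartAt E x).open_target le_rfl
    exact (h1.comp (continuous_fst.comp_continuousOn hyc) fun r hr => (hyt r hr).1).clm_apply hvc
  have hforcec : ContinuousOn (fun r => (fderiv ℝ (lagInChart L x)
      ((y r).1, velInChart V x (y r))).comp (ContinuousLinearMap.inl ℝ E E)) (Icc s t) := by
    have h1 := (contDiffOn_lagInChart hL x).continuousOn_fderiv_of_isOpen
      ((chartAt E x).open_target.prod isOpen_univ) (by norm_num)
    exact (h1.comp ((continuous_fst.comp_continuousOn hyc).prodMk hvc)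
      fun r hr => ⟨(hyt r hr).1, mem_univ _⟩).clm_comp continuousOn_const
  have hgc : ∀ i, ContinuousOn (fun r => w r i • fderiv ℝ (dpot (γ i) x) (y r).1
      (velInChart V x (y r))) (Icc s t) := fun i =>
    ((continuous_apply i).comp_continuousOn hw).smul (hpotc i)
  have h1 := integral_prodMk_sub_sum hst hvc hforcec hgc
  have h2 := intervalIntegral.integral_eq_sub_of_hasDerivAt_of_le hst
    (continuous_fst.comp_continuousOn hyc)
    (fun r hr => (hxi r (Ioo_subset_Icc_self hr)).hasDerivAt (Icc_mem_nhds hr.1 hr.2))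
    (hvc.intervalIntegrable_of_Icc hst)
  refine Eq.trans ?_ h1.symm
  rw [h2]
  refine Prod.ext rfl ?_
  exact sub_sum_sub_eq_of_sub_eq hmom

/-- The kinematic equation makes `dγᵢ(q)` a `C¹` function of time, so each Stratonovich integral in
the momentum equation has its pathwise value by `HasStratonovichIntegralOn.ae_eq`. The exceptional
null set may still depend on the initial point, the chart and the time interval. -/
theorem ae_satisfiesEquation_of_isSolution [FiniteDimensional ℝ E] {P : Measure Ω}
    [IsProbabilityMeasure P] {𝓕 : Filtration ℝ mΩ} {a b : ℝ} {W : Fin m → ℝ → Ω → ℝ}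
    (hW : ∀ i, ∀ᵐ η ∂P, ContinuousOn (fun t => W i t η) (Icc a b))
    (hL : ContMDiff 𝓘(ℝ, E).tangent 𝓘(ℝ, ℝ) 2 L)
    (hγ : ∀ i, ContMDiff 𝓘(ℝ, E) 𝓘(ℝ, ℝ) 2 (γ i))
    (hV : ContMDiff (cotangentModel E) 𝓘(ℝ, E).tangent 1 V) (hVp : ∀ z, (V z).proj = z.proj)
    (hVL : Function.LeftInverse V (legendre L))
    {F : ℝ → Ω → Cotangent E Q → Cotangent E Q}
    (hF : ∀ᵐ η ∂P, ContinuousOn (fun x : ℝ × Cotangent E Q => F x.1 η x.2) (Icc a b ×ˢ univ))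
    {c : ℝ → Ω → Pontryagin E Q} (hc : IsSolution L γ P 𝓕 W a b c) {z : Cotangent E Q}
    (hcF : ∀ᵐ η ∂P, ∀ t ∈ Icc a b, (c t η).toCotangent = F t η z) (x : Q) {s t : ℝ}
    (hs : s ∈ Icc a b) (ht : t ∈ Icc a b) (hst : s ≤ t) :
    ∀ᵐ η ∂P, SatisfiesEquation L V γ (fun r i => W i r η) (fun r => F r η) x z s t := by
  have hsub : Icc s t ⊆ Icc a b := Icc_subset_Icc hs.1 ht.2
  obtain ⟨J, hJ, hmom⟩ := hc.momentum (chartAt E x)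
    (IsManifold.chart_mem_maximalAtlas x) s hs t ht hst
  -- The time derivative of `dγᵢ(q)` as predicted by the chain rule, written through `F` because the
  -- velocity is a function of the state.
  have hJ' := fun i => (hJ i).ae_eq hst
    (fun r η => fderiv ℝ (dpot (γ i) x) (coord E x (F r η z)).1
      (velInChart V x (coord E x (F r η z))))
  filter_upwards [ae_all_iff.2 hW, hF, hcF, hc.kinematic, hc.legendre, hmom, ae_all_iff.2 hJ']
    with η hWη hFη hcFη hkin hleg hmomη hJη hsrc
  replace hsrc : ∀ r ∈ Icc s t, (F r η z).proj ∈ (chartAt E x).source := hsrc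
  have hcsrc : ∀ r ∈ Icc s t, (c r η).proj ∈ (chartAt E x).source := by
    intro r hr
    have := hsrc r hr
    rwa [← hcFη r (hsub hr)] at this
  set y : ℝ → E × (E →L[ℝ] ℝ) := fun r => coord E x (F r η z) with hy
  have hyc : ContinuousOn y (Icc s t) := by
    refine (continuousOn_coord x).comp
      ((continuousOn_slice hFη (mem_univ z)).mono hsub) fun r hr => ?_
    exact mem_coord_source.2 (hsrc r hr)
  have hyt : ∀ r ∈ Icc s t, y r ∈ (chartAt E x).target ×ˢ (univ : Set (E →L[ℝ] ℝ)) :=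
    fun r hr => ⟨(chartAt E x).map_source (hsrc r hr), mem_univ _⟩
  have hy1 : ∀ r ∈ Icc s t, (y r).1 = chartAt E x (c r η).proj := by
    intro r hr
    rw [hy]
    dsimp only
    rw [← hcFη r (hsub hr)]
    rfl
  have hvel : ∀ r ∈ Icc s t, velInChart V x (y r) =
      mfderiv 𝓘(ℝ, E) 𝓘(ℝ, E) (chartAt E x) (c r η).proj (c r η).2.1 := by
    intro r hr
    rw [hy]
    dsimp only
    rw [← hcFη r (hsub hr), velInChart_eq hVL (hleg r (hsub hr)) (hcsrc r hr)]
  have hvc : ContinuousOn (fun r => velInChart V x (y r)) (Icc s t) :=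
    (contDiffOn_velInChart hV hVp x).continuousOn.comp hyc hyt
  have hxi : ∀ r ∈ Icc s t, HasDerivWithinAt (fun r => (y r).1) (velInChart V x (y r))
      (Icc s t) r := by
    intro r hr
    let A : E →L[ℝ] E := mfderiv 𝓘(ℝ, E) 𝓘(ℝ, E) (chartAt E x) (c r η).proj
    let v : E := (c r η).2.1
    have h1 := ((chartAt_mdifferentiable x).mdifferentiableAt
      (hcsrc r hr)).hasMFDerivAt.comp_hasMFDerivWithinAt r ((hkin r (hsub hr)).mono hsub)
    have h2 : HasFDerivWithinAt (fun r => chartAt E x (c r η).proj)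
        (A.comp ((1 : ℝ →L[ℝ] ℝ).smulRight v)) (Icc s t) r :=
      HasMFDerivWithinAt.hasFDerivWithinAt h1
    have h3 : HasDerivWithinAt (fun r => chartAt E x (c r η).proj) (velInChart V x (y r))
        (Icc s t) r := by
      refine h2.hasDerivWithinAt.congr_deriv ?_
      refine Eq.trans ?_ (hvel r hr).symm
      change (A.comp ((1 : ℝ →L[ℝ] ℝ).smulRight v)) 1 = A v
      clear_value A v
      simp
    exact h3.congr hy1 (hy1 r hr)
  have hpotd : ∀ i, ∀ r ∈ Icc s t, HasDerivWithinAt (fun r => dpot (γ i) x (y r).1)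
      (fderiv ℝ (dpot (γ i) x) (y r).1 (velInChart V x (y r))) (Icc s t) r := by
    intro i r hr
    have h1 : DifferentiableAt ℝ (dpot (γ i) x) (y r).1 :=
      ((contDiffOn_dpot (k := 1) (hγ i) x (by norm_num)).contDiffAt
        ((chartAt E x).open_target.mem_nhds (hyt r hr).1)).differentiableAt one_ne_zero
    exact h1.hasFDerivAt.comp_hasDerivWithinAt r (hxi r hr)
  have hpotc : ∀ i, ContinuousOn (fun r => fderiv ℝ (dpot (γ i) x) (y r).1
      (velInChart V x (y r))) (Icc s t) := by
    intro i
    have h1 := (contDiffOn_dpot (k := 1) (hγ i) x (by norm_num)).continuousOn_fderiv_of_isOpen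
      (chartAt E x).open_target le_rfl
    exact (h1.comp (continuous_fst.comp_continuousOn hyc) fun r hr => (hyt r hr).1).clm_apply hvc
  have hpot : ∀ i, ∀ r ∈ Icc s t,
      potentialDerivInChart (γ i) (chartAt E x) (c r η).proj = dpot (γ i) x (y r).1 := by
    intro i r hr
    rw [hy1 r hr]
    rfl
  have hJval : ∀ i, J i η = W i t η • dpot (γ i) x (y t).1 - W i s η • dpot (γ i) x (y s).1 -
      ∫ r in s..t, W i r η • fderiv ℝ (dpot (γ i) x) (y r).1 (velInChart V x (y r)) := by
    intro i
    rw [← hpot i t (right_mem_Icc.2 hst), ← hpot i s (left_mem_Icc.2 hst)]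
    refine hJη i hcsrc ((hWη i).mono hsub) (hpotc i) fun r hr => ?_
    exact (hpotd i r hr).congr (hpot i) (hpot i r hr)
  have hbase : ∀ r ∈ Icc s t, baseDerivInChart L (chartAt E x) (c r η).proj (c r η).2.1 =
      (fderiv ℝ (lagInChart L x) ((y r).1, velInChart V x (y r))).comp
        (ContinuousLinearMap.inl ℝ E E) := by
    intro r hr
    have h1 : DifferentiableAt ℝ (lagInChart L x) ((y r).1, velInChart V x (y r)) :=
      ((contDiffOn_lagInChart hL x).contDiffAt
        (((chartAt E x).open_target.prod isOpen_univ).mem_nhds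
          ⟨(hyt r hr).1, mem_univ _⟩)).differentiableAt two_ne_zero
    have h2 : HasFDerivAt (fun e : E => lagInChart L x (e, velInChart V x (y r))) _ (y r).1 :=
      HasFDerivAt.comp (g := lagInChart L x) (y r).1 h1.hasFDerivAt
        (hasFDerivAt_prodMk_left (𝕜 := ℝ) (y r).1 (velInChart V x (y r)))
    rw [← h2.fderiv, hvel r hr, hy1 r hr]
    rfl
  have hmomeq : ∀ r ∈ Icc s t, momentumInChart (chartAt E x) (c r η).proj (c r η).2.2 =
      (y r).2 := by
    intro r hr
    have := momentumInChart_eq (z := (c r η).toCotangent) (hcsrc r hr)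
    exact this.trans (congrArg (fun z => (coord E x z).2) (hcFη r (hsub hr)))
  refine shiftedState_sub_eq_integral (w := fun r i => W i r η) (y := y) hL hγ hV hVp x hst
    (continuousOn_pi.2 fun i => (hWη i).mono hsub) hyc hyt hxi ?_
  have hmom' := hmomη hcsrc
  rw [hmomeq t (right_mem_Icc.2 hst), hmomeq s (left_mem_Icc.2 hst)] at hmom'
  rw [hmom', Finset.sum_congr rfl fun i _ => hJval i]
  congr 1
  exact intervalIntegral.integral_congr fun r hr => hbase r (by rwa [uIcc_of_le hst] at hr)

end LocalEquations

/-! ### One null set for all initial points, charts and time intervals. -/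

section Extension

variable {E : Type*} [NormedAddCommGroup E] [NormedSpace ℝ E]
  {Q : Type*} [TopologicalSpace Q] [ChartedSpace E Q] [IsManifold 𝓘(ℝ, E) ∞ Q]
  {m : ℕ} {L : TangentBundle 𝓘(ℝ, E) Q → ℝ} {V : Cotangent E Q → TangentBundle 𝓘(ℝ, E) Q}
  {γ : Fin m → Q → ℝ} {A : Type*} [TopologicalSpace A] {S : Set A} {c : A → Fin m → ℝ}
  {y : A → E × (E →L[ℝ] ℝ)}

theorem continuousOn_coord_comp {f : A → Cotangent E Q} (hf : ContinuousOn f S) {x : Q}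
    (hx : ∀ a ∈ S, (f a).proj ∈ (chartAt E x).source) :
    ContinuousOn (fun a => coord E x (f a)) S :=
  (continuousOn_coord x).comp hf fun a ha => mem_coord_source.2 (hx a ha)

theorem coord_mem_target {x : Q} {z : Cotangent E Q} (hz : z.proj ∈ (chartAt E x).source) :
    coord E x z ∈ (chartAt E x).target ×ˢ (univ : Set (E →L[ℝ] ℝ)) :=
  ⟨(chartAt E x).map_source hz, mem_univ _⟩

omit [IsManifold 𝓘(ℝ, E) ∞ Q] in
theorem continuousOn_shiftedState_comp [IsManifold 𝓘(ℝ, E) 2 Q]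
    (hγ : ∀ i, ContMDiff 𝓘(ℝ, E) 𝓘(ℝ, ℝ) 2 (γ i)) (x : Q)
    (hc : ContinuousOn c S) (hy : ContinuousOn y S)
    (hyt : ∀ a ∈ S, y a ∈ (chartAt E x).target ×ˢ (univ : Set (E →L[ℝ] ℝ))) :
    ContinuousOn (fun a => shiftedState γ x (c a) (y a)) S :=
  (contDiffOn_shiftedState (k := 0) hγ x (by norm_num)).continuousOn.comp
    (hc.prodMk hy) fun a ha => ⟨mem_univ _, hyt a ha⟩

theorem zero_add_one_add_one_le_two : (0 : WithTop ℕ∞) + 1 + 1 ≤ 2 := by norm_num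

theorem continuousOn_shiftedField_comp
    (hV : ContMDiff (cotangentModel E) 𝓘(ℝ, E).tangent 1 V) (hVp : ∀ z, (V z).proj = z.proj)
    (hL : ContMDiff 𝓘(ℝ, E).tangent 𝓘(ℝ, ℝ) 2 L)
    (hγ : ∀ i, ContMDiff 𝓘(ℝ, E) 𝓘(ℝ, ℝ) 2 (γ i)) (x : Q)
    (hc : ContinuousOn c S) (hy : ContinuousOn y S)
    (hyt : ∀ a ∈ S, y a ∈ (chartAt E x).target ×ˢ (univ : Set (E →L[ℝ] ℝ))) :
    ContinuousOn (fun a => shiftedField L V γ x (c a) (y a)) S :=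
  ((contDiffOn_shiftedField (k := 0) hV hVp hL hγ x zero_add_one_add_one_le_two
    zero_le_one).continuousOn.comp (hc.prodMk hy) fun a ha => ⟨mem_univ _, hyt a ha⟩ :)

variable [FiniteDimensional ℝ E] {a b : ℝ} {w : ℝ → Fin m → ℝ}
  {Φ : ℝ → Cotangent E Q → Cotangent E Q}

/-- The integral equations pass from a dense set of initial conditions to all of them. -/
theorem satisfiesEquation_of_dense
    (hV : ContMDiff (cotangentModel E) 𝓘(ℝ, E).tangent 1 V) (hVp : ∀ z, (V z).proj = z.proj)
    (hL : ContMDiff 𝓘(ℝ, E).tangent 𝓘(ℝ, ℝ) 2 L)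
    (hγ : ∀ i, ContMDiff 𝓘(ℝ, E) 𝓘(ℝ, ℝ) 2 (γ i)) {x : Q} {s t : ℝ} (hst : s ≤ t)
    (hw : ContinuousOn w (Icc s t))
    (hΦ : ContinuousOn (fun x : ℝ × Cotangent E Q => Φ x.1 x.2) (Icc s t ×ˢ univ))
    {D : Set (Cotangent E Q)} (hD : Dense D)
    (h : ∀ z ∈ D, SatisfiesEquation L V γ w Φ x z s t) (z : Cotangent E Q) :
    SatisfiesEquation L V γ w Φ x z s t := by
  let O : Set (Cotangent E Q) := {z | ∀ r ∈ Icc s t, (Φ r z).proj ∈ (chartAt E x).source}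
  -- By compactness of `[s, t]`, staying in the chart during the whole interval is an open condition
  -- on the initial point; a dense set therefore remains dense inside it.
  have hO : IsOpen O := by
    refine isOpen_iff_mem_nhds.2 fun z hz => ?_
    have := eventually_forall_mem_of_continuousOn isCompact_Icc isOpen_univ hΦ
      (isOpen_coord_source x) (mem_univ z) fun r hr => mem_coord_source.2 (hz r hr)
    filter_upwards [this] with z' hz' r hr using mem_coord_source.1 (hz' r hr)
  have hΦO : ContinuousOn (fun x : ℝ × Cotangent E Q => Φ x.1 x.2) (Icc s t ×ˢ O) :=
    hΦ.mono (prod_mono_right (subset_univ _))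
  have hy := continuousOn_coord_comp (x := x) hΦO fun a ha => ha.2 a.1 ha.1
  have hyt : ∀ a ∈ Icc s t ×ˢ O, coord E x (Φ a.1 a.2) ∈
      (chartAt E x).target ×ˢ (univ : Set (E →L[ℝ] ℝ)) :=
    fun a ha => coord_mem_target (ha.2 a.1 ha.1)
  have hw' : ContinuousOn (fun a : ℝ × Cotangent E Q => w a.1) (Icc s t ×ˢ O) :=
    hw.comp continuousOn_fst fun a ha => ha.1
  have hstate := continuousOn_shiftedState_comp hγ x hw' hy hyt
  have hfield := continuousOn_shiftedField_comp hV hVp hL hγ x hw' hy hyt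
  have hslice : ∀ r ∈ Icc s t,
      ContinuousOn (fun z => shiftedState γ x (w r) (coord E x (Φ r z))) O := fun r hr =>
    hstate.comp (f := fun z : Cotangent E Q => (r, z)) (by fun_prop) fun z hz => ⟨hr, hz⟩
  have heq : EqOn (fun z => shiftedState γ x (w t) (coord E x (Φ t z)) -
        shiftedState γ x (w s) (coord E x (Φ s z)))
      (fun z => ∫ r in s..t, shiftedField L V γ x (w r) (coord E x (Φ r z))) O := by
    refine EqOn.of_subset_closure (s := O ∩ D) (fun z hz => h z hz.2 hz.1)
      ((hslice t (right_mem_Icc.2 hst)).sub (hslice s (left_mem_Icc.2 hst)))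
      (continuousOn_intervalIntegral_of_continuousOn hst hfield) inter_subset_left
      (hD.open_subset_closure_inter hO)
  exact fun hz => heq hz

omit [FiniteDimensional ℝ E] in
/-- The integral equations pass from rational times to all times. -/
theorem satisfiesEquation_of_rat
    (hV : ContMDiff (cotangentModel E) 𝓘(ℝ, E).tangent 1 V) (hVp : ∀ z, (V z).proj = z.proj)
    (hL : ContMDiff 𝓘(ℝ, E).tangent 𝓘(ℝ, ℝ) 2 L)
    (hγ : ∀ i, ContMDiff 𝓘(ℝ, E) 𝓘(ℝ, ℝ) 2 (γ i)) {x : Q} {z : Cotangent E Q} {s t : ℝ}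
    (hst : s ≤ t) (hw : ContinuousOn w (Icc s t))
    (hΦ : ContinuousOn (fun r => Φ r z) (Icc s t))
    (h : ∀ p q : ℚ, s ≤ p → (q : ℝ) ≤ t → p ≤ q → SatisfiesEquation L V γ w Φ x z p q) :
    SatisfiesEquation L V γ w Φ x z s t := by
  intro hsrc
  rcases hst.eq_or_lt with rfl | hlt
  · simp
  have hy := continuousOn_coord_comp (x := x) hΦ hsrc
  have hyt := fun r hr => coord_mem_target (hsrc r hr)
  have hstate := continuousOn_shiftedState_comp hγ x hw hy hyt
  have hfield := continuousOn_shiftedField_comp hV hVp hL hγ x hw hy hyt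
  set f : ℝ → E × (E →L[ℝ] ℝ) := fun r => shiftedField L V γ x (w r) (coord E x (Φ r z)) with hf
  set g : ℝ → E × (E →L[ℝ] ℝ) := fun r => shiftedState γ x (w r) (coord E x (Φ r z)) with hg
  have hii : ∀ u ∈ Icc s t, ∀ v ∈ Icc s t, IntervalIntegrable f volume u v := fun u hu v hv =>
    (hfield.mono (uIcc_subset_Icc hu hv)).intervalIntegrable
  have hprim : ContinuousOn (fun r => ∫ τ in s..r, f τ) (Icc s t) := by
    have := intervalIntegral.continuousOn_primitive_interval'
      (hii s (left_mem_Icc.2 hst) t (right_mem_Icc.2 hst)) left_mem_uIcc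
    rwa [uIcc_of_le hst] at this
  obtain ⟨p, hp⟩ := exists_rat_btwn hlt
  have hpm : (p : ℝ) ∈ Icc s t := ⟨hp.1.le, hp.2.le⟩
  have key : ∀ q : ℚ, (q : ℝ) ∈ Icc s t → ∀ q' : ℚ, (q' : ℝ) ∈ Icc s t → q ≤ q' →
      g q' - ∫ τ in s..q', f τ = g q - ∫ τ in s..q, f τ := by
    intro q hq q' hq' hqq
    have h1 : g q' - g q = ∫ τ in (q : ℝ)..q', f τ := h q q' hq.1 hq'.2 hqq fun r hr =>
      hsrc r ⟨hq.1.trans hr.1, hr.2.trans hq'.2⟩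
    have h2 := intervalIntegral.integral_add_adjacent_intervals
      (hii s (left_mem_Icc.2 hst) q hq) (hii q hq q' hq')
    rw [← h2, ← h1]
    abel
  -- The shifted state minus the primitive of the field is continuous on `[s, t]` and constant at
  -- rational interior times, hence constant up to the possibly irrational end points.
  have heq : EqOn (fun r => g r - ∫ τ in s..r, f τ) (fun _ => g p - ∫ τ in s..p, f τ)
      (Icc s t) := by
    refine EqOn.of_subset_closure (s := Ioo s t ∩ range ((↑) : ℚ → ℝ)) ?_
      (hstate.sub hprim) continuousOn_const
      (inter_subset_left.trans Ioo_subset_Icc_self) ?_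
    · rintro _ ⟨hr, q, rfl⟩
      rcases le_total p q with hpq | hpq
      · exact key p hpm q (Ioo_subset_Icc_self hr) hpq
      · exact (key q (Ioo_subset_Icc_self hr) p hpm hpq).symm
    · rw [← closure_Ioo hlt.ne]
      exact closure_minimal
        (Rat.denseRange_cast.open_subset_closure_inter isOpen_Ioo) isClosed_closure
  have h1 := (heq (right_mem_Icc.2 hst)).trans (heq (left_mem_Icc.2 hst)).symm
  simp only [intervalIntegral.integral_same, sub_zero] at h1
  change g t - g s = _
  rw [← h1]
  abel

/-- Countably many charts cover `Q`, and their bundle charts have second countable model. The result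
supplies the countable dense set of initial conditions. -/
theorem separableSpace_cotangent [SecondCountableTopology Q] :
    TopologicalSpace.SeparableSpace (Cotangent E Q) := by
  have : ProperSpace E := FiniteDimensional.proper_real E
  have : ProperSpace (E →L[ℝ] ℝ) := FiniteDimensional.proper_real _
  obtain ⟨C, hC, hCU⟩ := TopologicalSpace.countable_cover_nhds fun x : Q => chart_source_mem_nhds E x
  have : SecondCountableTopology (ModelProd E (E →L[ℝ] ℝ)) :=
    inferInstanceAs (SecondCountableTopology (E × (E →L[ℝ] ℝ)))
  have : SecondCountableTopology (Cotangent E Q) := by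
    refine ChartedSpace.secondCountable_of_countable_cover (ModelProd E (E →L[ℝ] ℝ))
      (s := (fun x : Q => (⟨x, 0⟩ : Cotangent E Q)) '' C) ?_ (hC.image _)
    refine eq_univ_of_forall fun z => ?_
    obtain ⟨x, hx, hz⟩ := mem_iUnion₂.1 (hCU.ge (mem_univ z.proj))
    exact mem_iUnion₂.2 ⟨_, mem_image_of_mem _ hx, mem_cotangent_chart_source.2 hz⟩
  infer_instance

/-- Almost surely, all trajectories of a stochastic flow satisfy the integral equations over all
time intervals, in charts that cover the manifold. -/
theorem IsStochasticFlow.ae_satisfiesEquation [SecondCountableTopology Q]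
    {Ω : Type*} {mΩ : MeasurableSpace Ω} {P : Measure Ω}
    [IsProbabilityMeasure P] {𝓕 : Filtration ℝ mΩ} {W : Fin m → ℝ → Ω → ℝ}
    {F : ℝ → Ω → Cotangent E Q → Cotangent E Q} (hF : IsStochasticFlow L γ P 𝓕 W a b F)
    (hW : ∀ i, ∀ᵐ η ∂P, ContinuousOn (fun t => W i t η) (Icc a b))
    (hL : ContMDiff 𝓘(ℝ, E).tangent 𝓘(ℝ, ℝ) 2 L)
    (hγ : ∀ i, ContMDiff 𝓘(ℝ, E) 𝓘(ℝ, ℝ) 2 (γ i))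
    (hV : ContMDiff (cotangentModel E) 𝓘(ℝ, E).tangent 1 V) (hVp : ∀ z, (V z).proj = z.proj)
    (hVL : Function.LeftInverse V (legendre L)) :
    ∀ᵐ η ∂P, ∀ q : Q, ∃ x, q ∈ (chartAt E x).source ∧ ∀ z, ∀ s ∈ Icc a b, ∀ t ∈ Icc a b, s ≤ t →
      SatisfiesEquation L V γ (fun r i => W i r η) (fun r => F r η) x z s t := by
  have := separableSpace_cotangent (E := E) (Q := Q)
  obtain ⟨D, hDc, hD⟩ := TopologicalSpace.exists_countable_dense (Cotangent E Q)
  obtain ⟨C, hC, hCU⟩ := TopologicalSpace.countable_cover_nhds fun x : Q => chart_source_mem_nhds E x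
  -- Only countably many null sets are discarded: charts from a countable cover, initial points from
  -- a countable dense set, rational times. The rest is continuity on a fixed path.
  have h0 : ∀ᵐ η ∂P, ∀ x ∈ C, ∀ z ∈ D, ∀ p q : ℚ, (p : ℝ) ∈ Icc a b → (q : ℝ) ∈ Icc a b →
      (p : ℝ) ≤ q → SatisfiesEquation L V γ (fun r i => W i r η) (fun r => F r η) x z p q := by
    refine (ae_ball_iff hC).2 fun x _ => (ae_ball_iff hDc).2 fun z _ =>
      ae_all_iff.2 fun p => ae_all_iff.2 fun q => ?_
    by_cases hp : (p : ℝ) ∈ Icc a b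
    · by_cases hq : (q : ℝ) ∈ Icc a b
      · by_cases hpq : (p : ℝ) ≤ q
        · obtain ⟨c, hc, hcF⟩ := hF.solves z
          filter_upwards [ae_satisfiesEquation_of_isSolution hW hL hγ hV hVp hVL hF.continuous hc
            hcF x hp hq hpq] with η hη _ _ _ using hη
        · exact Eventually.of_forall fun η _ _ h => absurd h hpq
      · exact Eventually.of_forall fun η _ h => absurd h hq
    · exact Eventually.of_forall fun η h => absurd h hp
  filter_upwards [h0, ae_all_iff.2 hW, hF.continuous] with η hη hWη hFη q
  obtain ⟨x, hx, hq⟩ := mem_iUnion₂.1 (hCU.ge (mem_univ q))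
  have hwη : ContinuousOn (fun r i => W i r η) (Icc a b) := continuousOn_pi.2 hWη
  refine ⟨x, hq, fun z s hs t ht hst => ?_⟩
  have hsub : Icc s t ⊆ Icc a b := Icc_subset_Icc hs.1 ht.2
  refine satisfiesEquation_of_rat hV hVp hL hγ hst (hwη.mono hsub)
    ((continuousOn_slice hFη (mem_univ z)).mono hsub) fun p q hp hq hpq => ?_
  have hpq' : (p : ℝ) ≤ q := by exact_mod_cast hpq
  have hpm : (p : ℝ) ∈ Icc a b := hsub ⟨hp, hpq'.trans hq⟩
  have hqm : (q : ℝ) ∈ Icc a b := hsub ⟨hp.trans hpq', hq⟩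
  have hsub' : Icc (p : ℝ) q ⊆ Icc a b := Icc_subset_Icc hpm.1 hqm.2
  exact satisfiesEquation_of_dense hV hVp hL hγ hpq' (hwη.mono hsub')
    (hFη.mono (prod_mono_left hsub')) hD (fun z hz => hη x hx z hz p q hpm hqm hpq') z

end Extension

/-! ### First variation of the action along a driven flow. -/

section FirstVariation

variable {E : Type*} [NormedAddCommGroup E] [NormedSpace ℝ E]
  {Q : Type*} [TopologicalSpace Q] [ChartedSpace E Q] [IsManifold 𝓘(ℝ, E) ∞ Q]
  {m : ℕ} {L : TangentBundle 𝓘(ℝ, E) Q → ℝ} {V : Cotangent E Q → TangentBundle 𝓘(ℝ, E) Q}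
  {γ : Fin m → Q → ℝ} {x : Q}

/-- The family `Φ` of maps of the cotangent bundle solves the equations driven by the path `w`, the
velocity being the function `V` of state. -/
structure IsDrivenFlow (L : TangentBundle 𝓘(ℝ, E) Q → ℝ)
    (V : Cotangent E Q → TangentBundle 𝓘(ℝ, E) Q) (γ : Fin m → Q → ℝ) (w : ℝ → Fin m → ℝ)
    (a b : ℝ) (Φ : ℝ → Cotangent E Q → Cotangent E Q) : Prop where
  lagrangian : ContMDiff 𝓘(ℝ, E).tangent 𝓘(ℝ, ℝ) 2 L
  potential : ∀ i, ContMDiff 𝓘(ℝ, E) 𝓘(ℝ, ℝ) 2 (γ i)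
  velocity : ContMDiff (cotangentModel E) 𝓘(ℝ, E).tangent 1 V
  legendre : ∀ z, legendre L (V z) = z
  noise : ContinuousOn w (Icc a b)
  start : ∀ z, Φ a z = z
  continuous : ContinuousOn (fun x : ℝ × Cotangent E Q => Φ x.1 x.2) (Icc a b ×ˢ univ)
  equation : ∀ q : Q, ∃ x, q ∈ (chartAt E x).source ∧ ∀ z, ∀ s ∈ Icc a b, ∀ t ∈ Icc a b, s ≤ t →
    SatisfiesEquation L V γ w Φ x z s t

omit [IsManifold 𝓘(ℝ, E) ∞ Q] in
theorem hasFDerivAt_potential [IsManifold 𝓘(ℝ, E) 2 Q] {γ : Q → ℝ}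
    (hγ : ContMDiff 𝓘(ℝ, E) 𝓘(ℝ, ℝ) 2 γ) {e : E} (he : e ∈ (chartAt E x).target) :
    HasFDerivAt (fun e => γ ((chartAt E x).symm e)) (dpot γ x e) e :=
  (((contDiffOn_comp_chart_symm hγ x).contDiffAt
    ((chartAt E x).open_target.mem_nhds he)).differentiableAt two_ne_zero).hasFDerivAt

omit [IsManifold 𝓘(ℝ, E) ∞ Q] in
theorem hasFDerivAt_dpot [IsManifold 𝓘(ℝ, E) 2 Q] {γ : Q → ℝ}
    (hγ : ContMDiff 𝓘(ℝ, E) 𝓘(ℝ, ℝ) 2 γ) {e : E} (he : e ∈ (chartAt E x).target) :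
    HasFDerivAt (dpot γ x) (fderiv ℝ (dpot γ x) e) e :=
  (((contDiffOn_dpot (k := 1) hγ x (by norm_num)).contDiffAt
    ((chartAt E x).open_target.mem_nhds he)).differentiableAt one_ne_zero).hasFDerivAt

-- Used in the first variation to exchange `D(dγ)(δq) v`, which arises from varying the Lagrangian,
-- with `D(dγ)(v) δq`, which occurs in the equation of motion.
omit [IsManifold 𝓘(ℝ, E) ∞ Q] in
theorem fderiv_dpot_symm [IsManifold 𝓘(ℝ, E) 2 Q] {γ : Q → ℝ}
    (hγ : ContMDiff 𝓘(ℝ, E) 𝓘(ℝ, ℝ) 2 γ) {e : E} (he : e ∈ (chartAt E x).target) (u v : E) :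
    fderiv ℝ (dpot γ x) e u v = fderiv ℝ (dpot γ x) e v u := by
  have h := ((contDiffOn_comp_chart_symm hγ x).contDiffAt
    ((chartAt E x).open_target.mem_nhds he)).isSymmSndFDerivAt
      (by simp [minSmoothness_of_isRCLikeNormedField])
  exact h u v

theorem hasFDerivAt_lagInChart (hL : ContMDiff 𝓘(ℝ, E).tangent 𝓘(ℝ, ℝ) 2 L) {y : E × E}
    (hy : y.1 ∈ (chartAt E x).target) :
    HasFDerivAt (lagInChart L x) (fderiv ℝ (lagInChart L x) y) y :=
  (((contDiffOn_lagInChart hL x).contDiffAt (((chartAt E x).open_target.prod isOpen_univ).mem_nhds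
    ⟨hy, mem_univ _⟩)).differentiableAt two_ne_zero).hasFDerivAt

theorem hasFDerivAt_velInChart (hV : ContMDiff (cotangentModel E) 𝓘(ℝ, E).tangent 1 V)
    (hVp : ∀ z, (V z).proj = z.proj) {y : E × (E →L[ℝ] ℝ)} (hy : y.1 ∈ (chartAt E x).target) :
    HasFDerivAt (velInChart V x) (fderiv ℝ (velInChart V x) y) y :=
  (((contDiffOn_velInChart hV hVp x).contDiffAt
    (((chartAt E x).open_target.prod isOpen_univ).mem_nhds ⟨hy, mem_univ _⟩)).differentiableAt
      one_ne_zero).hasFDerivAt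

/-- The momentum is the fibre derivative of the Lagrangian, in coordinates. -/
theorem fderiv_lagInChart_comp_inr (hL : ContMDiff 𝓘(ℝ, E).tangent 𝓘(ℝ, ℝ) 2 L)
    (hV : ∀ z, legendre L (V z) = z) {y : E × (E →L[ℝ] ℝ)} (hy : y.1 ∈ (chartAt E x).target) :
    (fderiv ℝ (lagInChart L x) (y.1, velInChart V x y)).comp (ContinuousLinearMap.inr ℝ E E) =
      y.2 := by
  have hyt : y ∈ (coord E x).target := by
    rw [coord_target]
    exact ⟨hy, mem_univ _⟩
  have hp : (V ((coord E x).symm y)).proj = (chartAt E x).symm y.1 :=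
    congrArg TotalSpace.proj (hV ((coord E x).symm y))
  have hsrc : (V ((coord E x).symm y)).proj ∈ (chartAt E x).source := by
    rw [hp]
    exact (chartAt E x).map_target hy
  have h1 := coord_legendre_snd (hL.of_le one_le_two) hsrc
  have hbase : chartAt E x (V ((coord E x).symm y)).proj = y.1 := by
    rw [hp]
    exact (chartAt E x).right_inv hy
  rw [hV, (coord E x).right_inv hyt, hbase] at h1
  have h2 : HasFDerivAt (fun u : E => lagInChart L x (y.1, u)) _ (velInChart V x y) :=
    HasFDerivAt.comp (g := lagInChart L x) (velInChart V x y)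
      (hasFDerivAt_lagInChart (y := (y.1, velInChart V x y)) hL hy)
      (hasFDerivAt_prodMk_right (𝕜 := ℝ) y.1 (velInChart V x y))
  exact h2.unique h1

/-- The Lagrangian of the shifted equations, as a function of the state. -/
noncomputable def reducedLagrangian (L : TangentBundle 𝓘(ℝ, E) Q → ℝ)
    (V : Cotangent E Q → TangentBundle 𝓘(ℝ, E) Q) (γ : Fin m → Q → ℝ) (x : Q) (c : Fin m → ℝ)
    (y : E × (E →L[ℝ] ℝ)) : ℝ :=
  lagInChart L x (y.1, velInChart V x y) - ∑ i, c i * dpot (γ i) x y.1 (velInChart V x y)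

/-- This is `dℓ = (force) dq + p̃ dv`: the Legendre relation identifies `∂L/∂v` with `p`, so the
coefficient of `dv` is the shifted momentum, and symmetry of the second derivatives of the
potentials makes the coefficient of `dq` the second component of the field. -/
theorem hasFDerivAt_reducedLagrangian (hL : ContMDiff 𝓘(ℝ, E).tangent 𝓘(ℝ, ℝ) 2 L)
    (hγ : ∀ i, ContMDiff 𝓘(ℝ, E) 𝓘(ℝ, ℝ) 2 (γ i))
    (hV : ContMDiff (cotangentModel E) 𝓘(ℝ, E).tangent 1 V)
    (hVL : ∀ z, legendre L (V z) = z) (c : Fin m → ℝ)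
    {y : E × (E →L[ℝ] ℝ)} (hy : y.1 ∈ (chartAt E x).target) :
    HasFDerivAt (reducedLagrangian L V γ x c)
      ((shiftedField L V γ x c y).2.comp (ContinuousLinearMap.fst ℝ E (E →L[ℝ] ℝ)) +
        (shiftedState γ x c y).2.comp (fderiv ℝ (velInChart V x) y)) y := by
  have hVp : ∀ z, (V z).proj = z.proj := fun z => congrArg TotalSpace.proj (hVL z)
  have hv := hasFDerivAt_velInChart hV hVp hy
  have hfst : HasFDerivAt (Prod.fst : E × (E →L[ℝ] ℝ) → E)
      (ContinuousLinearMap.fst ℝ E (E →L[ℝ] ℝ)) y := hasFDerivAt_fst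
  have h1 : HasFDerivAt (fun y : E × (E →L[ℝ] ℝ) => lagInChart L x (y.1, velInChart V x y)) _ y :=
    HasFDerivAt.comp (g := lagInChart L x) y
      (hasFDerivAt_lagInChart (y := (y.1, velInChart V x y)) hL hy) (hfst.prodMk hv)
  have h2 : ∀ i, HasFDerivAt
      (fun y : E × (E →L[ℝ] ℝ) => c i * dpot (γ i) x y.1 (velInChart V x y)) _ y := fun i =>
    (HasFDerivAt.clm_apply (HasFDerivAt.comp (g := dpot (γ i) x) y
      (hasFDerivAt_dpot (hγ i) hy) hfst) hv).const_mul (c i)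
  have h3 := h1.sub (HasFDerivAt.fun_sum fun i (_ : i ∈ Finset.univ) => h2 i)
  refine h3.congr_fderiv ?_
  have hleg := fderiv_lagInChart_comp_inr hL hVL hy
  refine ContinuousLinearMap.ext fun u => ?_
  have hsplit : ∀ (T : E × E →L[ℝ] ℝ) (e e' : E), T (e, e') =
      T.comp (ContinuousLinearMap.inl ℝ E E) e + T.comp (ContinuousLinearMap.inr ℝ E E) e' := by
    intro T e e'
    simp [← map_add]
  simp only [sub_apply, add_apply, ContinuousLinearMap.comp_apply,
    ContinuousLinearMap.prod_apply, sum_apply, smul_apply,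
    ContinuousLinearMap.flip_apply, smul_eq_mul, shiftedField, shiftedState,
    ContinuousLinearMap.coe_fst', Function.comp_apply]
  rw [hsplit, hleg]
  simp only [fun i => fderiv_dpot_symm (hγ i) hy u.1 (velInChart V x y), mul_add,
    Finset.sum_add_distrib, ContinuousLinearMap.comp_apply]
  ring

variable [FiniteDimensional ℝ E] {Y : Type*} [NormedAddCommGroup Y] [NormedSpace ℝ Y]

omit [FiniteDimensional ℝ E] in
theorem continuousOn_reducedLagrangian {A : Type*} [TopologicalSpace A] {S : Set A}
    {c : A → Fin m → ℝ} {y : A → E × (E →L[ℝ] ℝ)}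
    (hL : ContMDiff 𝓘(ℝ, E).tangent 𝓘(ℝ, ℝ) 2 L)
    (hγ : ∀ i, ContMDiff 𝓘(ℝ, E) 𝓘(ℝ, ℝ) 2 (γ i))
    (hV : ContMDiff (cotangentModel E) 𝓘(ℝ, E).tangent 1 V) (hVp : ∀ z, (V z).proj = z.proj)
    (hc : ContinuousOn c S) (hy : ContinuousOn y S)
    (hyt : ∀ a ∈ S, y a ∈ (chartAt E x).target ×ˢ (univ : Set (E →L[ℝ] ℝ))) :
    ContinuousOn (fun a => reducedLagrangian L V γ x (c a) (y a)) S := by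
  have hv : ContinuousOn (fun a => velInChart V x (y a)) S :=
    (contDiffOn_velInChart hV hVp x).continuousOn.comp hy hyt
  have hy1 : ContinuousOn (fun a => (y a).1) S := continuous_fst.comp_continuousOn hy
  refine ContinuousOn.sub ?_ (continuousOn_finsetSum _ fun i _ => ContinuousOn.mul
    ((continuous_apply i).comp_continuousOn hc) (ContinuousOn.clm_apply ?_ hv))
  · exact (contDiffOn_lagInChart hL x).continuousOn.comp (f := fun a => ((y a).1, velInChart V x (y a)))
      (hy1.prodMk hv) fun a ha => ⟨(hyt a ha).1, mem_univ _⟩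
  · exact (contDiffOn_dpot (k := 1) (hγ i) x (by norm_num)).continuousOn.comp hy1
      fun a ha => (hyt a ha).1

/-- The increment of `p dq` along a differentiable family of solutions is exact. -/
theorem exists_hasFDerivAt_increment {w : ℝ → Fin m → ℝ}
    (hL : ContMDiff 𝓘(ℝ, E).tangent 𝓘(ℝ, ℝ) 2 L)
    (hγ : ∀ i, ContMDiff 𝓘(ℝ, E) 𝓘(ℝ, ℝ) 2 (γ i))
    (hV : ContMDiff (cotangentModel E) 𝓘(ℝ, E).tangent 1 V)
    (hVL : ∀ z, legendre L (V z) = z) {s t : ℝ} (hst : s ≤ t) (hw : ContinuousOn w (Icc s t))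
    {U : Set Y} (hU : IsOpen U) {H : ℝ → Y → E × (E →L[ℝ] ℝ)}
    {H' : ℝ → Y → Y →L[ℝ] E × (E →L[ℝ] ℝ)}
    (hHt : ∀ r ∈ Icc s t, ∀ y ∈ U, H r y ∈ (chartAt E x).target ×ˢ (univ : Set (E →L[ℝ] ℝ)))
    (hH : ContinuousOn (fun a : ℝ × Y => H a.1 a.2) (Icc s t ×ˢ U))
    (hHd : ∀ r ∈ Icc s t, ∀ y ∈ U, HasFDerivAt (H r) (H' r y) y)
    (hH' : ContinuousOn (fun a : ℝ × Y => H' a.1 a.2) (Icc s t ×ˢ U))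
    (heq : ∀ r ∈ Icc s t, ∀ y ∈ U,
      shiftedState γ x (w r) (H r y) - shiftedState γ x (w s) (H s y) =
        ∫ r in s..r, shiftedField L V γ x (w r) (H r y)) :
    ∃ S : Y → ℝ, ∀ y ∈ U, HasFDerivAt S
      ((H t y).2.comp ((ContinuousLinearMap.fst ℝ E (E →L[ℝ] ℝ)).comp (H' t y)) -
        (H s y).2.comp ((ContinuousLinearMap.fst ℝ E (E →L[ℝ] ℝ)).comp (H' s y))) y := by
  have hVp : ∀ z, (V z).proj = z.proj := fun z => congrArg TotalSpace.proj (hVL z)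
  have hHt' : ∀ a ∈ Icc s t ×ˢ U, H a.1 a.2 ∈ (chartAt E x).target ×ˢ (univ : Set (E →L[ℝ] ℝ)) :=
    fun a ha => hHt a.1 ha.1 a.2 ha.2
  have hw' : ContinuousOn (fun a : ℝ × Y => w a.1) (Icc s t ×ˢ U) :=
    hw.comp continuousOn_fst fun a ha => ha.1
  have hstate := continuousOn_shiftedState_comp hγ x hw' hH hHt'
  have hfield := continuousOn_shiftedField_comp hV hVp hL hγ x hw' hH hHt'
  have hlag := continuousOn_reducedLagrangian hL hγ hV hVp hw' hH hHt'
  have hvel : ContinuousOn (fun a : ℝ × Y => velInChart V x (H a.1 a.2)) (Icc s t ×ˢ U) :=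
    continuous_fst.comp_continuousOn hfield
  have hvel' : ContinuousOn (fun a : ℝ × Y => (fderiv ℝ (velInChart V x) (H a.1 a.2)).comp
      (H' a.1 a.2)) (Icc s t ×ˢ U) :=
    (((contDiffOn_velInChart hV hVp x).continuousOn_fderiv_of_isOpen
      ((chartAt E x).open_target.prod isOpen_univ) le_rfl).comp hH hHt').clm_comp hH'
  have hint : ∀ r ∈ Icc s t, ∀ y ∈ U, IntervalIntegrable
      (fun r => shiftedField L V γ x (w r) (H r y)) volume s r := fun r hr y hy =>
    ((continuousOn_slice (φ := fun r y => shiftedField L V γ x (w r) (H r y)) hfield hy).mono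
      (Icc_subset_Icc_right hr.2)).intervalIntegrable_of_Icc hr.1
  -- The action yields the increment of `p̃ dq`, with shifted momentum `c` and force `k`; both
  -- primitive relations are the components of the integral equation.
  have hact := fun y₀ (hy₀ : y₀ ∈ U) => hasFDerivAt_action hst hU
    (ξ := fun r y => (H r y).1) (u := fun r y => velInChart V x (H r y))
    (ξ' := fun r y => (ContinuousLinearMap.fst ℝ E (E →L[ℝ] ℝ)).comp (H' r y))
    (u' := fun r y => (fderiv ℝ (velInChart V x) (H r y)).comp (H' r y))
    (c := fun r y => (shiftedState γ x (w r) (H r y)).2)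
    (k := fun r y => (shiftedField L V γ x (w r) (H r y)).2)
    (f := fun r y => reducedLagrangian L V γ x (w r) (H r y))
    (fun y hy => continuousOn_slice
      (φ := fun r y => reducedLagrangian L V γ x (w r) (H r y)) hlag hy)
    (fun r hr y hy => hasFDerivAt_fst.comp y (hHd r hr y hy))
    (fun r hr y hy => (hasFDerivAt_velInChart hV hVp (hHt r hr y hy).1).comp y (hHd r hr y hy))
    (continuousOn_const.clm_comp hH') hvel hvel'
    (continuous_snd.comp_continuousOn hstate) (continuous_snd.comp_continuousOn hfield)
    (fun r hr y hy => (congrArg Prod.fst (heq r hr y hy)).trans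
      ((ContinuousLinearMap.fst ℝ E (E →L[ℝ] ℝ)).intervalIntegral_comp_comm (hint r hr y hy)).symm)
    (fun r hr y hy => (congrArg Prod.snd (heq r hr y hy)).trans
      ((ContinuousLinearMap.snd ℝ E (E →L[ℝ] ℝ)).intervalIntegral_comp_comm (hint r hr y hy)).symm)
    (fun r hr y hy => ((hasFDerivAt_reducedLagrangian hL hγ hV hVL (w r)
      (hHt r hr y hy).1).comp y (hHd r hr y hy)).congr_fderiv
        (ContinuousLinearMap.ext fun _ => rfl)) hy₀
  have hpot : ∀ r ∈ Icc s t, ∀ y ∈ U, HasFDerivAt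
      (fun y => ∑ i, w r i • γ i ((chartAt E x).symm (H r y).1))
      (∑ i, w r i • (dpot (γ i) x (H r y).1).comp
        ((ContinuousLinearMap.fst ℝ E (E →L[ℝ] ℝ)).comp (H' r y))) y := by
    intro r hr y hy
    refine HasFDerivAt.fun_sum fun i _ => HasFDerivAt.const_smul ?_ (w r i)
    exact HasFDerivAt.comp (g := fun e => γ i ((chartAt E x).symm e)) y
      (hasFDerivAt_potential (hγ i) (hHt r hr y hy).1) (hasFDerivAt_fst.comp y (hHd r hr y hy))
  -- The boundary terms `∑ wᵢ γᵢ(q)` at `t` and at `s` undo the shift, since their differentials are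
  -- the missing `∑ wᵢ dγᵢ(q) dq`.
  refine ⟨fun y => (∫ r in s..t, reducedLagrangian L V γ x (w r) (H r y)) +
    ((∑ i, w t i • γ i ((chartAt E x).symm (H t y).1)) -
      ∑ i, w s i • γ i ((chartAt E x).symm (H s y).1)), fun y hy => ?_⟩
  refine ((hact y hy).add ((hpot t (right_mem_Icc.2 hst) y hy).sub
    (hpot s (left_mem_Icc.2 hst) y hy))).congr_fderiv ?_
  refine ContinuousLinearMap.ext fun u => ?_
  simp only [sub_apply, add_apply, ContinuousLinearMap.comp_apply, sum_apply,
    smul_apply, shiftedState]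
  ring

end FirstVariation

/-! ### Conservation of the symplectic form by driven flows of class `C¹`. -/

/-- A map that is jointly continuous on a product set takes short time intervals and small
neighbourhoods into a given open set. -/
theorem exists_box {X M : Type*} [TopologicalSpace X] [TopologicalSpace M] {a b t₀ : ℝ}
    (ht₀ : t₀ ∈ Icc a b) {U₀ : Set X} (hU₀ : IsOpen U₀) {G : ℝ → X → M}
    (hG : ContinuousOn (fun x : ℝ × X => G x.1 x.2) (Icc a b ×ˢ U₀)) {y₀ : X} (hy₀ : y₀ ∈ U₀)
    {O : Set M} (hO : IsOpen O) (h : G t₀ y₀ ∈ O) {ε : ℝ} (hε : 0 < ε) :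
    ∃ α β, t₀ ∈ Icc α β ∧ Icc α β ⊆ Icc a b ∧ β - α ≤ ε ∧ Icc α β ∈ 𝓝[Icc a b] t₀ ∧
      ∃ U, IsOpen U ∧ y₀ ∈ U ∧ U ⊆ U₀ ∧ ∀ r ∈ Icc α β, ∀ y ∈ U, G r y ∈ O := by
  have h1 := hG (t₀, y₀) ⟨ht₀, hy₀⟩ (hO.mem_nhds h)
  rw [nhdsWithin_prod_eq, hU₀.nhdsWithin_eq hy₀] at h1
  obtain ⟨T, hT, U₁, hU₁, hTU⟩ := mem_prod_iff.1 (mem_map.1 h1)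
  obtain ⟨ε', hε', hball⟩ := Metric.mem_nhdsWithin_iff.1 hT
  -- Strictly below `ε'`, so that the closed interval of radius `δ` lies in the open ball, and at
  -- most `ε / 2`, since the interval has length at most `2 * δ`.
  obtain ⟨δ, hδ, hδε⟩ : ∃ δ, 0 < δ ∧ δ < ε' ∧ 2 * δ ≤ ε := by
    refine ⟨min (ε' / 2) (ε / 2), by positivity, ?_, ?_⟩
    · linarith [min_le_left (ε' / 2) (ε / 2)]
    · linarith [min_le_right (ε' / 2) (ε / 2)]
  have hIcc : Icc (max a (t₀ - δ)) (min b (t₀ + δ)) = Icc a b ∩ Icc (t₀ - δ) (t₀ + δ) :=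
    Icc_inter_Icc.symm
  refine ⟨max a (t₀ - δ), min b (t₀ + δ), ?_, ?_, ?_, ?_, interior U₁ ∩ U₀,
    isOpen_interior.inter hU₀, ⟨mem_interior_iff_mem_nhds.2 hU₁, hy₀⟩, inter_subset_right, ?_⟩
  · rw [hIcc]
    exact ⟨ht₀, by linarith, by linarith⟩
  · rw [hIcc]
    exact inter_subset_left
  · linarith [min_le_right b (t₀ + δ), le_max_right a (t₀ - δ)]
  · rw [hIcc]
    exact inter_mem_nhdsWithin _ (Icc_mem_nhds (by linarith) (by linarith))
  · intro r hr y hy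
    rw [hIcc] at hr
    refine hTU (a := (r, y)) ⟨hball ⟨?_, hr.1⟩, interior_subset hy.1⟩
    rw [Metric.mem_ball, Real.dist_eq, abs_lt]
    constructor <;> linarith [hr.2.1, hr.2.2]

section Conservation

variable {E : Type*} [NormedAddCommGroup E] [NormedSpace ℝ E]
  {Q : Type*} [TopologicalSpace Q] [ChartedSpace E Q] [IsManifold 𝓘(ℝ, E) ∞ Q]
  {m : ℕ} {L : TangentBundle 𝓘(ℝ, E) Q → ℝ} {V : Cotangent E Q → TangentBundle 𝓘(ℝ, E) Q}
  {γ : Fin m → Q → ℝ} {w : ℝ → Fin m → ℝ} {a b : ℝ} {Φ : ℝ → Cotangent E Q → Cotangent E Q}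

theorem IsDrivenFlow.continuousOn_comp_coord_symm (hΦ : IsDrivenFlow L V γ w a b Φ) (x : Q) :
    ContinuousOn (fun y : ℝ × (E × (E →L[ℝ] ℝ)) => Φ y.1 ((coord E x).symm y.2))
      (Icc a b ×ˢ (coord E x).target) :=
  hΦ.continuous.comp (f := fun y : ℝ × (E × (E →L[ℝ] ℝ)) => (y.1, (coord E x).symm y.2))
    (continuousOn_fst.prodMk ((continuousOn_coord_symm x).comp continuousOn_snd fun _ hy => hy.2))
    fun _ hy => ⟨hy.1, mem_univ _⟩

theorem IsC1Family.continuousOn_fderiv [FiniteDimensional ℝ E] (hΦ : IsC1Family a b Φ) {T : Set ℝ}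
    (hT : T ⊆ Icc a b) {x₀ x : Q} {U : Set (E × (E →L[ℝ] ℝ))} (hU : U ⊆ (coord E x₀).target)
    (hx : ∀ t ∈ T, ∀ y ∈ U, (Φ t ((coord E x₀).symm y)).proj ∈ (chartAt E x).source) :
    (∀ t ∈ T, ∀ y ∈ U, HasFDerivAt (fun y => coord E x (Φ t ((coord E x₀).symm y)))
      (fderiv ℝ (fun y => coord E x (Φ t ((coord E x₀).symm y))) y) y) ∧
    ContinuousOn (fun r : ℝ × (E × (E →L[ℝ] ℝ)) =>
      fderiv ℝ (fun y => coord E x (Φ r.1 ((coord E x₀).symm y))) r.2) (T ×ˢ U) := by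
  have hd : ∀ t ∈ T, MDifferentiable (cotangentModel E) (cotangentModel E) (Φ t) :=
    fun t ht => (hΦ.1 t (hT ht)).mdifferentiable one_ne_zero
  refine ⟨fun t ht y hy => ?_, ?_⟩
  · exact (differentiableAt_written_of_mdifferentiableAt (p := (⟨x₀, 0⟩ : Cotangent E Q))
      (p' := (⟨x, 0⟩ : Cotangent E Q)) (hU hy) (hd t ht _)
      (mem_cotangent_chart_source.2 (hx t ht y hy))).hasFDerivAt
  · exact continuousOn_fderiv_written (p := (⟨x₀, 0⟩ : Cotangent E Q))
      (p' := (⟨x, 0⟩ : Cotangent E Q)) hU hd (hΦ.2.mono (prod_mono_left hT))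
      fun t ht y hy => mem_cotangent_chart_source.2 (hx t ht y hy)

theorem mfderiv_coord_mfderiv {φ : Cotangent E Q → Cotangent E Q} {z : Cotangent E Q}
    (hφ : MDifferentiableAt (cotangentModel E) (cotangentModel E) φ z) {x₀ x : Q}
    (hx₀ : z.proj ∈ (chartAt E x₀).source) (hx : (φ z).proj ∈ (chartAt E x).source)
    (u : TangentSpace (cotangentModel E) z) :
    (mfderiv (cotangentModel E) 𝓘(ℝ, E × (E →L[ℝ] ℝ)) (coord E x) (φ z)
      (mfderiv (cotangentModel E) (cotangentModel E) φ z u) : E × (E →L[ℝ] ℝ)) =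
    fderiv ℝ (fun y => coord E x (φ ((coord E x₀).symm y))) (coord E x₀ z)
      (mfderiv (cotangentModel E) 𝓘(ℝ, E × (E →L[ℝ] ℝ)) (coord E x₀) z u) := by
  let p : TangentBundle (cotangentModel E) (Cotangent E Q) := ⟨⟨x₀, 0⟩, 0⟩
  let p' : TangentBundle (cotangentModel E) (Cotangent E Q) := ⟨⟨x, 0⟩, 0⟩
  let τ : TangentBundle (cotangentModel E) (Cotangent E Q) := ⟨z, u⟩
  have hs := mem_cotangent_chart_source.2 hx₀
  have hs' := mem_cotangent_chart_source.2 hx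
  have h1 := extChartAt_tangentMap (F := φ) (p := p) (p' := p') (u := τ) hφ hs hs'
  rw [extChartAt_tangent_apply (p := p) (u := τ) hs, extChartAt_tangent_apply (p := p') hs'] at h1
  exact congrArg Prod.snd h1

/-- The symplectic form is preserved by the maps of a driven flow of class `C¹`. -/
theorem IsDrivenFlow.preservesSymplecticForm [FiniteDimensional ℝ E]
    (hΦ : IsDrivenFlow L V γ w a b Φ) (hC : IsC1Family a b Φ) {t : ℝ} (ht : t ∈ Icc a b) :
    PreservesSymplecticForm (Φ t) := by
  intro z₀ u v
  set x₀ := z₀.proj with hx₀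
  have hz₀ : z₀ ∈ (coord E x₀).source := mem_coord_source.2 (mem_chart_source E x₀)
  have hy₀ := (coord E x₀).map_source hz₀
  have hG := hΦ.continuousOn_comp_coord_symm x₀
  set G : ℝ → E × (E →L[ℝ] ℝ) → Cotangent E Q := fun t y => Φ t ((coord E x₀).symm y) with hGdef
  have hGz : ∀ t, G t (coord E x₀ z₀) = Φ t z₀ := fun t =>
    congrArg (Φ t) ((coord E x₀).left_inv hz₀)
  -- The pullback of `Θ` by the flow, written in a chart of the source only. Being independent of
  -- the target chart, it lets increments computed in different target charts be added.
  let B : ℝ → E × (E →L[ℝ] ℝ) → (E × (E →L[ℝ] ℝ) →L[ℝ] ℝ) := fun t y =>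
    (canonicalOneForm (G t y)).comp
      (mfderiv 𝓘(ℝ, E × (E →L[ℝ] ℝ)) (cotangentModel E) (G t) y)
  have hB : ∀ x, ∀ t ∈ Icc a b, ∀ y ∈ (coord E x₀).target, (G t y).proj ∈ (chartAt E x).source →
      B t y = (coord E x (G t y)).2.comp ((ContinuousLinearMap.fst ℝ E (E →L[ℝ] ℝ)).comp
        (fderiv ℝ (fun y => coord E x (G t y)) y)) := by
    intro x t ht y hy hx
    refine ContinuousLinearMap.ext fun v => canonicalOneForm_comp_mfderiv ?_ hx v
    exact ((hC.1 t ht).mdifferentiable one_ne_zero _).comp y (mdifferentiableAt_coord_symm hy)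
  let R : ℝ → ℝ → Prop := fun s t =>
    ∃ S : E × (E →L[ℝ] ℝ) → ℝ, ∀ᶠ y in 𝓝 (coord E x₀ z₀), HasFDerivAt S (B t y - B s y) y
  have hsymm : ∀ s t, R s t → R t s := by
    rintro s t ⟨S, hS⟩
    refine ⟨-S, hS.mono fun y hy => hy.neg.congr_fderiv (neg_sub _ _)⟩
  have hloc : ∀ t₀ ∈ Icc a b, ∀ᶠ t in 𝓝[Icc a b] t₀, R t₀ t := by
    intro t₀ ht₀
    obtain ⟨x, hx, heq⟩ := hΦ.equation (G t₀ (coord E x₀ z₀)).proj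
    obtain ⟨α, β, hαβ, hsub, -, hnhds, U, hU, hyU, hU₀, hbox⟩ := exists_box ht₀
      (isOpen_coord_target x₀) hG hy₀ (isOpen_coord_source x) (mem_coord_source.2 hx) one_pos
    have hR : ∀ s ∈ Icc α β, ∀ t ∈ Icc α β, s ≤ t → R s t := by
      intro s hs t ht hst
      have hst' : Icc s t ⊆ Icc α β := Icc_subset_Icc hs.1 ht.2
      have hsrc : ∀ r ∈ Icc s t, ∀ y ∈ U, (G r y).proj ∈ (chartAt E x).source :=
        fun r hr y hy => mem_coord_source.1 (hbox r (hst' hr) y hy)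
      have hsubG : Icc s t ×ˢ U ⊆ Icc a b ×ˢ (coord E x₀).target :=
        prod_mono (hst'.trans hsub) hU₀
      obtain ⟨hd, hd'⟩ := hC.continuousOn_fderiv (hst'.trans hsub) hU₀ hsrc
      obtain ⟨S, hS⟩ := exists_hasFDerivAt_increment (x := x) (H := fun r y => coord E x (G r y))
        (H' := fun r y => fderiv ℝ (fun y => coord E x (G r y)) y)
        hΦ.lagrangian hΦ.potential hΦ.velocity
        hΦ.legendre hst (hΦ.noise.mono (hst'.trans hsub)) hU
        (fun r hr y hy => coord_mem_target (hsrc r hr y hy))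
        (continuousOn_coord_comp (hG.mono hsubG) fun p hp => hsrc p.1 hp.1 p.2 hp.2) hd hd'
        (fun r hr y hy => heq _ s (hsub hs) r (hsub (hst' hr)) hr.1
          fun r' hr' => hsrc r' ⟨hr'.1, hr'.2.trans hr.2⟩ y hy)
      refine ⟨S, ?_⟩
      filter_upwards [hU.mem_nhds hyU] with y hy
      rw [hB x t (hsub ht) y (hU₀ hy) (hsrc t (right_mem_Icc.2 hst) y hy),
        hB x s (hsub hs) y (hU₀ hy) (hsrc s (left_mem_Icc.2 hst) y hy)]
      exact hS y hy
    filter_upwards [hnhds] with t ht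
    rcases le_total t₀ t with h | h
    · exact hR t₀ hαβ t ht h
    · exact hsymm _ _ (hR t ht t₀ hαβ h)
  have ha : a ∈ Icc a b := left_mem_Icc.2 (ht.1.trans ht.2)
  obtain ⟨S, hS⟩ : R a t := by
    -- Exactness of the increment near the initial point holds for nearby times and is an
    -- equivalence-type relation (primitives add), so connectedness joins `a` to `t`. The
    -- neighbourhoods may shrink, since only germs at the initial point matter.
    refine isPreconnected_Icc.induction₂ R hloc ?_ (fun s t _ _ h => hsymm s t h) ha ht
    rintro r s t - - - ⟨S, hS⟩ ⟨S', hS'⟩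
    refine ⟨S + S', ?_⟩
    filter_upwards [hS, hS'] with y h1 h2
    exact (h1.add h2).congr_fderiv (by abel)
  -- The symplectic form at `Φ t z₀` is defined in the preferred chart there, so the final
  -- comparison uses this chart; the box below is needed only for its neighbourhood `U`, at the
  -- single time `t`.
  set x := (Φ t z₀).proj with hx
  have hxs : (G t (coord E x₀ z₀)).proj ∈ (chartAt E x).source := by
    rw [hGz]
    exact mem_chart_source E x
  obtain ⟨α, β, hαβ, hsub, -, -, U, hU, hyU, hU₀, hbox⟩ := exists_box ht
    (isOpen_coord_target x₀) hG hy₀ (isOpen_coord_source x) (mem_coord_source.2 hxs) one_pos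
  have hsrc : ∀ y ∈ U, (G t y).proj ∈ (chartAt E x).source :=
    fun y hy => mem_coord_source.1 (hbox t hαβ y hy)
  obtain ⟨hd, hd'⟩ := hC.continuousOn_fderiv (T := {t}) (singleton_subset_iff.2 ht) hU₀
    (x := x) (by rintro _ rfl y hy; exact hsrc y hy)
  have hd₀ := hd t rfl
  have hdc : ContinuousOn (fun y => fderiv ℝ (fun y => coord E x (G t y)) y) U :=
    hd'.comp (f := fun y : E × (E →L[ℝ] ℝ) => (t, y)) (by fun_prop) fun y hy => ⟨rfl, hy⟩
  have hBa : ∀ y ∈ (coord E x₀).target,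
      B a y = y.2.comp (ContinuousLinearMap.fst ℝ E (E →L[ℝ] ℝ)) := by
    intro y hy
    have h1 : ∀ y, G a y = (coord E x₀).symm y := fun y => hΦ.start _
    have h2 : (fun y => coord E x₀ (G a y)) =ᶠ[𝓝 y] id := by
      filter_upwards [(isOpen_coord_target x₀).mem_nhds hy] with y' hy'
      rw [h1]
      exact (coord E x₀).right_inv hy'
    rw [hB x₀ a ha y hy, h2.fderiv_eq, fderiv_id, ContinuousLinearMap.comp_id]
    · exact congrArg (fun v : E × (E →L[ℝ] ℝ) => v.2.comp (ContinuousLinearMap.fst ℝ E (E →L[ℝ] ℝ)))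
        h2.self_of_nhds
    · rw [h1]
      exact mem_coord_source.1 ((coord E x₀).map_target hy)
  have hwedge := wedge_eq_of_exact (S := S)
    (p := fun y => (coord E x (G t y)).2) (q := fun y => (coord E x (G t y)).1)
    (p₂ := fun y => y.2) (q₂ := fun y => y.1)
    (q' := fun y => (ContinuousLinearMap.fst ℝ E (E →L[ℝ] ℝ)).comp
      (fderiv ℝ (fun y => coord E x (G t y)) y))
    (q₂' := fun _ => ContinuousLinearMap.fst ℝ E (E →L[ℝ] ℝ))
    (p' := (ContinuousLinearMap.snd ℝ E (E →L[ℝ] ℝ)).comp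
      (fderiv ℝ (fun y => coord E x (G t y)) (coord E x₀ z₀)))
    (p₂' := ContinuousLinearMap.snd ℝ E (E →L[ℝ] ℝ)) (y₀ := coord E x₀ z₀)
    (by filter_upwards [hU.mem_nhds hyU] with y hy using hasFDerivAt_fst.comp y (hd₀ y hy))
    (continuousAt_const.clm_comp (hdc.continuousAt (hU.mem_nhds hyU)))
    (hasFDerivAt_snd.comp _ (hd₀ _ hyU))
    (Eventually.of_forall fun y => hasFDerivAt_fst) continuousAt_const hasFDerivAt_snd
    (by
      filter_upwards [hU.mem_nhds hyU, hS] with y hy h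
      rwa [hB x t ht y (hU₀ hy) (hsrc y hy), hBa y (hU₀ hy)] at h)
  have hD := mfderiv_coord_mfderiv ((hC.1 t ht).mdifferentiable one_ne_zero z₀)
    (mem_chart_source E x₀) (mem_chart_source E x)
  rw [canonicalSymplecticForm_apply, canonicalSymplecticForm_apply]
  -- The vectors enter in reversed order because `hwedge` concerns `dp ∧ dq` whereas `κ = dq ∧ dp`.
  have h1 := hwedge (mfderiv (cotangentModel E) 𝓘(ℝ, E × (E →L[ℝ] ℝ)) (coord E x₀) z₀ v)
    (mfderiv (cotangentModel E) 𝓘(ℝ, E × (E →L[ℝ] ℝ)) (coord E x₀) z₀ u)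
  have hpair : ∀ u₁ u₂ v₁ v₂ : E × (E →L[ℝ] ℝ), u₁ = u₂ → v₁ = v₂ →
      v₁.2 u₁.1 - u₁.2 v₁.1 = v₂.2 u₂.1 - u₂.2 v₂.1 := by
    rintro _ _ _ _ rfl rfl
    rfl
  exact (hpair _ _ _ _ (hD u) (hD v)).trans h1

end Conservation

/-! ### Driven flows with `C³` potentials are of class `C¹`. -/

theorem continuousOn_comp_prodMk {A C Z Z' : Type*} [TopologicalSpace A] [TopologicalSpace C]
    [TopologicalSpace Z] [TopologicalSpace Z'] {f : C → Z → Z'} {S : Set (C × Z)} {T : Set A}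
    (hf : ContinuousOn (fun a : C × Z => f a.1 a.2) S) {c : A → C} {y : A → Z}
    (hc : ContinuousOn c T) (hy : ContinuousOn y T) (h : ∀ p ∈ T, (c p, y p) ∈ S) :
    ContinuousOn (fun p => f (c p) (y p)) T :=
  hf.comp (hc.prodMk hy) h

/-- The noise is only continuous in time, so it enters as a parameter `c`. Joint continuity of the
partial derivative in `(c, y)` survives the substitution of a continuous path for `c`. -/
theorem ContDiffOn.hasFDerivAt_comp_prodMk {C Z Z' : Type*} [NormedAddCommGroup C]
    [NormedSpace ℝ C] [NormedAddCommGroup Z] [NormedSpace ℝ Z] [NormedAddCommGroup Z']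
    [NormedSpace ℝ Z'] {f : C → Z → Z'} {O : Set Z} (hO : IsOpen O)
    (hf : ContDiffOn ℝ 1 (fun a : C × Z => f a.1 a.2) (univ ×ˢ O)) :
    ∃ f' : C → Z → Z →L[ℝ] Z', (∀ c, ∀ y ∈ O, HasFDerivAt (f c) (f' c y) y) ∧
      ContinuousOn (fun a : C × Z => f' a.1 a.2) (univ ×ˢ O) := by
  refine ⟨fun c y => (fderiv ℝ (fun a : C × Z => f a.1 a.2) (c, y)).comp
    (ContinuousLinearMap.inr ℝ C Z), fun c y hy => ?_, ?_⟩
  · have h1 : HasFDerivAt (fun a : C × Z => f a.1 a.2) _ (c, y) :=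
      ((hf.contDiffAt ((isOpen_univ.prod hO).mem_nhds ⟨mem_univ _, hy⟩)).differentiableAt
        one_ne_zero).hasFDerivAt
    exact HasFDerivAt.comp (g := fun a : C × Z => f a.1 a.2) y h1 (hasFDerivAt_prodMk_right c y)
  · exact (hf.continuousOn_fderiv_of_isOpen (isOpen_univ.prod hO) le_rfl).clm_comp
      continuousOn_const

section Smoothness

variable {E : Type*} [NormedAddCommGroup E] [NormedSpace ℝ E]
  {Q : Type*} [TopologicalSpace Q] [ChartedSpace E Q] [IsManifold 𝓘(ℝ, E) ∞ Q]
  {m : ℕ} {L : TangentBundle 𝓘(ℝ, E) Q → ℝ} {V : Cotangent E Q → TangentBundle 𝓘(ℝ, E) Q}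
  {γ : Fin m → Q → ℝ} {w : ℝ → Fin m → ℝ} {a b : ℝ} {Φ : ℝ → Cotangent E Q → Cotangent E Q}

-- The shift changes only the momentum, by an amount depending only on `q`, so the opposite noise
-- value undoes it. This expresses the state through the shifted state and closes the equation.
omit [IsManifold 𝓘(ℝ, E) ∞ Q] in
theorem shiftedState_neg_shiftedState (γ : Fin m → Q → ℝ) (x : Q) (c : Fin m → ℝ)
    (y : E × (E →L[ℝ] ℝ)) : shiftedState γ x (-c) (shiftedState γ x c y) = y := by
  refine Prod.ext rfl ?_
  have h : ∑ i, (-c) i • dpot (γ i) x y.1 = -∑ i, c i • dpot (γ i) x y.1 := by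
    rw [← Finset.sum_neg_distrib]
    exact Finset.sum_congr rfl fun i _ => neg_smul (c i) (dpot (γ i) x y.1)
  change y.2 - ∑ i, c i • dpot (γ i) x y.1 - ∑ i, (-c) i • dpot (γ i) x y.1 = y.2
  rw [h, sub_neg_eq_add, sub_add_cancel]

/-- The vector field governing the shifted state. -/
noncomputable def drivenField (L : TangentBundle 𝓘(ℝ, E) Q → ℝ)
    (V : Cotangent E Q → TangentBundle 𝓘(ℝ, E) Q) (γ : Fin m → Q → ℝ) (x : Q) (c : Fin m → ℝ)
    (y : E × (E →L[ℝ] ℝ)) : E × (E →L[ℝ] ℝ) :=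
  shiftedField L V γ x c (shiftedState γ x (-c) y)

theorem contDiffOn_shiftedState_neg (hγ : ∀ i, ContMDiff 𝓘(ℝ, E) 𝓘(ℝ, ℝ) 2 (γ i)) (x : Q) :
    ContDiffOn ℝ 1 (fun a : (Fin m → ℝ) × (E × (E →L[ℝ] ℝ)) => shiftedState γ x (-a.1) a.2)
      (univ ×ˢ ((chartAt E x).target ×ˢ univ)) :=
  (contDiffOn_shiftedState hγ x (k := 1) (by norm_num)).comp
    (f := fun a : (Fin m → ℝ) × (E × (E →L[ℝ] ℝ)) => (-a.1, a.2))
    (contDiff_fst.neg.prodMk contDiff_snd).contDiffOn fun _ ha => ⟨mem_univ _, ha.2⟩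

/-- The third derivative of the potentials is spent here: the field contains second derivatives and
has to be `C¹`. -/
theorem contDiffOn_drivenField (hL : ContMDiff 𝓘(ℝ, E).tangent 𝓘(ℝ, ℝ) 2 L)
    (hγ : ∀ i, ContMDiff 𝓘(ℝ, E) 𝓘(ℝ, ℝ) 3 (γ i))
    (hV : ContMDiff (cotangentModel E) 𝓘(ℝ, E).tangent 1 V) (hVp : ∀ z, (V z).proj = z.proj)
    (x : Q) :
    ContDiffOn ℝ 1 (fun a : (Fin m → ℝ) × (E × (E →L[ℝ] ℝ)) => drivenField L V γ x a.1 a.2)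
      (univ ×ˢ ((chartAt E x).target ×ˢ univ)) := by
  have hn : (1 : WithTop ℕ∞) + 1 + 1 ≤ 3 := by norm_num
  have h2 : (2 : WithTop ℕ∞) ≤ 3 := by norm_num
  exact (contDiffOn_shiftedField hV hVp hL hγ x hn le_rfl).comp
    (f := fun a : (Fin m → ℝ) × (E × (E →L[ℝ] ℝ)) => (a.1, shiftedState γ x (-a.1) a.2))
    (contDiff_fst.contDiffOn.prodMk
      (contDiffOn_shiftedState_neg (fun i => (hγ i).of_le h2) x))
    fun _ ha => ⟨mem_univ _, ha.2.1, mem_univ _⟩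

theorem contDiffAt_written {φ : Cotangent E Q → Cotangent E Q} {z : Cotangent E Q} {x₀ x : Q}
    (hφ : ContMDiffAt (cotangentModel E) (cotangentModel E) 1 φ z)
    (hx₀ : z.proj ∈ (chartAt E x₀).source) (hx : (φ z).proj ∈ (chartAt E x).source) :
    ContDiffAt ℝ 1 (fun y => coord E x (φ ((coord E x₀).symm y))) (coord E x₀ z) := by
  have h := ((contMDiffAt_iff_of_mem_source (x := (⟨x₀, 0⟩ : Cotangent E Q))
    (y := (⟨x, 0⟩ : Cotangent E Q)) (mem_cotangent_chart_source.2 hx₀)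
    (mem_cotangent_chart_source.2 hx)).1 hφ).2
  rw [ModelWithCorners.range_eq_univ, contDiffWithinAt_univ] at h
  exact h

/-- Close to a given time and point, the maps of a driven flow are of class `C¹` with jointly
continuous tangent maps as soon as one of them is of class `C¹` at the point. -/
theorem IsDrivenFlow.exists_contMDiffAt [FiniteDimensional ℝ E]
    (hΦ : IsDrivenFlow L V γ w a b Φ) (hγ : ∀ i, ContMDiff 𝓘(ℝ, E) 𝓘(ℝ, ℝ) 3 (γ i))
    (z₀ : Cotangent E Q) {t₀ : ℝ} (ht₀ : t₀ ∈ Icc a b) :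
    ∃ T ∈ 𝓝[Icc a b] t₀, t₀ ∈ T ∧ ∀ s ∈ T,
      ContMDiffAt (cotangentModel E) (cotangentModel E) 1 (Φ s) z₀ →
      (∀ t ∈ T, ContMDiffAt (cotangentModel E) (cotangentModel E) 1 (Φ t) z₀) ∧
      ∃ N ∈ 𝓝 z₀, ContinuousOn
        (fun x : ℝ × TangentBundle (cotangentModel E) (Cotangent E Q) =>
          tangentMap (cotangentModel E) (cotangentModel E) (Φ x.1) x.2)
        (T ×ˢ {u | u.proj ∈ N}) := by
  have hVp : ∀ z, (V z).proj = z.proj := fun z => congrArg TotalSpace.proj (hΦ.legendre z)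
  set x₀ := z₀.proj with hx₀
  have hz₀ : z₀ ∈ (coord E x₀).source := mem_coord_source.2 (mem_chart_source E x₀)
  have hy₀ := (coord E x₀).map_source hz₀
  have hG := hΦ.continuousOn_comp_coord_symm x₀
  set G : ℝ → E × (E →L[ℝ] ℝ) → Cotangent E Q := fun t y => Φ t ((coord E x₀).symm y) with hGdef
  set y₀ := coord E x₀ z₀ with hy₀def
  have hGz : ∀ t, G t y₀ = Φ t z₀ := fun t => congrArg (Φ t) ((coord E x₀).left_inv hz₀)
  obtain ⟨x, hx, heq⟩ := hΦ.equation (G t₀ y₀).proj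
  obtain ⟨α₁, β₁, hαβ₁, hsub₁, -, hnhds₁, U₁, hU₁, hyU₁, hU₁₀, hbox₁⟩ := exists_box ht₀
    (isOpen_coord_target x₀) hG hy₀ (isOpen_coord_source x) (mem_coord_source.2 hx) one_pos
  have hsrc : ∀ r ∈ Icc α₁ β₁, ∀ y ∈ U₁, (G r y).proj ∈ (chartAt E x).source :=
    fun r hr y hy => mem_coord_source.1 (hbox₁ r hr y hy)
  have hHc := continuousOn_coord_comp (hG.mono (prod_mono hsub₁ hU₁₀))
    fun p hp => hsrc p.1 hp.1 p.2 hp.2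
  have hwc : ContinuousOn (fun p : ℝ × (E × (E →L[ℝ] ℝ)) => w p.1) (Icc α₁ β₁ ×ˢ U₁) :=
    (hΦ.noise.mono hsub₁).comp continuousOn_fst fun p hp => hp.1
  have hgc := continuousOn_shiftedState_comp hΦ.potential x hwc hHc
    fun p hp => coord_mem_target (hsrc p.1 hp.1 p.2 hp.2)
  set g : ℝ → E × (E →L[ℝ] ℝ) → E × (E →L[ℝ] ℝ) :=
    fun r y => shiftedState γ x (w r) (coord E x (G r y)) with hg
  have hOpen : IsOpen ((chartAt E x).target ×ˢ (univ : Set (E →L[ℝ] ℝ))) :=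
    (chartAt E x).open_target.prod isOpen_univ
  obtain ⟨X', hX', hX'c⟩ := ContDiffOn.hasFDerivAt_comp_prodMk hOpen
    (contDiffOn_drivenField hΦ.lagrangian hγ hΦ.velocity hVp x)
  obtain ⟨T', hT', hT'c⟩ := ContDiffOn.hasFDerivAt_comp_prodMk hOpen
    (f := fun c y => shiftedState γ x (-c) y) (contDiffOn_shiftedState_neg hΦ.potential x)
  have hXc := (contDiffOn_drivenField hΦ.lagrangian hγ hΦ.velocity hVp x).continuousOn
  have hg₀ : g t₀ y₀ ∈ (chartAt E x).target ×ˢ (univ : Set (E →L[ℝ] ℝ)) :=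
    ⟨(coord_mem_target hx).1, mem_univ _⟩
  obtain ⟨M, hM⟩ : ∃ M : ℝ, ‖X' (w t₀) (g t₀ y₀)‖ < M := exists_gt _
  have hM0 : 0 < M := (norm_nonneg _).trans_lt hM
  -- The ball in state space is the convex set required by `exists_hasFDerivAt_flow`; on it the
  -- derivative of the field is bounded by `M` for all nearby noise values.
  obtain ⟨δ, hδ, hball⟩ : ∃ δ > 0, Metric.ball (w t₀) δ ×ˢ Metric.ball (g t₀ y₀) δ ⊆
      {p | p.2 ∈ (chartAt E x).target ×ˢ (univ : Set (E →L[ℝ] ℝ)) ∧ ‖X' p.1 p.2‖ < M} := by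
    have h1 : {p : (Fin m → ℝ) × (E × (E →L[ℝ] ℝ)) |
        p.2 ∈ (chartAt E x).target ×ˢ (univ : Set (E →L[ℝ] ℝ)) ∧ ‖X' p.1 p.2‖ < M} ∈
        𝓝 (w t₀, g t₀ y₀) := by
      have hmem := (isOpen_univ.prod hOpen).mem_nhds
        (show (w t₀, g t₀ y₀) ∈ univ ×ˢ _ from ⟨mem_univ _, hg₀⟩)
      filter_upwards [hmem, (hX'c.continuousAt hmem).norm.eventually_lt continuousAt_const hM]
        with p hp hp' using ⟨hp.2, hp'⟩
    obtain ⟨δ, hδ, h⟩ := Metric.mem_nhds_iff.1 h1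
    exact ⟨δ, hδ, by rwa [ball_prod_same]⟩
  -- A second box inside the first keeps noise and shifted state in these balls; the length `1 / (2
  -- * M)` yields the smallness condition `M * (β - α) ≤ 1 / 2`.
  obtain ⟨α, β, hαβ, hsub, hlen, hnhds, U, hU, hyU, hU₀, hbox⟩ := exists_box hαβ₁ hU₁
    (G := fun r y => (w r, g r y)) (hwc.prodMk hgc) hyU₁
    (Metric.isOpen_ball.prod Metric.isOpen_ball)
    (show (w t₀, g t₀ y₀) ∈ Metric.ball (w t₀) δ ×ˢ Metric.ball (g t₀ y₀) δ from
      ⟨Metric.mem_ball_self hδ, Metric.mem_ball_self hδ⟩) (ε := 1 / (2 * M)) (by positivity)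
  have hwB : ∀ r ∈ Icc α β, w r ∈ Metric.ball (w t₀) δ := fun r hr => (hbox r hr y₀ hyU).1
  have hgB : ∀ r ∈ Icc α β, ∀ y ∈ U, g r y ∈ Metric.ball (g t₀ y₀) δ := fun r hr y hy =>
    (hbox r hr y hy).2
  have hBt : ∀ r ∈ Icc α β, ∀ y ∈ Metric.ball (g t₀ y₀) δ,
      y ∈ (chartAt E x).target ×ˢ (univ : Set (E →L[ℝ] ℝ)) ∧ ‖X' (w r) y‖ < M := fun r hr y hy =>
    hball (a := (w r, y)) ⟨hwB r hr, hy⟩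
  have hsub' : Icc α β ⊆ Icc a b := hsub.trans hsub₁
  have hwαβ := hΦ.noise.mono hsub'
  have hcomp : ContinuousOn (fun p : ℝ × (E × (E →L[ℝ] ℝ)) => (w p.1, p.2))
      (Icc α β ×ˢ Metric.ball (g t₀ y₀) δ) :=
    (hwαβ.comp continuousOn_fst fun p hp => hp.1).prodMk continuousOn_snd
  have hcompm : MapsTo (fun p : ℝ × (E × (E →L[ℝ] ℝ)) => (w p.1, p.2))
      (Icc α β ×ˢ Metric.ball (g t₀ y₀) δ) (univ ×ˢ ((chartAt E x).target ×ˢ univ)) :=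
    fun p hp => ⟨mem_univ _, (hBt p.1 hp.1 p.2 hp.2).1⟩
  have hint : ∀ s ∈ Icc α β, ∀ r ∈ Icc α β, ∀ y ∈ U,
      g r y - g s y = ∫ τ in s..r, drivenField L V γ x (w τ) (g τ y) := by
    have h1 : ∀ s ∈ Icc α β, ∀ r ∈ Icc α β, s ≤ r → ∀ y ∈ U,
        g r y - g s y = ∫ τ in s..r, drivenField L V γ x (w τ) (g τ y) := by
      intro s hs r hr hsr y hy
      simp only [hg, drivenField, shiftedState_neg_shiftedState]
      exact heq _ s (hsub' hs) r (hsub' hr) hsr fun τ hτ =>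
        hsrc τ (hsub ⟨hs.1.trans hτ.1, hτ.2.trans hr.2⟩) y (hU₀ hy)
    intro s hs r hr y hy
    rcases le_total s r with h | h
    · exact h1 s hs r hr h y hy
    · rw [intervalIntegral.integral_symm, ← h1 r hr s hs h y hy, neg_sub]
  -- The interval is fixed before the time `s` at which smoothness is assumed, so smoothness
  -- propagates both forwards and backwards within it.
  refine ⟨Icc α β, nhdsWithin_le_of_mem hnhds₁ hnhds, hαβ, fun s hs hCs => ?_⟩
  have hH : ContDiffAt ℝ 1 (g s) y₀ := by
    have h1 : ContDiffAt ℝ 1 (fun y => coord E x (G s y)) y₀ :=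
      contDiffAt_written hCs (mem_chart_source E x₀) (hGz s ▸ hsrc s (hsub hs) y₀ (hU₀ hyU))
    have h2 : ContDiffAt ℝ 1 (fun p : (Fin m → ℝ) × (E × (E →L[ℝ] ℝ)) =>
        shiftedState γ x p.1 p.2) (w s, coord E x (G s y₀)) :=
      (contDiffOn_shiftedState hΦ.potential x (k := 1) (by norm_num)).contDiffAt
        ((isOpen_univ.prod hOpen).mem_nhds
          ⟨mem_univ _, coord_mem_target (hsrc s (hsub hs) y₀ (hU₀ hyU))⟩)
    exact ContDiffAt.comp (g := fun p : (Fin m → ℝ) × (E × (E →L[ℝ] ℝ)) =>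
      shiftedState γ x p.1 p.2) (f := fun y => (w s, coord E x (G s y))) y₀ h2
      (contDiffAt_const.prodMk h1)
  obtain ⟨gs', N, hN, hgs'c, hgs'⟩ := contDiffAt_one_iff.1 hH
  set U' := interior N ∩ U with hU'
  have hU'o : IsOpen U' := isOpen_interior.inter hU
  have hyU' : y₀ ∈ U' := ⟨mem_interior_iff_mem_nhds.2 hN, hyU⟩
  have hgcU : ContinuousOn (fun p : ℝ × (E × (E →L[ℝ] ℝ)) => g p.1 p.2) (Icc α β ×ˢ U') :=
    hgc.mono (prod_mono hsub (inter_subset_right.trans hU₀))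
  obtain ⟨g', hg', hg'c⟩ := exists_hasFDerivAt_flow (hαβ.1.trans hαβ.2) hU'o
    (convex_ball (g t₀ y₀) δ) (X := fun r => drivenField L V γ x (w r)) (X' := fun r => X' (w r))
    (fun r hr y hy => hX' (w r) y (hBt r hr y hy).1) (continuousOn_comp_prodMk
      hXc (hwαβ.comp continuousOn_fst fun p hp => hp.1) continuousOn_snd hcompm)
    (hX'c.comp hcomp hcompm) (M := M) (fun r hr y hy => (hBt r hr y hy).2.le)
    (by
      have := mul_le_mul_of_nonneg_left hlen hM0.le
      refine this.trans_eq ?_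
      field_simp)
    hgcU (fun r hr y hy => hgB r hr y hy.2) hs (fun r hr y hy => hint s hs r hr y hy.2)
    (fun y hy => hgs' y (interior_subset hy.1))
    (hgs'c.mono (inter_subset_left.trans interior_subset))
  have hwg : ContinuousOn (fun p : ℝ × (E × (E →L[ℝ] ℝ)) => (w p.1, g p.1 p.2))
      (Icc α β ×ˢ U') :=
    (hwαβ.comp continuousOn_fst fun p hp => hp.1).prodMk hgcU
  have hgt : ∀ r ∈ Icc α β, ∀ y ∈ U', g r y ∈ (chartAt E x).target ×ˢ (univ : Set (E →L[ℝ] ℝ)) :=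
    fun r hr y hy => (hBt r hr _ (hgB r hr y hy.2)).1
  have hwgm : MapsTo (fun p : ℝ × (E × (E →L[ℝ] ℝ)) => (w p.1, g p.1 p.2))
      (Icc α β ×ˢ U') (univ ×ˢ ((chartAt E x).target ×ˢ univ)) :=
    fun p hp => ⟨mem_univ _, hgt p.1 hp.1 p.2 hp.2⟩
  -- The unshifted coordinates are recovered from the shifted ones, so differentiability passes back
  -- by the chain rule through `T'`.
  have hFg : ∀ r, (fun y => coord E x (G r y)) = fun y => shiftedState γ x (-w r) (g r y) :=
    fun r => funext fun y => (shiftedState_neg_shiftedState γ x (w r) _).symm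
  have hsrc' : ∀ r ∈ Icc α β, ∀ y ∈ U', (G r y).proj ∈ (chartAt E x).source :=
    fun r hr y hy => hsrc r (hsub hr) y (hU₀ hy.2)
  obtain ⟨hC, htan⟩ := continuousOn_tangentMap_of_written (I := cotangentModel E)
    (I' := cotangentModel E) (T := Icc α β) hU'o (F := Φ)
    (p := (⟨x₀, 0⟩ : Cotangent E Q)) (p' := (⟨x, 0⟩ : Cotangent E Q))
    (f' := fun r y => (T' (w r) (g r y)).comp (g' r y))
    (fun y hy => hU₁₀ (hU₀ hy.2))
    (fun r hr y _ => (continuousOn_univ.1 (hΦ.continuous.comp (f := fun z => (r, z)) (by fun_prop)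
      fun z _ => ⟨hsub' hr, mem_univ _⟩)).continuousAt)
    (fun r hr y hy => mem_cotangent_chart_source.2 (hsrc' r hr y hy))
    (hHc.mono (prod_mono hsub (inter_subset_right.trans hU₀)))
    ((hT'c.comp hwg hwgm).clm_comp hg'c)
    (fun r hr y hy => by
      have h1 := (hT' (w r) _ (hgt r hr y hy)).comp y (hg' r hr y hy)
      exact (congrArg (fun f => HasFDerivAt f _ y) (hFg r)).mpr h1)
  refine ⟨fun t ht => ?_, (coord E x₀).source ∩ coord E x₀ ⁻¹' U', ?_, ?_⟩
  · have := hC t ht y₀ hyU'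
    rwa [show (extChartAt (cotangentModel E) (⟨x₀, 0⟩ : Cotangent E Q)).symm y₀ = z₀ from
      (coord E x₀).left_inv hz₀] at this
  · exact ((continuousOn_coord x₀).isOpen_inter_preimage (isOpen_coord_source x₀) hU'o).mem_nhds
      ⟨hz₀, hyU'⟩
  · refine htan.mono (prod_mono_right fun u hu => ⟨?_, hu.2⟩)
    exact mem_cotangent_chart_source.2 (mem_coord_source.1 hu.1)

/-- For a fixed point, being `C¹` there is a locally constant property of time by
`IsDrivenFlow.exists_contMDiffAt`. It holds at time `a`, where the map is the identity, hence on all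
of the connected interval; continuity of the tangent maps is then local. -/
theorem IsDrivenFlow.isC1Family [FiniteDimensional ℝ E]
    (hΦ : IsDrivenFlow L V γ w a b Φ) (hγ : ∀ i, ContMDiff 𝓘(ℝ, E) 𝓘(ℝ, ℝ) 3 (γ i)) :
    IsC1Family a b Φ := by
  have hC : ∀ t ∈ Icc a b, ∀ z, ContMDiffAt (cotangentModel E) (cotangentModel E) 1 (Φ t) z := by
    intro t ht z
    have ha : a ∈ Icc a b := left_mem_Icc.2 (ht.1.trans ht.2)
    have h : ContMDiffAt (cotangentModel E) (cotangentModel E) 1 (Φ a) z ↔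
        ContMDiffAt (cotangentModel E) (cotangentModel E) 1 (Φ t) z := by
      refine isPreconnected_Icc.induction₂
        (fun s t => ContMDiffAt (cotangentModel E) (cotangentModel E) 1 (Φ s) z ↔
          ContMDiffAt (cotangentModel E) (cotangentModel E) 1 (Φ t) z) ?_
        (fun _ _ _ _ _ _ h h' => h.trans h') (fun _ _ _ _ h => h.symm) ha ht
      intro t₀ ht₀
      obtain ⟨T, hT, ht₀T, h⟩ := hΦ.exists_contMDiffAt hγ z ht₀
      filter_upwards [hT] with t htT
      exact ⟨fun hC => (h t₀ ht₀T hC).1 t htT, fun hC => (h t htT hC).1 t₀ ht₀T⟩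
    refine h.1 ?_
    have : Φ a = id := funext hΦ.start
    rw [this]
    exact contMDiffAt_id
  refine ⟨fun t ht z => hC t ht z, ?_⟩
  rintro ⟨t₀, u⟩ ⟨ht₀, -⟩
  obtain ⟨T, hT, ht₀T, h⟩ := hΦ.exists_contMDiffAt hγ u.proj ht₀
  obtain ⟨N, hN, hc⟩ := (h t₀ ht₀T (hC t₀ ht₀ _)).2
  refine (hc (t₀, u) ⟨ht₀T, show u.proj ∈ N from mem_of_mem_nhds hN⟩).mono_of_mem_nhdsWithin ?_
  rw [nhdsWithin_prod_eq, nhdsWithin_univ]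
  refine prod_mem_prod hT ?_
  exact (FiberBundle.continuous_proj (E × (E →L[ℝ] ℝ))
    (TangentSpace (cotangentModel E) : Cotangent E Q → Type _)).continuousAt.preimage_mem_nhds hN

end Smoothness

end StochasticHP

theorem mainTheorem4
    {E : Type*} [NormedAddCommGroup E] [NormedSpace ℝ E] [FiniteDimensional ℝ E]
    {Q : Type*} [TopologicalSpace Q] [T2Space Q] [SecondCountableTopology Q]
    [ChartedSpace E Q] [IsManifold 𝓘(ℝ, E) ∞ Q]
    {Ω : Type*} {mΩ : MeasurableSpace Ω} (P : Measure Ω) [IsProbabilityMeasure P]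
    (𝓕 : Filtration ℝ mΩ) (a b : ℝ) (hab : a < b)
    {m : ℕ} (W : Fin m → ℝ → Ω → ℝ) (hW : StochasticHP.IsWienerFamily P 𝓕 a b W)
    (L : TangentBundle 𝓘(ℝ, E) Q → ℝ) (hL : ContMDiff 𝓘(ℝ, E).tangent 𝓘(ℝ, ℝ) 2 L)
    (γ : Fin m → Q → ℝ) (hγ : ∀ i, ContMDiff 𝓘(ℝ, E) 𝓘(ℝ, ℝ) 2 (γ i))
    (hLegendre : StochasticHP.CanEliminateVelocity L)
    (F : ℝ → Ω → StochasticHP.Cotangent E Q → StochasticHP.Cotangent E Q)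
    (hF : StochasticHP.IsStochasticFlow L γ P 𝓕 W a b F) :
    (∀ᵐ η ∂P, StochasticHP.IsC1Family a b (fun t => F t η) →
      ∀ t ∈ Icc a b, StochasticHP.PreservesSymplecticForm (F t η)) ∧
    ((∀ i, ContMDiff 𝓘(ℝ, E) 𝓘(ℝ, ℝ) 3 (γ i)) →
      ∀ᵐ η ∂P, StochasticHP.IsC1Family a b (fun t => F t η) ∧
        ∀ t ∈ Icc a b, StochasticHP.PreservesSymplecticForm (F t η)) := by
  obtain ⟨V, hV, hVL, hVR⟩ := hLegendre
  have hVp : ∀ z, (V z).proj = z.proj := fun z => congrArg TotalSpace.proj (hVR z)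
  -- Probability ends here: outside one null set the flow is a deterministic driven flow. Of the
  -- Wiener property only continuity of the paths is used.
  have hdriven : ∀ᵐ η ∂P, StochasticHP.IsDrivenFlow L V γ (fun r i => W i r η) a b
      (fun t => F t η) := by
    filter_upwards [hF.ae_satisfiesEquation hW.continuous hL hγ hV hVp hVL,
      ae_all_iff.2 hW.continuous, hF.start, hF.continuous] with η heq hWη hs hc
    exact ⟨hL, hγ, hV, hVR, continuousOn_pi.2 hWη, hs, hc, heq⟩
  refine ⟨?_, fun hγ3 => ?_⟩
  · filter_upwards [hdriven] with η h hC t ht using h.preservesSymplecticForm hC ht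
  · filter_upwards [hdriven] with η h
    exact ⟨h.isC1Family hγ3, fun t ht => h.preservesSymplecticForm (h.isC1Family hγ3) ht⟩
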